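/- Let $n\ge 2$, let $\Omega\subset\mathbb R^n$ be a bounded domain with $C^2$ boundary and outward unit normal $\nu$, let $0<T<\infty$, and put $Q=(0,T)\times\Omega$, $\Sigma=(0,T)\times\partial\Omega$. For $\omega\in\mathbb S^{n-1}$ put $\partial\Omega_{\pm,\omega}=\{x\in\partial\Omega:\ \pm\,\nu(x)\cdot\omega\ge 0\}$ and $\Sigma_{\pm,\omega}=(0,T)\times\partial\Omega_{\pm,\omega}$; let $\sigma$ be the surface measure on $\partial\Omega$, and let $M\ge 0$. Then there are constants $\lambda_1>1$ and $C>0$, depending only on $\Omega$, $T$ and $M$, such that for every $\omega\in\mathbb S^{n-1}$, every real-valued $q\in L^\infty(Q)$ with $\|q\|_{L^\infty(Q)}\le M$ and every complex-valued $u\in C^2(\overline Q)$ with $u|_\Sigma=0$ the following hold. (a) If $u|_{t=0}=\partial_tu|_{t=0}=0$ on $\Omega$, then for all $\lambda\ge\lambda_1$ $$\begin{aligned} &\lambda\int_\Omega e^{-2\lambda(T+\omega\cdot x)}|\partial_tu(T,x)|^2\,dx+\lambda\int_{\Sigma_{+,\omega}}e^{-2\lambda(t+\omega\cdot x)}|\partial_\nu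 u|^2\,|\omega\cdot\nu(x)|\,d\sigma(x)\,dt+\lambda^2\int_Qe^{-2\lambda(t+\omega\cdot x)}|u|^2\,dx\,dt\\ &\le C\Big(\int_Qe^{-2\lambda(t+\omega\cdot x)}|(\partial_t^2-\Delta_x+q)u|^2\,dx\,dt+\lambda^3\int_\Omega e^{-2\lambda(T+\omega\cdot x)}|u(T,x)|^2\,dx+\lambda\int_\Omega e^{-2\lambda(T+\omega\cdot x)}|\nabla_xu(T,x)|^2\,dx\Big)\\ &\quad+C\lambda\int_{\Sigma_{-,\omega}}e^{-2\lambda(t+\omega\cdot x)}|\partial_\nu u|^2\,|\omega\cdot\nu(x)|\,d\sigma(x)\,dt . \end{aligned}$$ (b) If $u|_{t=T}=\partial_tu|_{t=T}=0$ on $\Omega$, then for all $\lambda\ge\lambda_1$ $$\begin{aligned} &\lambda\int_\Omega e^{2\lambda\,\omega\cdot x}|\partial_tu(0,x)|^2\,dx+\lambda\int_{\Sigma_{-,\omega}}e^{2\lambda(t+\omega\cdot x)}|\partial_\nu u|^2\,|\omega\cdot\nu(x)|\,d\sigma(x)\,dt+\lambda^2\int_Qe^{2\lambda(t+\omega\cdot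 x)}|u|^2\,dx\,dt\\ &\le C\Big(\int_Qe^{2\lambda(t+\omega\cdot x)}|(\partial_t^2-\Delta_x+q)u|^2\,dx\,dt+\lambda^3\int_\Omega e^{2\lambda\,\omega\cdot x}|u(0,x)|^2\,dx+\lambda\int_\Omega e^{2\lambda\,\omega\cdot x}|\nabla_xu(0,x)|^2\,dx\Big)\\ &\quad+C\lambda\int_{\Sigma_{+,\omega}}e^{2\lambda(t+\omega\cdot x)}|\partial_\nu u|^2\,|\omega\cdot\nu(x)|\,d\sigma(x)\,dt . \end{aligned}$$ -/

import Mathlib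

open Set MeasureTheory Laplacian
open scoped ENNReal NNReal RealInnerProductSpace

noncomputable section

/-- A bounded domain (open connected set) of `ℝⁿ` with `C²` boundary. The last field says that near
every boundary point, for suitable orthonormal coordinates whose last axis is the unit vector `e`,
the set is the part lying above the graph of a `C²` function `γ` of the other coordinates; the point
`x - ⟪e, x⟫ • e` of the hyperplane orthogonal to `e` stands for these other coordinates of `x`. -/
structure IsBoundedC2Domain {n : ℕ} (Ω : Set (EuclideanSpace ℝ (Fin n))) : Prop where
  isOpen : IsOpen Ω
  isConnected : IsConnected Ω
  isBounded : Bornology.IsBounded Ω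
  graph : ∀ x₀ ∈ frontier Ω, ∃ r : ℝ, 0 < r ∧ ∃ e : EuclideanSpace ℝ (Fin n), ‖e‖ = 1 ∧
    ∃ γ : EuclideanSpace ℝ (Fin n) → ℝ, ContDiff ℝ 2 γ ∧
      ∀ x ∈ Metric.ball x₀ r, (x ∈ Ω ↔ γ (x - ⟪e, x⟫ • e) < ⟪e, x⟫)

/-- `v` is the outward unit normal to `Ω` at the boundary point `x`: directions making an obtuse
angle with `v` enter `Ω`, directions making an acute angle with `v` leave the closure of `Ω`. -/
structure IsOuterUnitNormal {n : ℕ} (Ω : Set (EuclideanSpace ℝ (Fin n)))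
    (x v : EuclideanSpace ℝ (Fin n)) : Prop where
  norm_eq_one : ‖v‖ = 1
  inward : ∀ w : EuclideanSpace ℝ (Fin n), ⟪v, w⟫ < 0 →
    ∃ δ : ℝ, 0 < δ ∧ ∀ s ∈ Ioo (0 : ℝ) δ, x + s • w ∈ Ω
  outward : ∀ w : EuclideanSpace ℝ (Fin n), 0 < ⟪v, w⟫ →
    ∃ δ : ℝ, 0 < δ ∧ ∀ s ∈ Ioo (0 : ℝ) δ, x + s • w ∉ closure Ω

/-- There is at most one outward unit normal at a point. -/
theorem IsOuterUnitNormal.unique {n : ℕ} {Ω : Set (EuclideanSpace ℝ (Fin n))}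
    {x v v' : EuclideanSpace ℝ (Fin n)} (h : IsOuterUnitNormal Ω x v)
    (h' : IsOuterUnitNormal Ω x v') : v = v' := by
  by_contra hne
  have hlt : ⟪v, v'⟫ < 1 :=
    (inner_lt_one_iff_real_of_norm_eq_one h.norm_eq_one h'.norm_eq_one).2 hne
  obtain ⟨δ, hδ, H⟩ := h.inward (v' - v) (by
    rw [inner_sub_right, real_inner_self_eq_norm_sq, h.norm_eq_one]; linarith)
  obtain ⟨δ', hδ', H'⟩ := h'.outward (v' - v) (by
    rw [inner_sub_right, real_inner_self_eq_norm_sq, h'.norm_eq_one, real_inner_comm]; linarith)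
  have hm : 0 < min δ δ' := lt_min hδ hδ'
  have h1 := H (min δ δ' / 2) ⟨by linarith, by linarith [min_le_left δ δ']⟩
  exact H' (min δ δ' / 2) ⟨by linarith, by linarith [min_le_right δ δ']⟩ (subset_closure h1)

open Classical in
/-- The outward unit normal field `ν` of `Ω` (with value `0` where there is no such normal; for a
`C²` domain it exists at every boundary point). -/
def outerNormal {n : ℕ} (Ω : Set (EuclideanSpace ℝ (Fin n))) (x : EuclideanSpace ℝ (Fin n)) :
    EuclideanSpace ℝ (Fin n) :=
  if h : ∃ v, IsOuterUnitNormal Ω x v then h.choose else 0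

/-- The `ω`-shadowed face `∂Ω_{+,ω}`. -/
def facePlus {n : ℕ} (Ω : Set (EuclideanSpace ℝ (Fin n))) (ω : EuclideanSpace ℝ (Fin n)) :
    Set (EuclideanSpace ℝ (Fin n)) :=
  {x | x ∈ frontier Ω ∧ 0 ≤ ⟪outerNormal Ω x, ω⟫}

/-- The `ω`-illuminated face `∂Ω_{-,ω}`. -/
def faceMinus {n : ℕ} (Ω : Set (EuclideanSpace ℝ (Fin n))) (ω : EuclideanSpace ℝ (Fin n)) :
    Set (EuclideanSpace ℝ (Fin n)) :=
  {x | x ∈ frontier Ω ∧ ⟪outerNormal Ω x, ω⟫ ≤ 0}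

/-- The cylinder `Q = (0,T) × Ω`. -/
def cyl {n : ℕ} (T : ℝ) (Ω : Set (EuclideanSpace ℝ (Fin n))) :
    Set (ℝ × EuclideanSpace ℝ (Fin n)) :=
  Ioo (0 : ℝ) T ×ˢ Ω

/-- The surface measure `σ`: the `(n-1)`-dimensional Hausdorff measure of `ℝⁿ`, in the normalization
that agrees with Lebesgue measure on hyperplanes. -/
def surfaceMeasure (n : ℕ) : Measure (EuclideanSpace ℝ (Fin n)) :=
  Measure.euclideanHausdorffMeasure (n - 1)

/-- `∂_t u (t, x)`, for a function on `[0,T] × closure Ω` (one-sided at `t = 0` and `t = T`). -/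
def timeDeriv {n : ℕ} (T : ℝ) (u : ℝ × EuclideanSpace ℝ (Fin n) → ℂ) (t : ℝ)
    (x : EuclideanSpace ℝ (Fin n)) : ℂ :=
  derivWithin (fun s : ℝ => u (s, x)) (Icc 0 T) t

/-- `|∇_x u (t, x)|² = ∑ⱼ |∂_{x_j} u (t, x)|²`. -/
def gradSq {n : ℕ} (u : ℝ × EuclideanSpace ℝ (Fin n) → ℂ) (t : ℝ)
    (x : EuclideanSpace ℝ (Fin n)) : ℝ :=
  ∑ j : Fin n,
    ‖fderiv ℝ (fun y : EuclideanSpace ℝ (Fin n) => u (t, y)) x (EuclideanSpace.single j 1)‖ ^ 2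

/-- The normal derivative `∂_ν u (t, x)` at `x ∈ ∂Ω`; the derivative in `x` is taken within the
closure of `Ω`. -/
def normalDeriv {n : ℕ} (Ω : Set (EuclideanSpace ℝ (Fin n)))
    (u : ℝ × EuclideanSpace ℝ (Fin n) → ℂ) (t : ℝ) (x : EuclideanSpace ℝ (Fin n)) : ℂ :=
  fderivWithin ℝ (fun y : EuclideanSpace ℝ (Fin n) => u (t, y)) (closure Ω) x (outerNormal Ω x)

/-- `(∂_t² - Δ_x + q) u`. -/
def waveOp {n : ℕ} (q : ℝ × EuclideanSpace ℝ (Fin n) → ℝ)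
    (u : ℝ × EuclideanSpace ℝ (Fin n) → ℂ) (p : ℝ × EuclideanSpace ℝ (Fin n)) : ℂ :=
  iteratedDeriv 2 (fun s : ℝ => u (s, p.2)) p.1
    - (Δ (fun y : EuclideanSpace ℝ (Fin n) => u (p.1, y))) p.2 + (q p : ℂ) * u p

end

/-! The phase `t + ω·x` is characteristic for the wave operator `□ = ∂_t² - Δ` because `|ω| = 1`.
Put `v = e^{-λ(t+ω·x)} u` and `Z = ∂_t - ω·∇`. Conjugating `□` by the weight creates no term of
order zero: `e^{-λ(t+ω·x)} □u = □v + 2λ Zv` (`boxOp_exp_mul`). Squaring the right side and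
discarding `(□v)²` leaves `4λ² (Zv)² + 4λ □v Zv`, and each of these two terms supplies part of the
left side of the estimate.

The product `2 □v Zv` is an exact space-time divergence (`setIntegral_boxOp_mul`). When the Cauchy
data vanish at `t = 0` and `v` vanishes on the lateral boundary, what remains is a quadratic form in
the first derivatives at `t = T` and the flux `|∂_ν v|² ν·ω`, whose sign separates the two faces.
The term `4λ² (Zv)²` controls `λ² v²` by a Poincaré inequality along the lines of `Z`
(`setIntegral_sq_le`). Returning from `v` to `u` costs lower-order terms at `t = T`, which are
exactly the ones allowed on the right (`carleman_real`). Real and imaginary parts are treated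
separately and added. The potential contributes at most a multiple of `M² |u|²`, absorbed into the
`λ² |u|²` term for large `λ`. Part (b) is part (a) for the reflection `t ↦ T - t` with `ω` replaced
by `-ω`.

The divergence theorem is derived by flattening boundary charts. It is not proved for the Hausdorff
measure itself: a boundary measure `μ` glued from graph measures satisfies it, and `μ` and the
surface measure dominate each other up to a constant (`IsBoundedC2Domain.exists_boundaryMeasure`).
This suffices, since after splitting into faces every boundary integrand is nonnegative and the
estimate tolerates constants. -/

section CarlemanEstimate

open Filter Topology

/-! ### Divergence theorem above a graph -/

section GraphDomain

variable {E : Type*} [NormedAddCommGroup E] [InnerProductSpace ℝ E] [FiniteDimensional ℝ E]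
  [MeasurableSpace E] [BorelSpace E]

/-- The orthogonal splitting along `e` preserves volume, and since `e` is a unit vector the line it
spans is isometric to `ℝ`. -/
theorem measurePreserving_hyperplane_add_smul {e : E} (he : ‖e‖ = 1) :
    MeasurePreserving (fun p : (ℝ ∙ e)ᗮ × ℝ => (p.1 : E) + p.2 • e) := by
  have h1 := (Submodule.measurePreserving_measurableEquivProd (ℝ ∙ e) (0 : E)).symm
  rw [InnerProductSpace.euclideanHausdorffMeasure_eq_volume] at h1
  have h2 := (LinearIsometryEquiv.toSpanUnitSingleton e he).measurePreserving
  have h3 := (h2.prod (MeasurePreserving.id (volume : Measure (ℝ ∙ e)ᗮ))).comp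
    (Measure.measurePreserving_swap (μ := (volume : Measure (ℝ ∙ e)ᗮ)) (ν := (volume : Measure ℝ)))
  have h4 := h1.comp h3
  have h5 : (fun p : (ℝ ∙ e)ᗮ × ℝ => (p.1 : E) + p.2 • e) = ((ℝ ∙ e).measurableEquivProd 0).symm ∘
      Prod.map (LinearIsometryEquiv.toSpanUnitSingleton e he) id ∘ Prod.swap := by
    ext p
    simp [Submodule.measurableEquivProd_symm_apply, add_comm]
  rw [h5]
  exact h4

/-- The map flattening the epigraph of `γ` (in direction `e`) to a half space preserves volume. -/
theorem measurePreserving_graph_shear {e : E} (he : ‖e‖ = 1) {γ : E → ℝ} (hγ : Continuous γ) :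
    MeasurePreserving (fun p : (ℝ ∙ e)ᗮ × ℝ => (p.1 : E) + (γ p.1 + p.2) • e) := by
  have h1 : MeasurePreserving (fun p : (ℝ ∙ e)ᗮ × ℝ => (p.1, γ p.1 + p.2)) := by
    refine (MeasurePreserving.id (volume : Measure (ℝ ∙ e)ᗮ)).skew_product
      (g := fun y s => γ y + s) (by fun_prop) ?_
    filter_upwards with y using (measurePreserving_add_left volume (γ y)).map_eq
  exact (measurePreserving_hyperplane_add_smul he).comp h1

omit [FiniteDimensional ℝ E] [MeasurableSpace E] [BorelSpace E] in
theorem inner_hyperplane {e : E} (y : (ℝ ∙ e)ᗮ) : ⟪e, (y : E)⟫ = 0 :=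
  Submodule.mem_orthogonal_singleton_iff_inner_right.1 y.2

/-- Integration by parts against the constant `1`. Only integrability of the one directional
derivative is required, not its continuity; this matters because the derivatives met below are
merely bounded. -/
theorem integral_fderiv_eq_zero_of_hasCompactSupport {V : Type*} [NormedAddCommGroup V]
    [NormedSpace ℝ V] [FiniteDimensional ℝ V] [MeasurableSpace V] [BorelSpace V]
    {μ : Measure V} [μ.IsAddHaarMeasure] {h : V → ℝ} (hd : Differentiable ℝ h)
    (hs : HasCompactSupport h) (w : V) (hi : Integrable (fun x => fderiv ℝ h x w) μ) :
    ∫ x, fderiv ℝ h x w ∂μ = 0 := by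
  have := integral_mul_fderiv_eq_neg_fderiv_mul_of_integrable (μ := μ) (𝕜 := ℝ)
    (f := fun _ : V => (1 : ℝ)) (g := h) (v := w) (by simp) (by simpa using hi)
    (by simpa using hd.continuous.integrable_of_hasCompactSupport hs)
    (by fun_prop) (fun x _ => hd x)
  simpa using this

/-- The shear `Φ (y, s) = y + (γ y + s) e` turns the epigraph into a half space without changing
volume. There `∂_w` splits into a multiple of the vertical derivative `∂_e`, integrated by the
fundamental theorem of calculus along each vertical line, and a derivative tangent to the levels `s
= const`, which integrates to zero by compact support. Smoothness is used only at levels `s > 0`, so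
continuity of `f` up to the graph and a bounded gradient inside are enough. -/
theorem setIntegral_epigraph_fderiv {e : E} (he : ‖e‖ = 1) {γ : E → ℝ} (hγ : ContDiff ℝ 1 γ)
    {f : E → ℝ} (hfc : ContinuousOn f {x | γ (x - ⟪e, x⟫ • e) ≤ ⟪e, x⟫})
    (hfd : ∀ x, γ (x - ⟪e, x⟫ • e) < ⟪e, x⟫ → DifferentiableAt ℝ f x) {B : ℝ}
    (hB : ∀ x, γ (x - ⟪e, x⟫ • e) < ⟪e, x⟫ → ‖fderiv ℝ f x‖ ≤ B) {R : ℝ}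
    (hR : ∀ x, R < ‖x‖ → f x = 0) (w : E) :
    ∫ x in {x | γ (x - ⟪e, x⟫ • e) < ⟪e, x⟫}, fderiv ℝ f x w =
      ∫ y : (ℝ ∙ e)ᗮ, f (y + γ y • e) * (fderiv ℝ γ y (w - ⟪e, w⟫ • e) - ⟪e, w⟫) := by
  have hγc : Continuous γ := hγ.continuous
  have hγd : Differentiable ℝ γ := hγ.differentiable one_ne_zero
  set U : Set E := {x | γ (x - ⟪e, x⟫ • e) < ⟪e, x⟫} with hU
  have hUo : IsOpen U := isOpen_lt (by fun_prop) (by fun_prop)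
  have hee : ⟪e, e⟫ = 1 := by rw [real_inner_self_eq_norm_sq, he]; norm_num
  set Φ : (ℝ ∙ e)ᗮ × ℝ → E := fun p => (p.1 : E) + (γ p.1 + p.2) • e with hΦ
  have hΦm : MeasurePreserving Φ := measurePreserving_graph_shear he hγc
  have hΦc : Continuous Φ := by fun_prop
  have hΦe : ∀ p, ⟪e, Φ p⟫ = γ p.1 + p.2 := by
    intro p
    simp [hΦ, inner_add_right, inner_hyperplane, inner_smul_right, he]
  have hΦp : ∀ p, Φ p - ⟪e, Φ p⟫ • e = p.1 := by
    intro p; rw [hΦe]; simp [hΦ]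
  have hΦn : ∀ p, ‖(p.1 : E)‖ ≤ ‖Φ p‖ := by
    intro p
    have h : ‖Φ p‖ ^ 2 = ‖(p.1 : E)‖ ^ 2 + (γ p.1 + p.2) ^ 2 := by
      rw [hΦ]
      simp only
      rw [norm_add_sq_real, inner_smul_right, real_inner_comm, inner_hyperplane, norm_smul, he]
      simp
    exact le_of_sq_le_sq (by nlinarith) (norm_nonneg _)
  have hΦn' : ∀ p, |γ p.1 + p.2| ≤ ‖Φ p‖ := by
    intro p
    rw [← hΦe]
    simpa [he] using abs_real_inner_le_norm e (Φ p)
  have hΦU : Φ ⁻¹' U = univ ×ˢ Ioi 0 := by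
    ext p
    change γ (Φ p - ⟪e, Φ p⟫ • e) < ⟪e, Φ p⟫ ↔ _
    rw [hΦp, hΦe]
    simp
  have hf0 : ∀ x, R < ‖x‖ → fderiv ℝ f x = 0 := by
    intro x hx
    have : f =ᶠ[nhds x] fun _ => 0 := by
      filter_upwards [(isOpen_lt continuous_const continuous_norm).mem_nhds hx] with z hz
      exact hR z hz
    rw [this.fderiv_eq]; simp
  have hmeas : ∀ v : E, Measurable (fun x => fderiv ℝ f x v) := fun v =>
    measurable_fderiv_apply_const ℝ f v
  have hintU : ∀ v : E, IntegrableOn (fun x => fderiv ℝ f x v) U := by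
    intro v
    have h1 : IntegrableOn (fun x => fderiv ℝ f x v) (U ∩ Metric.closedBall 0 R) := by
      refine Measure.integrableOn_of_bounded (M := B * ‖v‖)
        ((measure_mono inter_subset_right).trans_lt measure_closedBall_lt_top).ne
        (hmeas v).aestronglyMeasurable ?_
      filter_upwards [ae_restrict_mem (hUo.measurableSet.inter measurableSet_closedBall)] with x hx
      exact (ContinuousLinearMap.le_opNorm _ _).trans
        (mul_le_mul_of_nonneg_right (hB x hx.1) (norm_nonneg _))
    refine h1.of_forall_sdiff_eq_zero hUo.measurableSet ?_
    intro x hx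
    have : R < ‖x‖ := by
      by_contra h
      exact hx.2 ⟨hx.1, by simpa using h⟩
    simp [hf0 x this]
  have hres := hΦm.restrict_preimage hUo.measurableSet
  rw [hΦU] at hres
  have hint : ∀ v : E, IntegrableOn (fun p => fderiv ℝ f (Φ p) v) (univ ×ˢ Ioi (0:ℝ)) := fun v =>
    (hres.integrable_comp (hmeas v).aestronglyMeasurable).2 (hintU v)
  set w' : (ℝ ∙ e)ᗮ := ⟨w - ⟪e, w⟫ • e, by
    rw [Submodule.mem_orthogonal_singleton_iff_inner_right, inner_sub_right, inner_smul_right, hee]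
    simp⟩ with hw'
  set c : (ℝ ∙ e)ᗮ → ℝ := fun y => ⟪e, w⟫ - fderiv ℝ γ y w' with hc
  have hcc : Continuous c := by
    have := hγ.continuous_fderiv one_ne_zero
    fun_prop
  -- The coefficient `c` is continuous but possibly unbounded. It may be cut off outside the ball of
  -- radius `R`, since `‖y‖ ≤ ‖Φ (y, s)‖` and the gradient of `f` vanishes beyond `R`.
  have hge : IntegrableOn (fun p : (ℝ ∙ e)ᗮ × ℝ => c p.1 * fderiv ℝ f (Φ p) e)
      (univ ×ˢ Ioi (0:ℝ)) := by
    obtain ⟨D, hD⟩ := (isCompact_closedBall (0 : (ℝ ∙ e)ᗮ) R).exists_bound_of_continuousOn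
      hcc.continuousOn
    have h1 : IntegrableOn (fun p : (ℝ ∙ e)ᗮ × ℝ =>
        (Metric.closedBall (0 : (ℝ ∙ e)ᗮ) R).indicator c p.1 * fderiv ℝ f (Φ p) e)
        (univ ×ˢ Ioi (0:ℝ)) := by
      refine (hint e).bdd_mul (c := max D 0) ?_ ?_
      · exact ((hcc.measurable.indicator measurableSet_closedBall).comp
          measurable_fst).aestronglyMeasurable
      · refine Filter.Eventually.of_forall fun p => ?_
        by_cases hp : p.1 ∈ Metric.closedBall (0 : (ℝ ∙ e)ᗮ) R
        · rw [indicator_of_mem hp]; exact (hD _ hp).trans (le_max_left _ _)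
        · rw [indicator_of_notMem hp]; simp
    refine h1.congr (Filter.Eventually.of_forall fun p => ?_)
    by_cases hp : p.1 ∈ Metric.closedBall (0 : (ℝ ∙ e)ᗮ) R
    · simp only [indicator_of_mem hp]
    · have : R < ‖Φ p‖ := lt_of_lt_of_le (by simpa using hp) (hΦn p)
      simp [hf0 _ this]
  have hprod : (volume : Measure ((ℝ ∙ e)ᗮ × ℝ)).restrict (univ ×ˢ Ioi (0:ℝ)) =
      (volume : Measure (ℝ ∙ e)ᗮ).prod (volume.restrict (Ioi (0:ℝ))) := by
    rw [Measure.volume_eq_prod, ← Measure.prod_restrict, Measure.restrict_univ]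
  have hL : ∫ x in U, fderiv ℝ f x w = ∫ p in univ ×ˢ Ioi (0:ℝ), fderiv ℝ f (Φ p) w := by
    rw [← hres.map_eq, integral_map hres.measurable.aemeasurable
      (hmeas w).aestronglyMeasurable]
  -- the vertical part
  have hvert : ∫ p in univ ×ˢ Ioi (0:ℝ), c p.1 * fderiv ℝ f (Φ p) e =
      ∫ y : (ℝ ∙ e)ᗮ, c y * (- f (y + γ y • e)) := by
    have hi := hint e
    rw [IntegrableOn, hprod] at hge hi
    rw [hprod, integral_prod _ hge]
    refine integral_congr_ae ?_
    filter_upwards [hi.prod_right_ae] with y hy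
    rw [integral_const_mul]
    congr 1
    have hline : ∀ s : ℝ, HasDerivAt (fun s => Φ (y, s)) e s := by
      intro s
      have h0 : HasDerivAt (fun s : ℝ => γ y + s) 1 s := (hasDerivAt_id s).const_add _
      simpa [hΦ] using (h0.smul_const e).const_add (y : E)
    have hmemU : ∀ s : ℝ, 0 < s → Φ (y, s) ∈ U := by
      intro s hs
      have : (y, s) ∈ Φ ⁻¹' U := by rw [hΦU]; exact ⟨mem_univ _, hs⟩
      exact this
    have hft : Filter.Tendsto (fun s => f (Φ (y, s))) Filter.atTop (nhds 0) := by
      refine Filter.Tendsto.congr' ?_ tendsto_const_nhds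
      filter_upwards [Filter.eventually_gt_atTop (R - γ y)] with s hs
      refine (hR _ (lt_of_lt_of_le ?_ (hΦn' (y, s)))).symm
      exact lt_of_lt_of_le (by simp only; linarith) (le_abs_self _)
    have := integral_Ioi_of_hasDerivAt_of_tendsto (a := (0:ℝ)) (f := fun s => f (Φ (y, s)))
      (f' := fun s => fderiv ℝ f (Φ (y, s)) e) (m := 0) ?_ ?_ hy hft
    · rw [this]; simp [hΦ]
    · have hm : ∀ s ∈ Ici (0:ℝ), Φ (y, s) ∈ {x | γ (x - ⟪e, x⟫ • e) ≤ ⟪e, x⟫} := by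
        intro s hs
        change γ (Φ (y, s) - ⟪e, Φ (y, s)⟫ • e) ≤ ⟪e, Φ (y, s)⟫
        rw [hΦp, hΦe]
        have : (0:ℝ) ≤ s := hs
        linarith
      exact (hfc _ (hm 0 self_mem_Ici)).comp (f := fun s => Φ (y, s))
        (by fun_prop : Continuous fun s => Φ (y, s)).continuousWithinAt hm
    · intro s hs
      exact ((hfd _ (hmemU s hs)).hasFDerivAt.comp_hasDerivAt s (hline s))
  -- the horizontal part
  have hhor : ∫ p in univ ×ˢ Ioi (0:ℝ), (fderiv ℝ f (Φ p) w - c p.1 * fderiv ℝ f (Φ p) e) = 0 := by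
    have hi : IntegrableOn (fun p => fderiv ℝ f (Φ p) w - c p.1 * fderiv ℝ f (Φ p) e)
        (univ ×ˢ Ioi (0:ℝ)) := (hint w).sub hge
    rw [IntegrableOn] at hi
    rw [hprod] at hi ⊢
    rw [integral_prod_symm _ hi]
    refine integral_eq_zero_of_ae ?_
    filter_upwards [hi.prod_left_ae, ae_restrict_mem measurableSet_Ioi] with s hs hs0
    have hd : ∀ y : (ℝ ∙ e)ᗮ, HasFDerivAt (fun y : (ℝ ∙ e)ᗮ => f (Φ (y, s)))
        ((fderiv ℝ f (Φ (y, s))).comp ((ℝ ∙ e)ᗮ.subtypeL +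
          ((fderiv ℝ γ y).comp (ℝ ∙ e)ᗮ.subtypeL).smulRight e)) y := by
      intro y
      have hyU : Φ (y, s) ∈ U := by
        have : (y, s) ∈ Φ ⁻¹' U := by rw [hΦU]; exact ⟨mem_univ _, hs0⟩
        exact this
      have h1 : HasFDerivAt (fun y : (ℝ ∙ e)ᗮ => γ y + s)
          ((fderiv ℝ γ y).comp (ℝ ∙ e)ᗮ.subtypeL) y :=
        ((hγd y).hasFDerivAt.comp y (ℝ ∙ e)ᗮ.subtypeL.hasFDerivAt).add_const s
      exact (hfd _ hyU).hasFDerivAt.comp y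
        ((ℝ ∙ e)ᗮ.subtypeL.hasFDerivAt.add (h1.smul_const e))
    -- Moving by `w'` in the hyperplane at fixed `s` also raises the point by `dγ(w')` along `e`.
    -- Since `w = w' + ⟪e, w⟫ e`, the chain rule gives `∂_w - c ∂_e` with `c = ⟪e, w⟫ - dγ(w')`.
    have heq : ∀ y : (ℝ ∙ e)ᗮ, fderiv ℝ (fun y : (ℝ ∙ e)ᗮ => f (Φ (y, s))) y w' =
        fderiv ℝ f (Φ (y, s)) w - c y * fderiv ℝ f (Φ (y, s)) e := by
      intro y
      rw [(hd y).fderiv]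
      have : w = (w' : E) + ⟪e, w⟫ • e := by simp [hw']
      conv_rhs => rw [this]
      simp [hc, hw']
      ring
    simp_rw [← heq] at hs ⊢
    refine integral_fderiv_eq_zero_of_hasCompactSupport (fun y => (hd y).differentiableAt) ?_ _ hs
    refine HasCompactSupport.of_support_subset_isCompact
      (isCompact_closedBall (0 : (ℝ ∙ e)ᗮ) R) ?_
    intro y hy
    by_contra h
    exact hy (hR _ (lt_of_lt_of_le (by simpa using h) (hΦn (y, s))))
  rw [integral_sub (hint w) hge, hvert] at hhor
  rw [hL, sub_eq_zero.1 hhor]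
  congr 1
  ext y
  simp only [hc, hw']
  ring

end GraphDomain

/-! ### Boundary charts, the outer normal and tangential derivatives -/

section Chart

variable {n : ℕ}

/-- The height of `x` above the graph of `γ` in direction `e`. -/
noncomputable def graphHeight (e : EuclideanSpace ℝ (Fin n)) (γ : EuclideanSpace ℝ (Fin n) → ℝ)
    (x : EuclideanSpace ℝ (Fin n)) : ℝ :=
  ⟪e, x⟫ - γ (x - ⟪e, x⟫ • e)

/-- The downward normal to the graph of `γ`, of length `√(1 + |∇γ|²)`. -/
noncomputable def graphNormal (e : EuclideanSpace ℝ (Fin n)) (γ : EuclideanSpace ℝ (Fin n) → ℝ)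
    (x : EuclideanSpace ℝ (Fin n)) : EuclideanSpace ℝ (Fin n) :=
  -(InnerProductSpace.toDual ℝ _).symm (fderiv ℝ (graphHeight e γ) x)

/-- The parametrization of the graph of `γ` by the hyperplane orthogonal to `e`. -/
noncomputable def graphMap (e : EuclideanSpace ℝ (Fin n)) (γ : EuclideanSpace ℝ (Fin n) → ℝ)
    (y : (ℝ ∙ e)ᗮ) : EuclideanSpace ℝ (Fin n) :=
  (y : EuclideanSpace ℝ (Fin n)) + γ y • e

/-- In the ball of radius `r` around `x₀`, the set `Ω` is the part above the graph of `γ`. -/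
structure IsGraphChart (Ω : Set (EuclideanSpace ℝ (Fin n))) (x₀ : EuclideanSpace ℝ (Fin n)) (r : ℝ)
    (e : EuclideanSpace ℝ (Fin n)) (γ : EuclideanSpace ℝ (Fin n) → ℝ) : Prop where
  isOpen : IsOpen Ω
  norm_eq_one : ‖e‖ = 1
  contDiff : ContDiff ℝ 2 γ
  mem_iff : ∀ x ∈ Metric.ball x₀ r, (x ∈ Ω ↔ 0 < graphHeight e γ x)

theorem IsBoundedC2Domain.exists_isGraphChart {Ω : Set (EuclideanSpace ℝ (Fin n))}
    (hΩ : IsBoundedC2Domain Ω) {x₀ : EuclideanSpace ℝ (Fin n)} (hx : x₀ ∈ frontier Ω) :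
    ∃ r e γ, 0 < r ∧ IsGraphChart Ω x₀ r e γ := by
  obtain ⟨r, hr, e, he, γ, hγ, h⟩ := hΩ.graph x₀ hx
  exact ⟨r, e, γ, hr, hΩ.isOpen, he, hγ, fun x hx => by rw [h x hx, graphHeight, sub_pos]⟩

namespace IsGraphChart

variable {Ω : Set (EuclideanSpace ℝ (Fin n))} {x₀ e : EuclideanSpace ℝ (Fin n)} {r : ℝ}
  {γ : EuclideanSpace ℝ (Fin n) → ℝ}

theorem inner_self (h : IsGraphChart Ω x₀ r e γ) : ⟪e, e⟫ = 1 := by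
  rw [real_inner_self_eq_norm_sq, h.norm_eq_one]; norm_num

theorem contDiff_height (h : IsGraphChart Ω x₀ r e γ) : ContDiff ℝ 2 (graphHeight e γ) := by
  have hγ := h.contDiff
  have hi : ContDiff ℝ 2 fun x : EuclideanSpace ℝ (Fin n) => ⟪e, x⟫ := contDiff_const.inner ℝ contDiff_id
  exact hi.sub (hγ.comp (contDiff_id.sub (hi.smul contDiff_const)))

theorem continuous_height (h : IsGraphChart Ω x₀ r e γ) : Continuous (graphHeight e γ) :=
  h.contDiff_height.continuous

theorem differentiable_height (h : IsGraphChart Ω x₀ r e γ) : Differentiable ℝ (graphHeight e γ) :=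
  h.contDiff_height.differentiable two_ne_zero

theorem fderiv_height (h : IsGraphChart Ω x₀ r e γ) (x w : EuclideanSpace ℝ (Fin n)) :
    fderiv ℝ (graphHeight e γ) x w =
      ⟪e, w⟫ - fderiv ℝ γ (x - ⟪e, x⟫ • e) (w - ⟪e, w⟫ • e) := by
  have h1 : HasFDerivAt (fun x : EuclideanSpace ℝ (Fin n) => ⟪e, x⟫) (innerSL ℝ e) x :=
    (innerSL ℝ e).hasFDerivAt
  have h2 := (hasFDerivAt_id (𝕜 := ℝ) x).sub (h1.smul_const e)
  have hγ : DifferentiableAt ℝ γ (x - ⟪e, x⟫ • e) := h.contDiff.differentiable two_ne_zero _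
  have h3 := h1.sub (hγ.hasFDerivAt.comp x h2)
  have : HasFDerivAt (graphHeight e γ) _ x := h3
  rw [this.fderiv]
  simp

theorem inner_normal (x w : EuclideanSpace ℝ (Fin n)) :
    ⟪graphNormal e γ x, w⟫ = - fderiv ℝ (graphHeight e γ) x w := by
  simp [graphNormal, inner_neg_left]

theorem continuous_normal (h : IsGraphChart Ω x₀ r e γ) : Continuous (graphNormal e γ) := by
  have := h.contDiff_height.continuous_fderiv two_ne_zero
  unfold graphNormal
  fun_prop

theorem inner_normal_self (h : IsGraphChart Ω x₀ r e γ) (x : EuclideanSpace ℝ (Fin n)) :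
    ⟪graphNormal e γ x, e⟫ = -1 := by
  rw [inner_normal, h.fderiv_height, h.inner_self]; simp

/-- The component along `e` already has absolute value `1`. This makes normalization harmless and
bounds the surface density below by `1`. -/
theorem one_le_norm_normal (h : IsGraphChart Ω x₀ r e γ) (x : EuclideanSpace ℝ (Fin n)) :
    1 ≤ ‖graphNormal e γ x‖ := by
  have h1 := abs_real_inner_le_norm (graphNormal e γ x) e
  rw [h.inner_normal_self, h.norm_eq_one] at h1
  simpa using h1

/-- Moving along `e` does not change the hyperplane coordinates. Hence boundary points can be pushed
into `Ω` along `e`, and nearby points projected onto the graph along `e`. -/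
theorem height_add_smul (h : IsGraphChart Ω x₀ r e γ) (x : EuclideanSpace ℝ (Fin n)) (s : ℝ) :
    graphHeight e γ (x + s • e) = graphHeight e γ x + s := by
  simp only [graphHeight, inner_add_right, inner_smul_right, h.inner_self]
  have : x + s • e - (⟪e, x⟫ + s * 1) • e = x - ⟪e, x⟫ • e := by module
  rw [this]; ring

theorem height_nonneg (h : IsGraphChart Ω x₀ r e γ) {x : EuclideanSpace ℝ (Fin n)}
    (hx : x ∈ closure Ω) (hb : x ∈ Metric.ball x₀ r) : 0 ≤ graphHeight e γ x := by
  have h1 : x ∈ closure (Metric.ball x₀ r ∩ Ω) := Metric.isOpen_ball.inter_closure ⟨hb, hx⟩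
  have h2 : closure (Metric.ball x₀ r ∩ Ω) ⊆ {x | 0 ≤ graphHeight e γ x} :=
    closure_minimal (fun z hz => ((h.mem_iff z hz.1).1 hz.2).le)
      (isClosed_le continuous_const h.continuous_height)
  exact h2 h1

theorem mem_closure (h : IsGraphChart Ω x₀ r e γ) {x : EuclideanSpace ℝ (Fin n)}
    (hx : 0 ≤ graphHeight e γ x) (hb : x ∈ Metric.ball x₀ r) : x ∈ closure Ω := by
  have h1 : Tendsto (fun s : ℝ => x + s • e) (𝓝[>] 0) (𝓝 x) := by
    have : Continuous fun s : ℝ => x + s • e := by fun_prop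
    have h2 := this.tendsto 0
    simp only [zero_smul, add_zero] at h2
    exact h2.mono_left nhdsWithin_le_nhds
  refine mem_closure_of_tendsto h1 ?_
  filter_upwards [h1 (Metric.isOpen_ball.mem_nhds hb), self_mem_nhdsWithin] with s hs hs0
  rw [h.mem_iff _ hs, h.height_add_smul]
  exact add_pos_of_nonneg_of_pos hx hs0

theorem height_eq_zero (h : IsGraphChart Ω x₀ r e γ) {x : EuclideanSpace ℝ (Fin n)}
    (hx : x ∈ frontier Ω) (hb : x ∈ Metric.ball x₀ r) : graphHeight e γ x = 0 := by
  refine le_antisymm ?_ (h.height_nonneg (frontier_subset_closure hx) hb)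
  rw [h.isOpen.frontier_eq] at hx
  by_contra hc
  exact hx.2 ((h.mem_iff x hb).2 (not_le.1 hc))

theorem mem_frontier (h : IsGraphChart Ω x₀ r e γ) {x : EuclideanSpace ℝ (Fin n)}
    (hx : graphHeight e γ x = 0) (hb : x ∈ Metric.ball x₀ r) : x ∈ frontier Ω := by
  rw [h.isOpen.frontier_eq]
  refine ⟨h.mem_closure hx.ge hb, fun hm => ?_⟩
  exact ((h.mem_iff x hb).1 hm).ne' hx

theorem eventually_height_pos (h : IsGraphChart Ω x₀ r e γ) {x w : EuclideanSpace ℝ (Fin n)}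
    (hx : graphHeight e γ x = 0) (hw : 0 < fderiv ℝ (graphHeight e γ) x w) :
    ∀ᶠ s in 𝓝[>] (0:ℝ), 0 < graphHeight e γ (x + s • w) := by
  have h1 : HasDerivAt (fun s : ℝ => graphHeight e γ (x + s • w))
      (fderiv ℝ (graphHeight e γ) x w) 0 :=
    (h.differentiable_height x).hasFDerivAt.hasLineDerivAt w
  have h2 := h1.tendsto_slope_zero_right
  filter_upwards [h2.eventually (lt_mem_nhds hw), self_mem_nhdsWithin] with s hs hs0
  simp only [zero_add, zero_smul, add_zero, hx, sub_zero, smul_eq_mul] at hs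
  exact (mul_pos_iff_of_pos_left (inv_pos.2 hs0)).1 hs

theorem eventually_mem_ball {x w : EuclideanSpace ℝ (Fin n)} (hb : x ∈ Metric.ball x₀ r) :
    ∀ᶠ s in 𝓝[>] (0:ℝ), x + s • w ∈ Metric.ball x₀ r := by
  have : Continuous fun s : ℝ => x + s • w := by fun_prop
  refine (this.tendsto 0).mono_left nhdsWithin_le_nhds (Metric.isOpen_ball.mem_nhds ?_)
  simpa using hb

/-- The height vanishes at a boundary point and its derivative along `w` is minus the inner product
of `w` with the graph normal, so the first-order sign decides on which side a short segment lies. In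
the outward case negative height excludes the closure too, because within the ball the closure has
nonnegative height. -/
theorem isOuterUnitNormal (h : IsGraphChart Ω x₀ r e γ) {x : EuclideanSpace ℝ (Fin n)}
    (hx : x ∈ frontier Ω) (hb : x ∈ Metric.ball x₀ r) :
    IsOuterUnitNormal Ω x (‖graphNormal e γ x‖⁻¹ • graphNormal e γ x) := by
  have hN : 0 < ‖graphNormal e γ x‖ := zero_lt_one.trans_le (h.one_le_norm_normal x)
  have h0 := h.height_eq_zero hx hb
  refine ⟨by rw [norm_smul, norm_inv, norm_norm, inv_mul_cancel₀ hN.ne'], ?_, ?_⟩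
  · intro w hw
    rw [inner_smul_left] at hw
    have hw' : 0 < fderiv ℝ (graphHeight e γ) x w := by
      have := lt_of_not_ge fun hc => hw.not_ge (mul_nonneg (inv_pos.2 hN).le hc)
      rw [inner_normal] at this; linarith
    have := (h.eventually_height_pos h0 hw').and (eventually_mem_ball (w := w) hb)
    obtain ⟨δ, hδ, H⟩ := mem_nhdsGT_iff_exists_Ioo_subset.1 this
    exact ⟨δ, hδ, fun s hs => (h.mem_iff _ (H hs).2).2 (H hs).1⟩
  · intro w hw
    rw [inner_smul_left] at hw
    have hw' : 0 < fderiv ℝ (graphHeight e γ) x (-w) := by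
      have := (mul_pos_iff_of_pos_left (inv_pos.2 hN)).1 hw
      rw [inner_normal] at this; rw [map_neg]; linarith
    have h3 : ∀ᶠ s in 𝓝[>] (0:ℝ), graphHeight e γ (x + s • w) < 0 := by
      have h1 : HasDerivAt (fun s : ℝ => graphHeight e γ (x + s • w))
          (fderiv ℝ (graphHeight e γ) x w) 0 :=
        (h.differentiable_height x).hasFDerivAt.hasLineDerivAt w
      have h2 := h1.tendsto_slope_zero_right
      rw [map_neg, neg_pos] at hw'
      filter_upwards [h2.eventually (gt_mem_nhds hw'), self_mem_nhdsWithin] with s hs hs0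
      simp only [zero_add, zero_smul, add_zero, h0, sub_zero, smul_eq_mul] at hs
      exact lt_of_not_ge fun hc => hs.not_ge (mul_nonneg (inv_pos.2 hs0).le hc)
    have := h3.and (eventually_mem_ball (w := w) hb)
    obtain ⟨δ, hδ, H⟩ := mem_nhdsGT_iff_exists_Ioo_subset.1 this
    exact ⟨δ, hδ, fun s hs hc => (h.height_nonneg hc (H hs).2).not_gt (H hs).1⟩

end IsGraphChart

theorem IsOuterUnitNormal.outerNormal_eq {Ω : Set (EuclideanSpace ℝ (Fin n))}
    {x v : EuclideanSpace ℝ (Fin n)} (h : IsOuterUnitNormal Ω x v) : outerNormal Ω x = v := by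
  have hex : ∃ v, IsOuterUnitNormal Ω x v := ⟨v, h⟩
  rw [outerNormal, dif_pos hex]
  exact hex.choose_spec.unique h

theorem IsGraphChart.outerNormal_eq {Ω : Set (EuclideanSpace ℝ (Fin n))}
    {x₀ e : EuclideanSpace ℝ (Fin n)} {r : ℝ} {γ : EuclideanSpace ℝ (Fin n) → ℝ}
    (h : IsGraphChart Ω x₀ r e γ) {x : EuclideanSpace ℝ (Fin n)}
    (hx : x ∈ frontier Ω) (hb : x ∈ Metric.ball x₀ r) :
    outerNormal Ω x = ‖graphNormal e γ x‖⁻¹ • graphNormal e γ x :=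
  (h.isOuterUnitNormal hx hb).outerNormal_eq

namespace IsBoundedC2Domain

variable {Ω : Set (EuclideanSpace ℝ (Fin n))}

theorem isOuterUnitNormal (hΩ : IsBoundedC2Domain Ω) {x : EuclideanSpace ℝ (Fin n)}
    (hx : x ∈ frontier Ω) : IsOuterUnitNormal Ω x (outerNormal Ω x) := by
  obtain ⟨r, e, γ, hr, h⟩ := hΩ.exists_isGraphChart hx
  have := h.isOuterUnitNormal hx (Metric.mem_ball_self hr)
  rwa [this.outerNormal_eq]

theorem continuousOn_outerNormal (hΩ : IsBoundedC2Domain Ω) :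
    ContinuousOn (outerNormal Ω) (frontier Ω) := by
  intro x hx
  obtain ⟨r, e, γ, hr, h⟩ := hΩ.exists_isGraphChart hx
  have hN : ‖graphNormal e γ x‖ ≠ 0 := (zero_lt_one.trans_le (h.one_le_norm_normal x)).ne'
  have hc : ContinuousWithinAt (fun x => ‖graphNormal e γ x‖⁻¹ • graphNormal e γ x)
      (frontier Ω) x := by
    have := h.continuous_normal
    exact ((this.norm.continuousAt.inv₀ hN).smul this.continuousAt).continuousWithinAt
  refine hc.congr_of_eventuallyEq ?_ (h.outerNormal_eq hx (Metric.mem_ball_self hr))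
  filter_upwards [self_mem_nhdsWithin, mem_nhdsWithin_of_mem_nhds (Metric.ball_mem_nhds x hr)]
    with z hz hz' using h.outerNormal_eq hz hz'

/-- The tangent cone at a boundary point contains the open half space `⟪ν, w⟫ < 0`, which spans.
This is what makes derivatives within the closure well defined up to the boundary. -/
theorem uniqueDiffOn_closure (hΩ : IsBoundedC2Domain Ω) : UniqueDiffOn ℝ (closure Ω) := by
  intro x hx
  by_cases hxΩ : x ∈ Ω
  · exact (hΩ.isOpen.uniqueDiffWithinAt hxΩ).mono subset_closure
  have hfr : x ∈ frontier Ω := by rw [hΩ.isOpen.frontier_eq]; exact ⟨hx, hxΩ⟩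
  have hν := hΩ.isOuterUnitNormal hfr
  set ν := outerNormal Ω x
  refine ⟨?_, subset_closure hx⟩
  have hsub : {w : EuclideanSpace ℝ (Fin n) | ⟪ν, w⟫ < 0} ⊆ tangentConeAt ℝ (closure Ω) x := by
    intro w hw
    obtain ⟨δ, hδ, H⟩ := hν.inward w hw
    refine mem_tangentConeAt_of_seq atTop (fun k : ℕ => (δ / (k + 2) : ℝ)⁻¹)
      (fun k : ℕ => (δ / (k + 2) : ℝ) • w) ?_ ?_ ?_
    · have : Tendsto (fun k : ℕ => (δ / ((k : ℝ) + 2))) atTop (𝓝 0) :=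
        tendsto_const_nhds.div_atTop (tendsto_atTop_add_const_right _ _ tendsto_natCast_atTop_atTop)
      simpa using this.smul_const w
    · refine Eventually.of_forall fun k => subset_closure (H _ ⟨by positivity, ?_⟩)
      rw [div_lt_iff₀ (by positivity)]
      nlinarith [(Nat.cast_nonneg k : (0:ℝ) ≤ k)]
    · refine tendsto_const_nhds.congr fun k => ?_
      rw [smul_smul, inv_mul_cancel₀ (by positivity), one_smul]
  have hspan : Submodule.span ℝ (tangentConeAt ℝ (closure Ω) x) = ⊤ := by
    rw [eq_top_iff]
    intro w _
    have hνν : ⟪ν, ν⟫ = 1 := by rw [real_inner_self_eq_norm_sq, hν.norm_eq_one]; norm_num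
    have h1 : (w - (⟪ν, w⟫ + 1) • ν) ∈ Submodule.span ℝ (tangentConeAt ℝ (closure Ω) x) := by
      apply Submodule.subset_span
      apply hsub
      change ⟪ν, _⟫ < 0
      rw [inner_sub_right, inner_smul_right, hνν]; linarith
    have h2 : -ν ∈ Submodule.span ℝ (tangentConeAt ℝ (closure Ω) x) := by
      apply Submodule.subset_span
      apply hsub
      change ⟪ν, _⟫ < 0
      rw [inner_neg_right, hνν]; linarith
    -- An arbitrary `w` is a combination of two inward vectors: `w - (⟪ν, w⟫ + 1) ν` and `-ν`.
    have := Submodule.sub_mem _ h1 (Submodule.smul_mem _ (⟪ν, w⟫ + 1) h2)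
    convert this using 1
    module
  rw [hspan]
  exact dense_univ

/-- The tangential derivatives vanish at the boundary for a function vanishing there. -/
theorem fderivWithin_apply_of_eq_zero (hΩ : IsBoundedC2Domain Ω)
    {f : EuclideanSpace ℝ (Fin n) → ℝ} (hf : ∀ x ∈ frontier Ω, f x = 0)
    {x : EuclideanSpace ℝ (Fin n)} (hx : x ∈ frontier Ω)
    {f' : EuclideanSpace ℝ (Fin n) →L[ℝ] ℝ} (hd : HasFDerivWithinAt f f' (closure Ω) x)
    (w : EuclideanSpace ℝ (Fin n)) :
    f' w = ⟪outerNormal Ω x, w⟫ * f' (outerNormal Ω x) := by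
  obtain ⟨r, e, γ, hr, h⟩ := hΩ.exists_isGraphChart hx
  have hb := Metric.mem_ball_self (x := x) hr
  have h0 := h.height_eq_zero hx hb
  -- the projection along `e` onto the graph
  set p : EuclideanSpace ℝ (Fin n) → EuclideanSpace ℝ (Fin n) :=
    fun z => z - graphHeight e γ z • e with hp
  have hpx : p x = x := by simp [hp, h0]
  have hpd : HasFDerivAt p (ContinuousLinearMap.id ℝ _ -
      (fderiv ℝ (graphHeight e γ) x).smulRight e) x :=
    (hasFDerivAt_id x).sub ((h.differentiable_height x).hasFDerivAt.smul_const e)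
  have hpc : Continuous p := by have := h.continuous_height; fun_prop
  have hpf : ∀ᶠ z in 𝓝 x, p z ∈ frontier Ω := by
    have h1 : ∀ᶠ z in 𝓝 x, p z ∈ Metric.ball x r :=
      hpc.continuousAt.eventually_mem (by rw [hpx]; exact Metric.ball_mem_nhds _ hr)
    filter_upwards [h1] with z hz
    refine h.mem_frontier ?_ hz
    have := h.height_add_smul z (-graphHeight e γ z)
    simp only [neg_smul, ← sub_eq_add_neg, sub_self] at this
    exact this
  -- Near `x` the projection `p` takes values in the frontier, hence in the closure, so a derivative
  -- of `f` within the closure yields a full derivative of `f ∘ p`.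
  have hcomp : HasFDerivAt (f ∘ p) (f'.comp (ContinuousLinearMap.id ℝ _ -
      (fderiv ℝ (graphHeight e γ) x).smulRight e)) x := by
    rw [← hpx] at hd
    have h3 := hpd.hasFDerivWithinAt (s := p ⁻¹' (closure Ω))
    have h4 := hd.comp x h3 (fun z hz => hz)
    refine h4.hasFDerivAt ?_
    filter_upwards [hpf] with z hz using frontier_subset_closure hz
  have hzero : HasFDerivAt (f ∘ p) (0 : EuclideanSpace ℝ (Fin n) →L[ℝ] ℝ) x := by
    refine (hasFDerivAt_const (0:ℝ) x).congr_of_eventuallyEq ?_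
    filter_upwards [hpf] with z hz using hf _ hz
  have huniq := hcomp.unique hzero
  -- Since `f ∘ p` is locally zero, `f'` kills `v - dh(v) e`, where `h` is the height. So `f'` is
  -- proportional to `dh`, that is, to the normal covector.
  have key : ∀ v, f' v = - ⟪graphNormal e γ x, v⟫ * f' e := by
    intro v
    have := congrArg (fun L : EuclideanSpace ℝ (Fin n) →L[ℝ] ℝ => L v) huniq
    simp at this
    rw [IsGraphChart.inner_normal]
    linarith
  have hN : ‖graphNormal e γ x‖ ≠ 0 := (zero_lt_one.trans_le (h.one_le_norm_normal x)).ne'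
  rw [key w, key (outerNormal Ω x), h.outerNormal_eq hx hb, inner_smul_left, inner_smul_right,
    real_inner_self_eq_norm_sq]
  simp
  field_simp

end IsBoundedC2Domain

end Chart

/-! ### Graph measure and Hausdorff measure in one chart -/

section ChartMeasure

variable {n : ℕ}

theorem finrank_hyperplane (hn : 2 ≤ n) {e : EuclideanSpace ℝ (Fin n)} (he : ‖e‖ = 1) :
    Module.finrank ℝ (ℝ ∙ e)ᗮ = n - 1 := by
  have he0 : e ≠ 0 := by
    intro h; simp [h] at he
  have h1 := Submodule.finrank_add_finrank_orthogonal (ℝ ∙ e)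
  rw [finrank_span_singleton he0, finrank_euclideanSpace_fin] at h1
  omega

/-- Since `V` has dimension `n - 1`, its volume and the surface measure are the same multiple of the
respective Hausdorff measures, so the Lipschitz bound for the latter carries over. This bound and
the antilipschitz one below replace an area formula. -/
theorem surfaceMeasure_image_le {V : Type*} [NormedAddCommGroup V] [InnerProductSpace ℝ V]
    [FiniteDimensional ℝ V] [MeasurableSpace V] [BorelSpace V]
    (hV : Module.finrank ℝ V = n - 1) {g : V → EuclideanSpace ℝ (Fin n)} {L : ℝ≥0} {s : Set V}
    (hg : LipschitzOnWith L g s) :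
    surfaceMeasure n (g '' s) ≤ (L : ℝ≥0∞) ^ (n - 1) * volume s := by
  rw [← InnerProductSpace.euclideanHausdorffMeasure_eq_volume, hV, surfaceMeasure,
    Measure.euclideanHausdorffMeasure_def, Measure.euclideanHausdorffMeasure_def,
    Measure.smul_apply, Measure.smul_apply]
  have := hg.hausdorffMeasure_image_le (d := ((n - 1 : ℕ) : ℝ)) (Nat.cast_nonneg _)
  rw [ENNReal.rpow_natCast] at this
  rw [mul_smul_comm]
  gcongr

theorem volume_le_surfaceMeasure_image {V : Type*} [NormedAddCommGroup V] [InnerProductSpace ℝ V]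
    [FiniteDimensional ℝ V] [MeasurableSpace V] [BorelSpace V]
    (hV : Module.finrank ℝ V = n - 1) {g : V → EuclideanSpace ℝ (Fin n)}
    (hg : AntilipschitzWith 1 g) (s : Set V) :
    volume s ≤ surfaceMeasure n (g '' s) := by
  rw [← InnerProductSpace.euclideanHausdorffMeasure_eq_volume, hV, surfaceMeasure,
    Measure.euclideanHausdorffMeasure_def, Measure.euclideanHausdorffMeasure_def,
    Measure.smul_apply, Measure.smul_apply]
  have := hg.le_hausdorffMeasure_image (d := ((n - 1 : ℕ) : ℝ)) (Nat.cast_nonneg _) s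
  simp only [ENNReal.coe_one, ENNReal.one_rpow, one_mul] at this
  gcongr

/-- The surface measure of the graph of `γ` (with density `√(1 + |∇γ|²)` in the coordinates of the
hyperplane orthogonal to `e`) weighted by `χ`. -/
noncomputable def graphMeasure (e : EuclideanSpace ℝ (Fin n)) (γ χ : EuclideanSpace ℝ (Fin n) → ℝ) :
    Measure (EuclideanSpace ℝ (Fin n)) :=
  ((volume : Measure (ℝ ∙ e)ᗮ).withDensity fun y =>
    ((Real.toNNReal (χ (graphMap e γ y) * ‖graphNormal e γ (graphMap e γ y)‖) : ℝ≥0) : ℝ≥0∞)).map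
      (graphMap e γ)

namespace IsGraphChart

variable {Ω : Set (EuclideanSpace ℝ (Fin n))} {x₀ e : EuclideanSpace ℝ (Fin n)} {r : ℝ}
  {γ : EuclideanSpace ℝ (Fin n) → ℝ}

theorem continuous_graphMap (h : IsGraphChart Ω x₀ r e γ) : Continuous (graphMap e γ) := by
  have := h.contDiff.continuous
  unfold graphMap
  fun_prop

theorem inner_graphMap (h : IsGraphChart Ω x₀ r e γ) (y : (ℝ ∙ e)ᗮ) :
    ⟪e, graphMap e γ y⟫ = γ y := by
  simp [graphMap, inner_add_right, inner_hyperplane, inner_smul_right, h.norm_eq_one]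

theorem graphMap_sub (h : IsGraphChart Ω x₀ r e γ) (y : (ℝ ∙ e)ᗮ) :
    graphMap e γ y - ⟪e, graphMap e γ y⟫ • e = y := by
  rw [h.inner_graphMap]; simp [graphMap]

theorem height_graphMap (h : IsGraphChart Ω x₀ r e γ) (y : (ℝ ∙ e)ᗮ) :
    graphHeight e γ (graphMap e γ y) = 0 := by
  rw [graphHeight, h.graphMap_sub, h.inner_graphMap, sub_self]

theorem exists_graphMap_eq (h : IsGraphChart Ω x₀ r e γ) {x : EuclideanSpace ℝ (Fin n)}
    (hx : graphHeight e γ x = 0) : ∃ y, graphMap e γ y = x := by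
  refine ⟨⟨x - ⟪e, x⟫ • e, ?_⟩, ?_⟩
  · rw [Submodule.mem_orthogonal_singleton_iff_inner_right, inner_sub_right, inner_smul_right,
      h.inner_self]
    simp
  · simp only [graphMap]
    rw [graphHeight, sub_eq_zero] at hx
    rw [← hx]; simp

theorem norm_sub_le_graphMap (y z : (ℝ ∙ e)ᗮ) :
    ‖y - z‖ ≤ ‖graphMap e γ y - graphMap e γ z‖ := by
  have h1 : graphMap e γ y - graphMap e γ z =
      ((y - z : (ℝ ∙ e)ᗮ) : EuclideanSpace ℝ (Fin n)) + (γ y - γ z) • e := by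
    simp only [graphMap, Submodule.coe_sub]; module
  have h2 := norm_add_sq_real ((y - z : (ℝ ∙ e)ᗮ) : EuclideanSpace ℝ (Fin n)) ((γ y - γ z) • e)
  rw [inner_smul_right, real_inner_comm, inner_hyperplane, ← h1] at h2
  refine le_of_sq_le_sq ?_ (norm_nonneg _)
  rw [h2, Submodule.coe_norm]
  nlinarith [sq_nonneg ‖(γ y - γ z) • e‖]

theorem antilipschitz_graphMap : AntilipschitzWith 1 (graphMap e γ) :=
  AntilipschitzWith.of_le_mul_dist fun y z => by
    simpa [dist_eq_norm] using norm_sub_le_graphMap (e := e) (γ := γ) y z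

theorem measurableEmbedding_graphMap (h : IsGraphChart Ω x₀ r e γ) :
    MeasurableEmbedding (graphMap e γ) :=
  h.continuous_graphMap.measurableEmbedding antilipschitz_graphMap.injective

/-- `γ` is Lipschitz on bounded convex sets only, and orthogonality keeps the hyperplane coordinate
`y` no longer than the graph point above it. -/
theorem exists_lipschitzOnWith_graphMap (h : IsGraphChart Ω x₀ r e γ) :
    ∃ L : ℝ≥0, LipschitzOnWith L (graphMap e γ) (graphMap e γ ⁻¹' Metric.ball x₀ r) := by
  have hγ := h.contDiff
  have hK : IsCompact (Metric.closedBall (0 : EuclideanSpace ℝ (Fin n)) (‖x₀‖ + r)) :=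
    isCompact_closedBall _ _
  obtain ⟨D, hD⟩ := hK.exists_bound_of_continuousOn
    (hγ.continuous_fderiv two_ne_zero).continuousOn
  have hlip : LipschitzOnWith D.toNNReal γ
      (Metric.closedBall (0 : EuclideanSpace ℝ (Fin n)) (‖x₀‖ + r)) := by
    refine (convex_closedBall _ _).lipschitzOnWith_of_nnnorm_fderiv_le
      (fun x _ => hγ.differentiable two_ne_zero x) fun x hx => ?_
    rw [← NNReal.coe_le_coe, coe_nnnorm]
    exact (hD x hx).trans (Real.le_coe_toNNReal D)
  refine ⟨1 + D.toNNReal, LipschitzOnWith.of_dist_le_mul fun y hy z hz => ?_⟩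
  have hmem : ∀ y ∈ graphMap e γ ⁻¹' Metric.ball x₀ r, (y : EuclideanSpace ℝ (Fin n)) ∈
      Metric.closedBall (0 : EuclideanSpace ℝ (Fin n)) (‖x₀‖ + r) := by
    intro y hy
    have h0 : ‖graphMap e γ y‖ ≤ ‖x₀‖ + r := by
      have h1 : ‖graphMap e γ y - x₀‖ < r := by simpa [dist_eq_norm] using hy
      have h2 := norm_add_le (graphMap e γ y - x₀) x₀
      rw [sub_add_cancel] at h2
      linarith
    have h3 : ‖(y : EuclideanSpace ℝ (Fin n))‖ ^ 2 ≤ ‖graphMap e γ y‖ ^ 2 := by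
      rw [graphMap, norm_add_sq_real, inner_smul_right, real_inner_comm, inner_hyperplane]
      nlinarith [sq_nonneg ‖(γ y) • e‖]
    simpa using (le_of_sq_le_sq h3 (norm_nonneg _)).trans h0
  have h1 := hlip.dist_le_mul _ (hmem y hy) _ (hmem z hz)
  have h2 : graphMap e γ y - graphMap e γ z =
      ((y - z : (ℝ ∙ e)ᗮ) : EuclideanSpace ℝ (Fin n)) + (γ y - γ z) • e := by
    simp only [graphMap, Submodule.coe_sub]; module
  rw [dist_eq_norm, h2]
  refine (norm_add_le _ _).trans ?_
  rw [norm_smul, h.norm_eq_one, mul_one, ← dist_eq_norm (γ y)]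
  rw [NNReal.coe_add, add_mul, NNReal.coe_one, one_mul]
  refine add_le_add ?_ h1
  rw [dist_eq_norm, Submodule.coe_norm]

theorem measurable_density (h : IsGraphChart Ω x₀ r e γ) {χ : EuclideanSpace ℝ (Fin n) → ℝ}
    (hχ : Continuous χ) : Measurable fun y : (ℝ ∙ e)ᗮ =>
      Real.toNNReal (χ (graphMap e γ y) * ‖graphNormal e γ (graphMap e γ y)‖) := by
  have := h.continuous_graphMap
  have := h.continuous_normal
  exact (continuous_real_toNNReal.comp (by fun_prop)).measurable

theorem lintegral_graphMeasure (h : IsGraphChart Ω x₀ r e γ) {χ : EuclideanSpace ℝ (Fin n) → ℝ}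
    (hχ : Continuous χ) (g : EuclideanSpace ℝ (Fin n) → ℝ≥0∞) (hg : Measurable g) :
    ∫⁻ x, g x ∂(graphMeasure e γ χ) = ∫⁻ y : (ℝ ∙ e)ᗮ,
      (Real.toNNReal (χ (graphMap e γ y) * ‖graphNormal e γ (graphMap e γ y)‖) : ℝ≥0) *
        g (graphMap e γ y) := by
  rw [graphMeasure, h.measurableEmbedding_graphMap.lintegral_map,
    lintegral_withDensity_eq_lintegral_mul]
  · rfl
  · exact (h.measurable_density hχ).coe_nnreal_ennreal
  · exact hg.comp h.continuous_graphMap.measurable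

theorem integral_graphMeasure (h : IsGraphChart Ω x₀ r e γ) {χ : EuclideanSpace ℝ (Fin n) → ℝ}
    (hχ : Continuous χ) (hχ0 : ∀ x, 0 ≤ χ x) (g : EuclideanSpace ℝ (Fin n) → ℝ) :
    ∫ x, g x ∂(graphMeasure e γ χ) = ∫ y : (ℝ ∙ e)ᗮ,
      χ (graphMap e γ y) * ‖graphNormal e γ (graphMap e γ y)‖ * g (graphMap e γ y) := by
  rw [graphMeasure, h.measurableEmbedding_graphMap.integral_map,
    integral_withDensity_eq_integral_smul (h.measurable_density hχ)]
  congr 1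
  ext y
  rw [NNReal.smul_def, Real.coe_toNNReal _ (mul_nonneg (hχ0 _) (norm_nonneg _)), smul_eq_mul]

/-- The weighted graph measure is dominated by the surface measure on the boundary. -/
theorem exists_graphMeasure_le (hn : 2 ≤ n) (h : IsGraphChart Ω x₀ r e γ)
    {χ : EuclideanSpace ℝ (Fin n) → ℝ} (hχ : Continuous χ) (hχ1 : ∀ x, χ x ≤ 1)
    (hχs : tsupport χ ⊆ Metric.ball x₀ r) :
    ∃ D : ℝ≥0, graphMeasure e γ χ ≤ D • (surfaceMeasure n).restrict (frontier Ω) := by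
  obtain ⟨D, hD⟩ := (isCompact_closedBall x₀ r).exists_bound_of_continuousOn
    h.continuous_normal.continuousOn
  refine ⟨D.toNNReal, Measure.le_iff.2 fun A hA => ?_⟩
  have hG := h.continuous_graphMap.measurable
  have hS : MeasurableSet (graphMap e γ ⁻¹' (A ∩ Metric.ball x₀ r)) :=
    hG (hA.inter measurableSet_ball)
  calc graphMeasure e γ χ A
      = ∫⁻ x, A.indicator 1 x ∂(graphMeasure e γ χ) := by rw [lintegral_indicator_one hA]
    _ = _ := h.lintegral_graphMeasure hχ _ (measurable_one.indicator hA)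
    _ ≤ ∫⁻ y : (ℝ ∙ e)ᗮ, (graphMap e γ ⁻¹' (A ∩ Metric.ball x₀ r)).indicator
          (fun _ => (D.toNNReal : ℝ≥0∞)) y := by
        refine lintegral_mono fun y => ?_
        by_cases hy : graphMap e γ y ∈ A ∩ Metric.ball x₀ r
        · rw [indicator_of_mem (show y ∈ graphMap e γ ⁻¹' (A ∩ Metric.ball x₀ r) from hy),
            indicator_of_mem hy.1]
          simp only [Pi.one_apply, mul_one, ENNReal.coe_le_coe]
          apply Real.toNNReal_le_toNNReal
          have h1 := hD _ (Metric.ball_subset_closedBall hy.2)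
          rw [← one_mul D]
          exact mul_le_mul (hχ1 _) h1 (norm_nonneg _) zero_le_one
        · by_cases hyA : graphMap e γ y ∈ A
          · have : χ (graphMap e γ y) = 0 :=
              image_eq_zero_of_notMem_tsupport fun hc => hy ⟨hyA, hχs hc⟩
            simp [this]
          · simp [hyA]
    _ = D.toNNReal * volume (graphMap e γ ⁻¹' (A ∩ Metric.ball x₀ r)) := by
        rw [lintegral_indicator_const hS]
    _ ≤ D.toNNReal * (surfaceMeasure n).restrict (frontier Ω) A := by
        gcongr
        -- Orthogonal projection of the graph to the hyperplane does not increase distances, so the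
        -- volume of the shadow is at most the surface measure of the piece of graph.
        refine (volume_le_surfaceMeasure_image (finrank_hyperplane hn h.norm_eq_one)
          (antilipschitz_graphMap (γ := γ)) _).trans ?_
        rw [Measure.restrict_apply hA]
        refine measure_mono ?_
        rintro _ ⟨y, hy, rfl⟩
        exact ⟨hy.1, h.mem_frontier (h.height_graphMap y) hy.2⟩
    _ = _ := rfl

/-- The surface measure on the boundary, weighted by `χ`, is dominated by the graph measure. -/
theorem exists_le_graphMeasure (hn : 2 ≤ n) (h : IsGraphChart Ω x₀ r e γ)
    {χ : EuclideanSpace ℝ (Fin n) → ℝ} (hχ : Continuous χ)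
    (hχs : tsupport χ ⊆ Metric.ball x₀ r) :
    ∃ D : ℝ≥0, ((surfaceMeasure n).restrict (frontier Ω)).withDensity
      (fun x => ((χ x).toNNReal : ℝ≥0∞)) ≤ D • graphMeasure e γ χ := by
  obtain ⟨L, hL⟩ := h.exists_lipschitzOnWith_graphMap
  have hG := h.continuous_graphMap.measurable
  -- Inside the ball the frontier lies in the image of the graph map, which is `L`-Lipschitz there.
  have hle : (surfaceMeasure n).restrict (frontier Ω ∩ Metric.ball x₀ r) ≤
      (L ^ (n - 1)) • (volume : Measure (ℝ ∙ e)ᗮ).map (graphMap e γ) := by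
    refine Measure.le_iff.2 fun A hA => ?_
    rw [Measure.restrict_apply hA, Measure.smul_apply, Measure.map_apply hG hA]
    have hsub : A ∩ (frontier Ω ∩ Metric.ball x₀ r) ⊆
        graphMap e γ '' (graphMap e γ ⁻¹' (A ∩ Metric.ball x₀ r)) := by
      rintro x ⟨hxA, hxf, hxb⟩
      obtain ⟨y, rfl⟩ := h.exists_graphMap_eq (h.height_eq_zero hxf hxb)
      exact ⟨y, ⟨hxA, hxb⟩, rfl⟩
    refine (measure_mono hsub).trans ((surfaceMeasure_image_le
      (finrank_hyperplane hn h.norm_eq_one) (hL.mono fun y hy => hy.2)).trans ?_)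
    rw [ENNReal.smul_def, smul_eq_mul, ENNReal.coe_pow]
    gcongr
    exact inter_subset_left
  refine ⟨L ^ (n - 1), Measure.le_iff.2 fun A hA => ?_⟩
  have hm : Measurable (A.indicator fun x => ((χ x).toNNReal : ℝ≥0∞)) :=
    ((continuous_real_toNNReal.comp hχ).measurable.coe_nnreal_ennreal).indicator hA
  calc _ = ∫⁻ x in frontier Ω, A.indicator (fun x => ((χ x).toNNReal : ℝ≥0∞)) x
          ∂(surfaceMeasure n) := by rw [withDensity_apply _ hA, lintegral_indicator hA]
    _ = ∫⁻ x in frontier Ω ∩ Metric.ball x₀ r, A.indicator (fun x => ((χ x).toNNReal : ℝ≥0∞)) x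
          ∂(surfaceMeasure n) := by
        rw [inter_comm, ← Measure.restrict_restrict measurableSet_ball]
        refine (setLIntegral_eq_of_support_subset fun x hx => ?_).symm
        refine hχs (subset_tsupport _ fun h0 => hx ?_)
        by_cases hxA : x ∈ A <;> simp [h0, hxA]
    _ ≤ ∫⁻ x, A.indicator (fun x => ((χ x).toNNReal : ℝ≥0∞)) x
          ∂((L ^ (n - 1)) • (volume : Measure (ℝ ∙ e)ᗮ).map (graphMap e γ)) :=
        lintegral_mono' hle le_rfl
    _ = (L ^ (n - 1) : ℝ≥0) * ∫⁻ y : (ℝ ∙ e)ᗮ,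
          A.indicator (fun x => ((χ x).toNNReal : ℝ≥0∞)) (graphMap e γ y) := by
        rw [lintegral_smul_measure, lintegral_map hm hG]; rfl
    _ ≤ (L ^ (n - 1) : ℝ≥0) * ∫⁻ y : (ℝ ∙ e)ᗮ,
          (Real.toNNReal (χ (graphMap e γ y) * ‖graphNormal e γ (graphMap e γ y)‖) : ℝ≥0) *
            A.indicator 1 (graphMap e γ y) := by
        gcongr with y
        by_cases hy : graphMap e γ y ∈ A
        · rw [indicator_of_mem hy, indicator_of_mem hy]
          simp only [Pi.one_apply, mul_one, ENNReal.coe_le_coe]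
          -- The graph density is at least `1`, so inserting it only increases the integral.
          rw [mul_comm, Real.toNNReal_mul (norm_nonneg _)]
          refine le_mul_of_one_le_left' ?_
          rw [← Real.toNNReal_one]
          exact Real.toNNReal_le_toNNReal (h.one_le_norm_normal _)
        · simp [hy]
    _ = (L ^ (n - 1) : ℝ≥0) * graphMeasure e γ χ A := by
        rw [← h.lintegral_graphMeasure hχ _ (measurable_one.indicator hA),
          lintegral_indicator_one hA]
    _ = _ := rfl

/-- The divergence theorem for functions supported in a chart. -/
theorem setIntegral_fderiv_of_tsupport_subset (h : IsGraphChart Ω x₀ r e γ)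
    {f : EuclideanSpace ℝ (Fin n) → ℝ} (hfc : ContinuousOn f (closure Ω))
    (hfd : DifferentiableOn ℝ f Ω) {B : ℝ} (hB : ∀ x ∈ Ω, ‖fderiv ℝ f x‖ ≤ B)
    (hfs : tsupport f ⊆ Metric.ball x₀ r) (w : EuclideanSpace ℝ (Fin n)) :
    ∫ x in Ω, fderiv ℝ f x w = ∫ y : (ℝ ∙ e)ᗮ,
      f (graphMap e γ y) * ⟪graphNormal e γ (graphMap e γ y), w⟫ := by
  have hf0 : ∀ x ∉ Metric.ball x₀ r, f =ᶠ[𝓝 x] 0 := fun x hx =>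
    notMem_tsupport_iff_eventuallyEq.1 fun hc => hx (hfs hc)
  have hfd0 : ∀ x ∉ Metric.ball x₀ r, fderiv ℝ f x = 0 := by
    intro x hx
    rw [(hf0 x hx).fderiv_eq]
    simp
  have hUm : MeasurableSet {x | γ (x - ⟪e, x⟫ • e) < ⟪e, x⟫} := by
    have := h.contDiff.continuous
    exact (isOpen_lt (by fun_prop) (by fun_prop)).measurableSet
  have hmem : ∀ x ∈ Metric.ball x₀ r, (γ (x - ⟪e, x⟫ • e) < ⟪e, x⟫ ↔ x ∈ Ω) := by
    intro x hx
    rw [h.mem_iff x hx, graphHeight, sub_pos]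
  -- Inside the ball `Ω` coincides with the epigraph; outside it `f` vanishes near every point, so
  -- the two domains of integration are interchangeable. The bound is `max B 0` because epigraph
  -- points outside the ball, where the gradient is zero, need not belong to `Ω`.
  have key := setIntegral_epigraph_fderiv h.norm_eq_one (h.contDiff.of_le one_le_two) (f := f)
    (B := max B 0) (R := ‖x₀‖ + r) ?_ ?_ ?_ ?_ w
  · rw [← integral_indicator h.isOpen.measurableSet]
    rw [← integral_indicator hUm] at key
    convert key using 1
    · congr 1
      ext x
      by_cases hx : x ∈ Metric.ball x₀ r
      · by_cases hxΩ : x ∈ Ω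
        · rw [indicator_of_mem hxΩ, indicator_of_mem (by exact (hmem x hx).2 hxΩ)]
        · have hxU : x ∉ {x | γ (x - ⟪e, x⟫ • e) < ⟪e, x⟫} := fun hc => hxΩ ((hmem x hx).1 hc)
          rw [indicator_of_notMem hxΩ, indicator_of_notMem hxU]
      · simp [indicator, hfd0 x hx]
    · congr 1
      ext y
      rw [inner_normal, h.fderiv_height, h.graphMap_sub, neg_sub]
      rfl
  · intro x hx
    by_cases hb : x ∈ Metric.ball x₀ r
    · have hx' : 0 ≤ graphHeight e γ x := sub_nonneg.2 hx
      refine (hfc x (h.mem_closure hx' hb)).mono_of_mem_nhdsWithin ?_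
      filter_upwards [self_mem_nhdsWithin, mem_nhdsWithin_of_mem_nhds
        (Metric.isOpen_ball.mem_nhds hb)] with z hz hzb
      exact h.mem_closure (sub_nonneg.2 hz) hzb
    · refine ContinuousAt.continuousWithinAt ?_
      exact (continuousAt_const (y := (0:ℝ))).congr (hf0 x hb).symm
  · intro x hx
    by_cases hb : x ∈ Metric.ball x₀ r
    · exact hfd.differentiableAt (h.isOpen.mem_nhds ((hmem x hb).1 hx))
    · exact (differentiableAt_const (0:ℝ)).congr_of_eventuallyEq (hf0 x hb)
  · intro x hx
    by_cases hb : x ∈ Metric.ball x₀ r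
    · exact (hB x ((hmem x hb).1 hx)).trans (le_max_left _ _)
    · rw [hfd0 x hb]; simp
  · intro x hx
    refine (hf0 x fun hb => ?_).self_of_nhds
    have h1 : ‖x - x₀‖ < r := by simpa [dist_eq_norm] using hb
    have h2 := norm_add_le (x - x₀) x₀
    rw [sub_add_cancel] at h2
    linarith

end IsGraphChart

end ChartMeasure

/-! ### Gluing the charts: the divergence theorem on the domain -/

section BoundaryMeasure

variable {n : ℕ} {Ω : Set (EuclideanSpace ℝ (Fin n))}

theorem integrable_of_continuousOn_of_measure_compl {X : Type*} [TopologicalSpace X] [T2Space X]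
    [MeasurableSpace X] [OpensMeasurableSpace X] {μ : Measure X} [IsFiniteMeasure μ]
    {s : Set X} (hs : IsCompact s) (hμ : μ sᶜ = 0) {g : X → ℝ} (hg : ContinuousOn g s) :
    Integrable g μ := by
  have h1 : IntegrableOn g s μ := hg.integrableOn_compact' hs hs.measurableSet
  rwa [IntegrableOn, Measure.restrict_eq_self_of_ae_mem] at h1
  exact mem_ae_iff.2 hμ

theorem IsGraphChart.isFiniteMeasure_graphMeasure {x₀ e : EuclideanSpace ℝ (Fin n)} {r : ℝ}
    {γ : EuclideanSpace ℝ (Fin n) → ℝ} (h : IsGraphChart Ω x₀ r e γ)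
    {χ : EuclideanSpace ℝ (Fin n) → ℝ} (hχ : Continuous χ)
    (hχs : tsupport χ ⊆ Metric.ball x₀ r) : IsFiniteMeasure (graphMeasure e γ χ) := by
  refine ⟨?_⟩
  have hG := h.continuous_graphMap
  have hN : Continuous (graphNormal e γ) := h.continuous_normal
  have h0 := h.lintegral_graphMeasure hχ 1 measurable_one
  simp only [Pi.one_apply, mul_one, lintegral_one] at h0
  rw [h0]
  have hc : HasCompactSupport fun y : (ℝ ∙ e)ᗮ =>
      χ (graphMap e γ y) * ‖graphNormal e γ (graphMap e γ y)‖ := by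
    -- The graph map does not contract distances, so preimages of bounded sets are bounded.
    have hK : IsCompact (graphMap e γ ⁻¹' Metric.closedBall x₀ r) :=
      Metric.isCompact_of_isClosed_isBounded (Metric.isClosed_closedBall.preimage hG)
        ((IsGraphChart.antilipschitz_graphMap (e := e) (γ := γ)).isBounded_preimage
          Metric.isBounded_closedBall)
    refine HasCompactSupport.of_support_subset_isCompact hK ?_
    intro y hy
    have hy0 : χ (graphMap e γ y) ≠ 0 := left_ne_zero_of_mul hy
    exact mem_preimage.2 (Metric.ball_subset_closedBall (hχs (subset_tsupport χ hy0)))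
  have hcont : Continuous fun y : (ℝ ∙ e)ᗮ =>
      χ (graphMap e γ y) * ‖graphNormal e γ (graphMap e γ y)‖ :=
    (hχ.comp hG).mul (hN.comp hG).norm
  have hi := hcont.integrable_of_hasCompactSupport (μ := volume) hc
  exact hi.lintegral_lt_top

theorem IsBoundedC2Domain.isCompact_closure (hΩ : IsBoundedC2Domain Ω) : IsCompact (closure Ω) :=
  hΩ.isBounded.isCompact_closure

theorem IsBoundedC2Domain.isCompact_frontier (hΩ : IsBoundedC2Domain Ω) : IsCompact (frontier Ω) :=
  hΩ.isCompact_closure.of_isClosed_subset isClosed_frontier frontier_subset_closure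

theorem IsBoundedC2Domain.volume_lt_top (hΩ : IsBoundedC2Domain Ω) : volume Ω < ⊤ :=
  hΩ.isBounded.measure_lt_top

/-- A finite smooth partition of unity on `closure Ω` subordinate to `Ω` and to chart balls. -/
theorem IsBoundedC2Domain.exists_partition (hΩ : IsBoundedC2Domain Ω) :
    ∃ (t : Finset (frontier Ω)) (r : frontier Ω → ℝ) (e : frontier Ω → EuclideanSpace ℝ (Fin n))
      (γ : frontier Ω → EuclideanSpace ℝ (Fin n) → ℝ)
      (χ : Option t → EuclideanSpace ℝ (Fin n) → ℝ),
      (∀ x : frontier Ω, IsGraphChart Ω (x : EuclideanSpace ℝ (Fin n)) (r x) (e x) (γ x)) ∧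
      (∀ i, ContDiff ℝ 1 (χ i)) ∧ (∀ i x, 0 ≤ χ i x) ∧ (∀ i x, χ i x ≤ 1) ∧
      (∀ x ∈ closure Ω, ∑ i, χ i x = 1) ∧ tsupport (χ none) ⊆ Ω ∧
      ∀ i : t, tsupport (χ (some i)) ⊆
        Metric.ball ((i : frontier Ω) : EuclideanSpace ℝ (Fin n)) (r i) := by
  choose r e γ hr h using fun x : frontier Ω => hΩ.exists_isGraphChart x.2
  obtain ⟨t, ht⟩ := hΩ.isCompact_frontier.elim_finite_subcover
    (fun x : frontier Ω => Metric.ball (x : EuclideanSpace ℝ (Fin n)) (r x))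
    (fun _ => Metric.isOpen_ball)
    (fun x hx => mem_iUnion.2 ⟨⟨x, hx⟩, Metric.mem_ball_self (hr _)⟩)
  let U : Option t → Set (EuclideanSpace ℝ (Fin n)) := fun i =>
    i.elim Ω fun i => Metric.ball ((i : frontier Ω) : EuclideanSpace ℝ (Fin n)) (r i)
  have hUo : ∀ i, IsOpen (U i) := by
    rintro (_ | i)
    · exact hΩ.isOpen
    · exact Metric.isOpen_ball
  have hU : closure Ω ⊆ ⋃ i, U i := by
    intro x hx
    by_cases hxΩ : x ∈ Ω
    · exact mem_iUnion.2 ⟨none, hxΩ⟩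
    · have hfr : x ∈ frontier Ω := by rw [hΩ.isOpen.frontier_eq]; exact ⟨hx, hxΩ⟩
      obtain ⟨i, hi⟩ := mem_iUnion.1 (ht hfr)
      obtain ⟨hit, hi⟩ := mem_iUnion.1 hi
      exact mem_iUnion.2 ⟨some ⟨i, hit⟩, hi⟩
  obtain ⟨f, hf⟩ := SmoothPartitionOfUnity.exists_isSubordinate
    (modelWithCornersSelf ℝ (EuclideanSpace ℝ (Fin n))) isClosed_closure U hUo hU
  refine ⟨t, r, e, γ, fun i => f i, h, fun i => ?_, fun i x => f.nonneg i x,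
    fun i x => f.le_one i x, fun x hx => ?_, hf none, fun i => hf (some i)⟩
  · exact (contMDiff_iff_contDiff.1 (f i).contMDiff).of_le (by norm_cast)
  · rw [← finsum_eq_sum_of_fintype]
    exact f.sum_eq_one hx

theorem IsBoundedC2Domain.exists_bound_fderiv_mul (hΩ : IsBoundedC2Domain Ω)
    {χ f : EuclideanSpace ℝ (Fin n) → ℝ} (hχ : ContDiff ℝ 1 χ)
    (hfc : ContinuousOn f (closure Ω)) (hfd : DifferentiableOn ℝ f Ω)
    (hB : ∃ B, ∀ x ∈ Ω, ‖fderiv ℝ f x‖ ≤ B) :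
    ∃ B, ∀ x ∈ Ω, ‖fderiv ℝ (fun x => χ x * f x) x‖ ≤ B := by
  obtain ⟨B, hB⟩ := hB
  obtain ⟨B1, hB1⟩ := hΩ.isCompact_closure.exists_bound_of_continuousOn hfc
  obtain ⟨B2, hB2⟩ := hΩ.isCompact_closure.exists_bound_of_continuousOn hχ.continuous.continuousOn
  obtain ⟨B3, hB3⟩ := hΩ.isCompact_closure.exists_bound_of_continuousOn
    (hχ.continuous_fderiv one_ne_zero).continuousOn
  refine ⟨B2 * B + B1 * B3, fun x hx => ?_⟩
  have hx' := subset_closure hx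
  have hfx := hfd.differentiableAt (hΩ.isOpen.mem_nhds hx)
  have h : fderiv ℝ (fun x => χ x * f x) x = χ x • fderiv ℝ f x + f x • fderiv ℝ χ x :=
    fderiv_fun_mul (hχ.differentiable one_ne_zero x) hfx
  rw [h]
  refine (norm_add_le _ _).trans ?_
  rw [norm_smul, norm_smul]
  have h1 := hB x hx
  have h2 := hB1 x hx'
  have h3 := hB2 x hx'
  have h4 := hB3 x hx'
  have := norm_nonneg (χ x)
  have := norm_nonneg (f x)
  have := norm_nonneg (fderiv ℝ f x)
  have := norm_nonneg (fderiv ℝ χ x)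
  gcongr <;> linarith

theorem IsBoundedC2Domain.integrableOn_fderiv (hΩ : IsBoundedC2Domain Ω)
    {f : EuclideanSpace ℝ (Fin n) → ℝ} (hB : ∃ B, ∀ x ∈ Ω, ‖fderiv ℝ f x‖ ≤ B)
    (w : EuclideanSpace ℝ (Fin n)) : IntegrableOn (fun x => fderiv ℝ f x w) Ω := by
  obtain ⟨B, hB⟩ := hB
  refine Measure.integrableOn_of_bounded (M := B * ‖w‖) hΩ.volume_lt_top.ne
    (measurable_fderiv_apply_const ℝ f w).aestronglyMeasurable ?_
  filter_upwards [ae_restrict_mem hΩ.isOpen.measurableSet] with x hx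
  exact (ContinuousLinearMap.le_opNorm _ _).trans
    (mul_le_mul_of_nonneg_right (hB x hx) (norm_nonneg _))

theorem IsBoundedC2Domain.setIntegral_fderiv_eq_zero (hΩ : IsBoundedC2Domain Ω)
    {f : EuclideanSpace ℝ (Fin n) → ℝ} (hfd : DifferentiableOn ℝ f Ω)
    (hB : ∃ B, ∀ x ∈ Ω, ‖fderiv ℝ f x‖ ≤ B) (hs : tsupport f ⊆ Ω)
    (w : EuclideanSpace ℝ (Fin n)) : ∫ x in Ω, fderiv ℝ f x w = 0 := by
  have hf0 : ∀ x ∉ Ω, f =ᶠ[𝓝 x] 0 := fun x hx =>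
    notMem_tsupport_iff_eventuallyEq.1 fun hc => hx (hs hc)
  have hsupp : Function.support (fun x => fderiv ℝ f x w) ⊆ Ω := by
    intro x hx
    by_contra hc
    refine hx ?_
    simp only
    rw [(hf0 x hc).fderiv_eq]; simp
  rw [setIntegral_eq_integral_of_forall_compl_eq_zero fun x hx => by
    by_contra hc; exact hx (hsupp hc)]
  have hd : Differentiable ℝ f := by
    intro x
    by_cases hx : x ∈ Ω
    · exact hfd.differentiableAt (hΩ.isOpen.mem_nhds hx)
    · exact (differentiableAt_const (0:ℝ)).congr_of_eventuallyEq (hf0 x hx)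
  refine integral_fderiv_eq_zero_of_hasCompactSupport hd
    (HasCompactSupport.of_support_subset_isCompact hΩ.isCompact_closure
      ((subset_tsupport f).trans (hs.trans subset_closure))) w ?_
  exact (integrableOn_iff_integrable_of_support_subset hsupp).1 (hΩ.integrableOn_fderiv hB w)

/-- The divergence theorem on a bounded `C²` domain, for a finite measure on the boundary which is
comparable to the Hausdorff measure. -/
theorem IsBoundedC2Domain.exists_boundaryMeasure (hn : 2 ≤ n) (hΩ : IsBoundedC2Domain Ω) :
    ∃ (μ : Measure (EuclideanSpace ℝ (Fin n))) (K : ℝ≥0), IsFiniteMeasure μ ∧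
      μ ≤ K • (surfaceMeasure n).restrict (frontier Ω) ∧
      (surfaceMeasure n).restrict (frontier Ω) ≤ K • μ ∧
      ∀ f : EuclideanSpace ℝ (Fin n) → ℝ, ContinuousOn f (closure Ω) → DifferentiableOn ℝ f Ω →
        (∃ B, ∀ x ∈ Ω, ‖fderiv ℝ f x‖ ≤ B) → ∀ w,
        ∫ x in Ω, fderiv ℝ f x w = ∫ x, f x * ⟪outerNormal Ω x, w⟫ ∂μ := by
  obtain ⟨t, r, e, γ, χ, h, hχd, hχ0, hχ1, hχsum, hχnone, hχsome⟩ := hΩ.exists_partition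
  have hχc : ∀ i, Continuous (χ i) := fun i => (hχd i).continuous
  choose D hD using fun i : t =>
    (h i).exists_graphMeasure_le hn (hχc (some i)) (hχ1 (some i)) (hχsome i)
  choose D' hD' using fun i : t => (h i).exists_le_graphMeasure hn (hχc (some i)) (hχsome i)
  have hfin : ∀ i : t, IsFiniteMeasure (graphMeasure (e i) (γ i) (χ (some i))) := fun i =>
    (h i).isFiniteMeasure_graphMeasure (hχc _) (hχsome i)
  have hleD' : ∀ i, D' i ≤ ∑ i, D' i := fun i =>
    Finset.single_le_sum (fun _ _ => zero_le) (Finset.mem_univ i)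
  have hfr0 : ∀ i : t, graphMeasure (e i) (γ i) (χ (some i)) (frontier Ω)ᶜ = 0 := by
    intro i
    refine le_antisymm ((hD i _).trans ?_) zero_le
    rw [Measure.smul_apply, Measure.restrict_apply isClosed_frontier.measurableSet.compl]
    simp
  -- The boundary measure is the sum of the chart measures weighted by the partition of unity. A
  -- single constant `K` dominates the constants of both comparisons.
  refine ⟨∑ i : t, graphMeasure (e i) (γ i) (χ (some i)), ∑ i, D i + ∑ i, D' i, ?_, ?_, ?_, ?_⟩
  · infer_instance
  · refine Measure.le_iff.2 fun A _ => ?_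
    rw [Measure.finsetSum_apply, Measure.smul_apply, add_smul, Finset.sum_smul]
    exact (Finset.sum_le_sum fun i _ => hD i A).trans le_self_add
  · refine Measure.le_iff.2 fun A hA => ?_
    -- On the frontier the interior bump `χ none` vanishes, so the boundary bumps alone sum to `1`
    -- there.
    have hsum : (surfaceMeasure n).restrict (frontier Ω) A =
        ∑ i : t, ((surfaceMeasure n).restrict (frontier Ω)).withDensity
          (fun x => ((χ (some i) x).toNNReal : ℝ≥0∞)) A := by
      have hm : ∀ i : t, Measurable fun x => ((χ (some i) x).toNNReal : ℝ≥0∞) := fun i =>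
        (continuous_real_toNNReal.comp (hχc _)).measurable.coe_nnreal_ennreal
      simp_rw [withDensity_apply _ hA]
      rw [← lintegral_finsetSum _ fun i _ => hm i]
      rw [← setLIntegral_one]
      refine setLIntegral_congr_fun_ae hA ?_
      filter_upwards [ae_restrict_mem isClosed_frontier.measurableSet] with x hx _
      have h1 := hχsum x (frontier_subset_closure hx)
      have h2 : χ none x = 0 := by
        refine image_eq_zero_of_notMem_tsupport fun hc => ?_
        rw [hΩ.isOpen.frontier_eq] at hx
        exact hx.2 (hχnone hc)
      rw [Fintype.sum_option, h2, zero_add] at h1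
      rw [← ENNReal.ofNNReal_finsetSum, ← Real.toNNReal_sum_of_nonneg fun i _ => hχ0 _ _, h1]
      simp
    rw [hsum, Measure.smul_apply, Measure.finsetSum_apply, Finset.smul_sum]
    refine Finset.sum_le_sum fun i _ => (hD' i A).trans ?_
    rw [Measure.smul_apply]
    refine smul_le_smul_of_nonneg_right ?_ zero_le
    exact (hleD' i).trans le_add_self
  · intro f hfc hfd hB w
    have hgd : ∀ i, DifferentiableOn ℝ (fun x => χ i x * f x) Ω := fun i =>
      ((hχd i).differentiable one_ne_zero).differentiableOn.mul hfd
    have hgB := fun i => hΩ.exists_bound_fderiv_mul (hχd i) hfc hfd hB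
    have hgs : ∀ i, tsupport (fun x => χ i x * f x) ⊆ tsupport (χ i) := fun i =>
      closure_mono fun x hx hc => hx (by simp only [hc, zero_mul])
    have hsplit : ∫ x in Ω, fderiv ℝ f x w =
        ∑ i, ∫ x in Ω, fderiv ℝ (fun x => χ i x * f x) x w := by
      rw [← integral_finsetSum _ fun i _ => hΩ.integrableOn_fderiv (hgB i) w]
      refine setIntegral_congr_fun hΩ.isOpen.measurableSet fun x hx => ?_
      have hev : f =ᶠ[𝓝 x] fun x => ∑ i, χ i x * f x := by
        filter_upwards [hΩ.isOpen.mem_nhds hx] with z hz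
        rw [← Finset.sum_mul, hχsum z (subset_closure hz), one_mul]
      rw [hev.fderiv_eq, fderiv_fun_sum fun i _ =>
        (hgd i).differentiableAt (hΩ.isOpen.mem_nhds hx)]
      simp
    rw [hsplit, Fintype.sum_option, hΩ.setIntegral_fderiv_eq_zero (hgd none) (hgB none)
      ((hgs none).trans hχnone), zero_add, integral_finsetSum_measure]
    · refine Finset.sum_congr rfl fun i _ => ?_
      obtain ⟨B, hB⟩ := hgB (some i)
      rw [(h i).setIntegral_fderiv_of_tsupport_subset (f := fun x => χ (some i) x * f x)
        ((hχc _).continuousOn.mul hfc)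
        (hgd (some i)) hB ((hgs (some i)).trans (hχsome i)) w,
        (h i).integral_graphMeasure (hχc _) (hχ0 _)]
      congr 1
      ext y
      by_cases hy : χ (some i) (graphMap (e i) (γ i) y) = 0
      · simp [hy]
      have hb := hχsome i (subset_tsupport _ hy)
      -- The factor `‖graphNormal‖` in the density cancels the normalization of the unit normal,
      -- leaving the flux through the unnormalized graph normal.
      have hN : ‖graphNormal (e i) (γ i) (graphMap (e i) (γ i) y)‖ ≠ 0 :=
        (zero_lt_one.trans_le ((h i).one_le_norm_normal _)).ne'
      rw [(h i).outerNormal_eq ((h i).mem_frontier ((h i).height_graphMap y) hb) hb,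
        inner_smul_left]
      simp
      field_simp
    · intro i _
      refine integrable_of_continuousOn_of_measure_compl hΩ.isCompact_frontier (hfr0 i) ?_
      exact (hfc.mono frontier_subset_closure).mul
        (hΩ.continuousOn_outerNormal.inner continuousOn_const)

end BoundaryMeasure

/-! ### Differentiation and integration on the closed cylinder -/

section SpaceTime

variable {n : ℕ} {Ω : Set (EuclideanSpace ℝ (Fin n))} {T : ℝ}

/-- A finite measure on the boundary of `Ω` for which the divergence theorem holds. -/
structure IsDivergenceMeasure (Ω : Set (EuclideanSpace ℝ (Fin n)))
    (μ : Measure (EuclideanSpace ℝ (Fin n))) : Prop where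
  isFiniteMeasure : IsFiniteMeasure μ
  measure_compl : μ (frontier Ω)ᶜ = 0
  setIntegral_fderiv : ∀ f : EuclideanSpace ℝ (Fin n) → ℝ, ContinuousOn f (closure Ω) →
    DifferentiableOn ℝ f Ω → (∃ B, ∀ x ∈ Ω, ‖fderiv ℝ f x‖ ≤ B) → ∀ w,
    ∫ x in Ω, fderiv ℝ f x w = ∫ x, f x * ⟪outerNormal Ω x, w⟫ ∂μ

theorem IsBoundedC2Domain.exists_isDivergenceMeasure (hn : 2 ≤ n) (hΩ : IsBoundedC2Domain Ω) :
    ∃ (μ : Measure (EuclideanSpace ℝ (Fin n))) (K : ℝ≥0), IsDivergenceMeasure Ω μ ∧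
      μ ≤ K • (surfaceMeasure n).restrict (frontier Ω) ∧
      (surfaceMeasure n).restrict (frontier Ω) ≤ K • μ := by
  obtain ⟨μ, K, hfin, h1, h2, h3⟩ := hΩ.exists_boundaryMeasure hn
  refine ⟨μ, K, ⟨hfin, ?_, h3⟩, h1, h2⟩
  refine le_antisymm ((h1 _).trans ?_) zero_le
  rw [Measure.smul_apply, Measure.restrict_apply isClosed_frontier.measurableSet.compl]
  simp

/-- The closed space-time cylinder. -/
def closedCyl (T : ℝ) (Ω : Set (EuclideanSpace ℝ (Fin n))) :
    Set (ℝ × EuclideanSpace ℝ (Fin n)) :=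
  Icc 0 T ×ˢ closure Ω

/-- The derivative of `g` in the direction `ξ` within `K`. -/
noncomputable def dirDeriv {X F : Type*} [NormedAddCommGroup X] [NormedSpace ℝ X]
    [NormedAddCommGroup F] [NormedSpace ℝ F] (K : Set X) (ξ : X) (g : X → F) (p : X) : F :=
  fderivWithin ℝ g K p ξ

theorem closure_cyl (hT : 0 < T) : closure (cyl T Ω) = closedCyl T Ω := by
  rw [cyl, closedCyl, closure_prod_eq, closure_Ioo hT.ne]

theorem cyl_subset_closedCyl : cyl T Ω ⊆ closedCyl T Ω :=
  prod_mono Ioo_subset_Icc_self subset_closure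

namespace IsBoundedC2Domain

theorem isOpen_cyl (hΩ : IsBoundedC2Domain Ω) : IsOpen (cyl T Ω) := isOpen_Ioo.prod hΩ.isOpen

theorem measurableSet_cyl (hΩ : IsBoundedC2Domain Ω) : MeasurableSet (cyl T Ω) :=
  hΩ.isOpen_cyl.measurableSet

theorem isCompact_closedCyl (hΩ : IsBoundedC2Domain Ω) : IsCompact (closedCyl T Ω) :=
  isCompact_Icc.prod hΩ.isCompact_closure

theorem uniqueDiffOn_closedCyl (hΩ : IsBoundedC2Domain Ω) (hT : 0 < T) :
    UniqueDiffOn ℝ (closedCyl T Ω) :=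
  (uniqueDiffOn_Icc hT).prod hΩ.uniqueDiffOn_closure

theorem closedCyl_mem_nhds (hΩ : IsBoundedC2Domain Ω) {p : ℝ × EuclideanSpace ℝ (Fin n)}
    (hp : p ∈ cyl T Ω) : closedCyl T Ω ∈ 𝓝 p :=
  mem_of_superset (hΩ.isOpen_cyl.mem_nhds hp) cyl_subset_closedCyl

theorem integrableOn_cyl (hΩ : IsBoundedC2Domain Ω) {F : Type*} [NormedAddCommGroup F]
    {g : ℝ × EuclideanSpace ℝ (Fin n) → F} (hg : ContinuousOn g (closedCyl T Ω)) :
    IntegrableOn g (cyl T Ω) :=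
  (hg.integrableOn_compact' hΩ.isCompact_closedCyl
    hΩ.isCompact_closedCyl.measurableSet).mono_set cyl_subset_closedCyl

theorem integrableOn_domain (hΩ : IsBoundedC2Domain Ω) {F : Type*} [NormedAddCommGroup F]
    {g : EuclideanSpace ℝ (Fin n) → F} (hg : ContinuousOn g (closure Ω)) :
    IntegrableOn g Ω :=
  (hg.integrableOn_compact' hΩ.isCompact_closure
    hΩ.isCompact_closure.measurableSet).mono_set subset_closure

end IsBoundedC2Domain

section DirDeriv

variable {X F : Type*} [NormedAddCommGroup X] [NormedSpace ℝ X]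
    [NormedAddCommGroup F] [NormedSpace ℝ F] {K : Set X}

theorem ContDiffOn.dirDeriv {g : X → F} (hg : ContDiffOn ℝ 2 g K) (hK : UniqueDiffOn ℝ K) (ξ : X) :
    ContDiffOn ℝ 1 (dirDeriv K ξ g) K :=
  (hg.fderivWithin hK (by norm_num)).clm_apply contDiffOn_const

theorem ContDiffOn.continuousOn_dirDeriv {g : X → F} (hg : ContDiffOn ℝ 1 g K)
    (hK : UniqueDiffOn ℝ K) (ξ : X) : ContinuousOn (_root_.dirDeriv K ξ g) K :=
  (hg.continuousOn_fderivWithin hK le_rfl).clm_apply continuousOn_const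

theorem HasFDerivWithinAt.dirDeriv_eq {g : X → F} {g' : X →L[ℝ] F} {p : X}
    (hg : HasFDerivWithinAt g g' K p) (hK : UniqueDiffOn ℝ K) (hp : p ∈ K) (ξ : X) :
    dirDeriv K ξ g p = g' ξ := by
  rw [dirDeriv, hg.fderivWithin (hK p hp)]

/-- At a point having `K` as a neighbourhood, second derivatives within `K` are ordinary ones, and
those are symmetric for a `C²` function. -/
theorem dirDeriv_comm {g : X → F} (hg : ContDiffOn ℝ 2 g K) (hK : UniqueDiffOn ℝ K) {p : X}
    (hp : K ∈ 𝓝 p) (ξ η : X) :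
    dirDeriv K ξ (dirDeriv K η g) p = dirDeriv K η (dirDeriv K ξ g) p := by
  have hpK := mem_of_mem_nhds hp
  have hd : DifferentiableWithinAt ℝ (fderivWithin ℝ g K) K p :=
    (hg.fderivWithin hK (m := 1) (by norm_num)).differentiableOn one_ne_zero p hpK
  have h1 : ∀ ξ η, dirDeriv K ξ (dirDeriv K η g) p =
      fderivWithin ℝ (fderivWithin ℝ g K) K p ξ η := by
    intro ξ η
    have := hd.hasFDerivWithinAt.clm_apply (hasFDerivWithinAt_const η p K)
    have h2 : HasFDerivWithinAt (dirDeriv K η g) _ K p := this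
    rw [h2.dirDeriv_eq hK hpK]
    simp
  rw [h1, h1]
  have h3 : IsSymmSndFDerivAt ℝ g p :=
    (hg.contDiffAt hp).isSymmSndFDerivAt (by simp)
  have h4 : IsSymmSndFDerivWithinAt ℝ g K p := by
    intro v w
    rw [fderivWithin_fderivWithin_eq_of_mem_nhds hp]
    exact h3 v w
  exact h4 ξ η

end DirDeriv

theorem HasFDerivWithinAt.slice_space {F : Type*} [NormedAddCommGroup F] [NormedSpace ℝ F]
    {g : ℝ × EuclideanSpace ℝ (Fin n) → F} {g' : ℝ × EuclideanSpace ℝ (Fin n) →L[ℝ] F}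
    {t : ℝ} (ht : t ∈ Icc 0 T) {x : EuclideanSpace ℝ (Fin n)}
    (h : HasFDerivWithinAt g g' (closedCyl T Ω) (t, x)) :
    HasFDerivWithinAt (fun y => g (t, y))
      (g'.comp (ContinuousLinearMap.inr ℝ ℝ (EuclideanSpace ℝ (Fin n)))) (closure Ω) x :=
  h.comp x (hasFDerivAt_prodMk_right t x).hasFDerivWithinAt fun _ hy => ⟨ht, hy⟩

theorem HasFDerivWithinAt.slice_time {F : Type*} [NormedAddCommGroup F] [NormedSpace ℝ F]
    {g : ℝ × EuclideanSpace ℝ (Fin n) → F} {g' : ℝ × EuclideanSpace ℝ (Fin n) →L[ℝ] F}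
    {t : ℝ} {x : EuclideanSpace ℝ (Fin n)} (hx : x ∈ closure Ω)
    (h : HasFDerivWithinAt g g' (closedCyl T Ω) (t, x)) :
    HasDerivWithinAt (fun s => g (s, x)) (g' (1, 0)) (Icc 0 T) t := by
  have h0 : HasFDerivWithinAt (fun s : ℝ => (s, x))
      (ContinuousLinearMap.inl ℝ ℝ (EuclideanSpace ℝ (Fin n))) (Icc 0 T) t :=
    (hasFDerivAt_prodMk_left t x).hasFDerivWithinAt
  have hm : MapsTo (fun s : ℝ => (s, x)) (Icc 0 T) (closedCyl T Ω) := fun _ hs => ⟨hs, hx⟩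
  simpa [Function.comp_def] using (h.comp t h0 hm).hasDerivWithinAt

theorem fderiv_slice_space {F : Type*} [NormedAddCommGroup F] [NormedSpace ℝ F]
    {g : ℝ × EuclideanSpace ℝ (Fin n) → F} (hΩ : IsBoundedC2Domain Ω)
    (hg : DifferentiableOn ℝ g (closedCyl T Ω)) {t : ℝ} (ht : t ∈ Icc 0 T)
    {x : EuclideanSpace ℝ (Fin n)} (hx : x ∈ Ω) :
    HasFDerivAt (fun y => g (t, y)) ((fderivWithin ℝ g (closedCyl T Ω) (t, x)).comp
      (ContinuousLinearMap.inr ℝ ℝ (EuclideanSpace ℝ (Fin n)))) x :=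
  ((hg (t, x) ⟨ht, subset_closure hx⟩).hasFDerivWithinAt.slice_space ht).hasFDerivAt
    (mem_of_superset (hΩ.isOpen.mem_nhds hx) subset_closure)

/-- Fubini, then the fundamental theorem of calculus on each segment `[0, T] × {x}`. -/
theorem setIntegral_dirDeriv_time (hΩ : IsBoundedC2Domain Ω) (hT : 0 < T)
    {g : ℝ × EuclideanSpace ℝ (Fin n) → ℝ} (hg : ContDiffOn ℝ 1 g (closedCyl T Ω)) :
    ∫ p in cyl T Ω, dirDeriv (closedCyl T Ω) (1, 0) g p = ∫ x in Ω, (g (T, x) - g (0, x)) := by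
  have hK := hΩ.uniqueDiffOn_closedCyl hT
  have hint := hΩ.integrableOn_cyl (hg.continuousOn_dirDeriv hK (1, 0))
  have hprod : (volume : Measure (ℝ × EuclideanSpace ℝ (Fin n))).restrict (cyl T Ω) =
      (volume.restrict (Ioo 0 T)).prod (volume.restrict Ω) := by
    rw [cyl, Measure.volume_eq_prod, Measure.prod_restrict]
  rw [IntegrableOn, hprod] at hint
  rw [hprod, integral_prod_symm _ hint]
  refine integral_congr_ae ?_
  filter_upwards [ae_restrict_mem hΩ.isOpen.measurableSet] with x hx
  have hxc := subset_closure hx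
  have hd : ∀ t ∈ Icc 0 T, HasDerivWithinAt (fun s => g (s, x))
      (dirDeriv (closedCyl T Ω) (1, 0) g (t, x)) (Icc 0 T) t := fun t ht =>
    (hg.differentiableOn one_ne_zero (t, x) ⟨ht, hxc⟩).hasFDerivWithinAt.slice_time hxc
  rw [← integral_Ioc_eq_integral_Ioo, ← intervalIntegral.integral_of_le hT.le]
  refine intervalIntegral.integral_eq_sub_of_hasDerivAt_of_le (f := fun s => g (s, x)) hT.le
    (fun t ht => (hd t ht).continuousWithinAt)
    (fun t ht => (hd t (Ioo_subset_Icc_self ht)).hasDerivAt (Icc_mem_nhds ht.1 ht.2)) ?_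
  refine ContinuousOn.intervalIntegrable_of_Icc hT.le ?_
  exact (hg.continuousOn_dirDeriv hK (1, 0)).comp (by fun_prop) fun t ht => ⟨ht, hxc⟩

/-- The divergence theorem on each time slice; compactness of the closed cylinder supplies the
gradient bound it needs. The sum stays under the integral so that fluxes in different directions can
be combined pointwise on the boundary. -/
theorem setIntegral_sum_dirDeriv_space (hΩ : IsBoundedC2Domain Ω) (hT : 0 < T)
    {μ : Measure (EuclideanSpace ℝ (Fin n))} (hμ : IsDivergenceMeasure Ω μ)
    {ι : Type*} [Fintype ι] {g : ι → ℝ × EuclideanSpace ℝ (Fin n) → ℝ}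
    (hg : ∀ i, ContDiffOn ℝ 1 (g i) (closedCyl T Ω)) (w : ι → EuclideanSpace ℝ (Fin n)) :
    ∫ p in cyl T Ω, ∑ i, dirDeriv (closedCyl T Ω) (0, w i) (g i) p =
      ∫ t in Ioo 0 T, ∫ x, ∑ i, g i (t, x) * ⟪outerNormal Ω x, w i⟫ ∂μ := by
  have hK := hΩ.uniqueDiffOn_closedCyl hT
  have := hμ.isFiniteMeasure
  have hcont : ∀ i, ContinuousOn (dirDeriv (closedCyl T Ω) (0, w i) (g i)) (closedCyl T Ω) :=
    fun i => (hg i).continuousOn_dirDeriv hK _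
  have hint := hΩ.integrableOn_cyl (continuousOn_finsetSum Finset.univ fun i _ => hcont i)
  rw [cyl, Measure.volume_eq_prod, setIntegral_prod _ (by rwa [cyl, Measure.volume_eq_prod] at hint)]
  refine setIntegral_congr_fun measurableSet_Ioo fun t ht => ?_
  have htc := Ioo_subset_Icc_self ht
  have hslice : ∀ i, ContinuousOn (fun x => g i (t, x)) (closure Ω) := fun i =>
    (hg i).continuousOn.comp (by fun_prop) fun x hx => ⟨htc, hx⟩
  rw [integral_finsetSum, integral_finsetSum]
  · refine Finset.sum_congr rfl fun i _ => ?_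
    have hd := fun x (hx : x ∈ Ω) =>
      fderiv_slice_space hΩ ((hg i).differentiableOn one_ne_zero) htc hx
    rw [← hμ.setIntegral_fderiv (fun x => g i (t, x)) (hslice i)
      (fun x hx => (hd x hx).differentiableAt.differentiableWithinAt) ?_ (w i)]
    · refine setIntegral_congr_fun hΩ.isOpen.measurableSet fun x hx => ?_
      rw [(hd x hx).fderiv]
      simp [dirDeriv]
    · obtain ⟨B, hB⟩ := (hΩ.isCompact_closedCyl (T := T)).exists_bound_of_continuousOn
        ((hg i).continuousOn_fderivWithin hK le_rfl)
      refine ⟨B * ‖ContinuousLinearMap.inr ℝ ℝ (EuclideanSpace ℝ (Fin n))‖, fun x hx => ?_⟩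
      rw [(hd x hx).fderiv]
      exact (ContinuousLinearMap.opNorm_comp_le _ _).trans
        (mul_le_mul_of_nonneg_right (hB _ ⟨htc, subset_closure hx⟩) (norm_nonneg _))
  · intro i _
    refine integrable_of_continuousOn_of_measure_compl hΩ.isCompact_frontier hμ.measure_compl ?_
    exact ((hslice i).mono frontier_subset_closure).mul
      (hΩ.continuousOn_outerNormal.inner continuousOn_const)
  · intro i _
    refine hΩ.integrableOn_domain ?_
    exact (hcont i).comp (by fun_prop) fun x hx => ⟨htc, hx⟩

end SpaceTime

/-! ### Multiplier identity, Poincaré inequality and the conjugated estimate -/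

section Energy

variable {n : ℕ} {Ω : Set (EuclideanSpace ℝ (Fin n))} {T : ℝ}

/-- The wave operator `∂_t² - Δ`, with derivatives within `K`. -/
noncomputable def boxOp {F : Type*} [NormedAddCommGroup F] [NormedSpace ℝ F]
    (K : Set (ℝ × EuclideanSpace ℝ (Fin n))) (v : ℝ × EuclideanSpace ℝ (Fin n) → F)
    (p : ℝ × EuclideanSpace ℝ (Fin n)) : F :=
  dirDeriv K (1, 0) (dirDeriv K (1, 0) v) p -
    ∑ j, dirDeriv K (0, EuclideanSpace.single j 1) (dirDeriv K (0, EuclideanSpace.single j 1) v) p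

theorem sum_inner_single_mul_inner_single (x y : EuclideanSpace ℝ (Fin n)) :
    ∑ j, ⟪x, EuclideanSpace.single j (1:ℝ)⟫ * ⟪y, EuclideanSpace.single j (1:ℝ)⟫ = ⟪x, y⟫ := by
  have := (EuclideanSpace.basisFun (Fin n) ℝ).sum_inner_mul_inner x y
  simp only [EuclideanSpace.basisFun_apply] at this
  rw [← this]
  refine Finset.sum_congr rfl fun j _ => ?_
  rw [real_inner_comm y]

theorem dirDeriv_space_eq_sum {F : Type*} [NormedAddCommGroup F] [NormedSpace ℝ F]
    (K : Set (ℝ × EuclideanSpace ℝ (Fin n))) (ω : EuclideanSpace ℝ (Fin n))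
    (g : ℝ × EuclideanSpace ℝ (Fin n) → F) (p : ℝ × EuclideanSpace ℝ (Fin n)) :
    dirDeriv K (0, ω) g p =
      ∑ j, ⟪ω, EuclideanSpace.single j (1:ℝ)⟫ • dirDeriv K (0, EuclideanSpace.single j 1) g p := by
  have h : ((0, ω) : ℝ × EuclideanSpace ℝ (Fin n)) =
      ∑ j, ⟪ω, EuclideanSpace.single j (1:ℝ)⟫ •
        ((0, EuclideanSpace.single j 1) : ℝ × EuclideanSpace ℝ (Fin n)) := by
    have h1 := (EuclideanSpace.basisFun (Fin n) ℝ).sum_repr' ω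
    simp only [EuclideanSpace.basisFun_apply] at h1
    refine Prod.ext ?_ ?_
    · simp [Prod.fst_sum]
    · rw [Prod.snd_sum]
      conv_lhs => rw [show ((0, ω) : ℝ × EuclideanSpace ℝ (Fin n)).2 = ω from rfl, ← h1]
      refine Finset.sum_congr rfl fun j _ => ?_
      rw [real_inner_comm]; rfl
  rw [dirDeriv, h, map_sum]
  simp only [map_smul, dirDeriv]

theorem dirDeriv_space_eq_zero (hΩ : IsBoundedC2Domain Ω)
    {F : Type*} [NormedAddCommGroup F] [NormedSpace ℝ F]
    {v : ℝ × EuclideanSpace ℝ (Fin n) → F} (hv : DifferentiableOn ℝ v (closedCyl T Ω)) {t : ℝ}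
    (ht : t ∈ Icc 0 T) (h0 : ∀ x ∈ Ω, v (t, x) = 0) {x : EuclideanSpace ℝ (Fin n)} (hx : x ∈ Ω)
    (w : EuclideanSpace ℝ (Fin n)) : dirDeriv (closedCyl T Ω) (0, w) v (t, x) = 0 := by
  have h1 := fderiv_slice_space hΩ hv ht hx
  have h2 : (fun y => v (t, y)) =ᶠ[𝓝 x] fun _ => 0 := by
    filter_upwards [hΩ.isOpen.mem_nhds hx] with y hy using h0 y hy
  have h3 := h1.fderiv
  rw [h2.fderiv_eq] at h3
  have h4 := congrArg (fun L : EuclideanSpace ℝ (Fin n) →L[ℝ] F => L w) h3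
  simpa [dirDeriv] using h4.symm

theorem dirDeriv_time_eq_zero {F : Type*} [NormedAddCommGroup F] [NormedSpace ℝ F]
    {v : ℝ × EuclideanSpace ℝ (Fin n) → F} (hv : DifferentiableOn ℝ v (closedCyl T Ω)) {t : ℝ}
    (ht : t ∈ Ioo 0 T) (h0 : ∀ t ∈ Ioo 0 T, ∀ x ∈ frontier Ω, v (t, x) = 0)
    {x : EuclideanSpace ℝ (Fin n)} (hx : x ∈ frontier Ω) :
    dirDeriv (closedCyl T Ω) (1, 0) v (t, x) = 0 := by
  have hxc := frontier_subset_closure hx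
  have h1 := ((hv (t, x) ⟨Ioo_subset_Icc_self ht, hxc⟩).hasFDerivWithinAt.slice_time hxc).hasDerivAt
    (Icc_mem_nhds ht.1 ht.2)
  have h2 : (fun s => v (s, x)) =ᶠ[𝓝 t] fun _ => 0 := by
    filter_upwards [isOpen_Ioo.mem_nhds ht] with s hs using h0 s hs x hx
  exact h1.unique ((hasDerivAt_const t (0:F)).congr_of_eventuallyEq h2)

theorem dirDeriv_space_boundary (hΩ : IsBoundedC2Domain Ω)
    {v : ℝ × EuclideanSpace ℝ (Fin n) → ℝ} (hv : DifferentiableOn ℝ v (closedCyl T Ω)) {t : ℝ}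
    (ht : t ∈ Ioo 0 T) (h0 : ∀ t ∈ Ioo 0 T, ∀ x ∈ frontier Ω, v (t, x) = 0)
    {x : EuclideanSpace ℝ (Fin n)} (hx : x ∈ frontier Ω) (w : EuclideanSpace ℝ (Fin n)) :
    dirDeriv (closedCyl T Ω) (0, w) v (t, x) =
      ⟪outerNormal Ω x, w⟫ * dirDeriv (closedCyl T Ω) (0, outerNormal Ω x) v (t, x) := by
  have htc := Ioo_subset_Icc_self ht
  have hxc := frontier_subset_closure hx
  have h1 := (hv (t, x) ⟨htc, hxc⟩).hasFDerivWithinAt.slice_space htc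
  simpa [dirDeriv] using hΩ.fderivWithin_apply_of_eq_zero (h0 t ht) hx h1 w

/-- The multiplier identity for `∂_t² - Δ` with the multiplier `∂_t - ω·∇`. -/
theorem setIntegral_boxOp_mul (hΩ : IsBoundedC2Domain Ω) (hT : 0 < T)
    {μ : Measure (EuclideanSpace ℝ (Fin n))} (hμ : IsDivergenceMeasure Ω μ)
    (ω : EuclideanSpace ℝ (Fin n))
    {v : ℝ × EuclideanSpace ℝ (Fin n) → ℝ} (hv : ContDiffOn ℝ 2 v (closedCyl T Ω))
    (hvS : ∀ t ∈ Ioo 0 T, ∀ x ∈ frontier Ω, v (t, x) = 0) (hv0 : ∀ x ∈ Ω, v (0, x) = 0)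
    (hvt0 : ∀ x ∈ Ω, dirDeriv (closedCyl T Ω) (1, 0) v (0, x) = 0) :
    ∫ p in cyl T Ω, 2 * boxOp (closedCyl T Ω) v p *
        (dirDeriv (closedCyl T Ω) (1, 0) v p - dirDeriv (closedCyl T Ω) (0, ω) v p) =
      (∫ x in Ω, (dirDeriv (closedCyl T Ω) (1, 0) v (T, x) ^ 2 +
        ∑ j, dirDeriv (closedCyl T Ω) (0, EuclideanSpace.single j 1) v (T, x) ^ 2 -
        2 * (dirDeriv (closedCyl T Ω) (1, 0) v (T, x) *
          dirDeriv (closedCyl T Ω) (0, ω) v (T, x)))) +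
      ∫ t in Ioo 0 T, ∫ x, dirDeriv (closedCyl T Ω) (0, outerNormal Ω x) v (t, x) ^ 2 *
        ⟪outerNormal Ω x, ω⟫ ∂μ := by
  have hK := hΩ.uniqueDiffOn_closedCyl hT
  set K := closedCyl T Ω with hKdef
  set e : Fin n → EuclideanSpace ℝ (Fin n) := fun j => EuclideanSpace.single j 1 with he
  have hD : ∀ ξ, ContDiffOn ℝ 1 (dirDeriv K ξ v) K := fun ξ => hv.dirDeriv hK ξ
  set vt := dirDeriv K (1, 0) v with hvt
  set vo := dirDeriv K (0, ω) v with hvo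
  set vj : Fin n → ℝ × EuclideanSpace ℝ (Fin n) → ℝ := fun j => dirDeriv K (0, e j) v with hvj
  have hct : ContDiffOn ℝ 1 vt K := hD _
  have hco : ContDiffOn ℝ 1 vo K := hD _
  have hcj : ∀ j, ContDiffOn ℝ 1 (vj j) K := fun j => hD _
  -- the fluxes in the directions `∂_t`, `ω` and `e j`
  set g0 : ℝ × EuclideanSpace ℝ (Fin n) → ℝ := fun p =>
    vt p * vt p + ∑ j, vj j p * vj j p - 2 * (vt p * vo p) with hg0
  set G : Option (Fin n) → ℝ × EuclideanSpace ℝ (Fin n) → ℝ := fun i p =>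
    i.elim (vt p * vt p - ∑ j, vj j p * vj j p) fun j => 2 * (vj j p * vo p) - 2 * (vj j p * vt p)
    with hG
  set w : Option (Fin n) → EuclideanSpace ℝ (Fin n) := fun i => i.elim ω e with hw
  have hcsum : ContDiffOn ℝ 1 (fun p => ∑ j, vj j p * vj j p) K :=
    ContDiffOn.sum fun j _ => (hcj j).mul (hcj j)
  have hcg0 : ContDiffOn ℝ 1 g0 K :=
    ((hct.mul hct).add hcsum).sub (contDiffOn_const.mul (hct.mul hco))
  have hcG : ∀ i, ContDiffOn ℝ 1 (G i) K := by
    rintro (_ | j)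
    · exact (hct.mul hct).sub hcsum
    · exact (contDiffOn_const.mul ((hcj j).mul hco)).sub (contDiffOn_const.mul ((hcj j).mul hct))
  -- After the product rule every mixed second derivative cancels once the derivatives are commuted;
  -- what survives is `2 (v_tt - Δv)(v_t - v_ω)`.
  have hpt : ∀ p ∈ cyl T Ω, 2 * boxOp K v p * (vt p - vo p) =
      dirDeriv K (1, 0) g0 p + ∑ i, dirDeriv K (0, w i) (G i) p := by
    intro p hp
    have hpK : p ∈ K := cyl_subset_closedCyl hp
    have hpn := hΩ.closedCyl_mem_nhds hp
    have hdt := (hct.differentiableOn one_ne_zero p hpK).hasFDerivWithinAt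
    have hdo := (hco.differentiableOn one_ne_zero p hpK).hasFDerivWithinAt
    have hdj := fun j => ((hcj j).differentiableOn one_ne_zero p hpK).hasFDerivWithinAt
    have hds : HasFDerivWithinAt (fun p => ∑ j, vj j p * vj j p) _ K p :=
      HasFDerivWithinAt.fun_sum fun j _ => (hdj j).mul (hdj j)
    have hd0 : HasFDerivWithinAt g0 _ K p :=
      ((hdt.mul hdt).add hds).sub ((hdt.mul hdo).const_mul 2)
    have hdGn : HasFDerivWithinAt (G none) _ K p := (hdt.mul hdt).sub hds
    have hdGs : ∀ j, HasFDerivWithinAt (G (some j)) _ K p := fun j =>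
      (((hdj j).mul hdo).const_mul 2).sub (((hdj j).mul hdt).const_mul 2)
    rw [Fintype.sum_option, hd0.dirDeriv_eq hK hpK, hdGn.dirDeriv_eq hK hpK]
    simp_rw [fun j => (hdGs j).dirDeriv_eq hK hpK]
    have hfold : ∀ ξ (g : ℝ × EuclideanSpace ℝ (Fin n) → ℝ),
        fderivWithin ℝ g K p ξ = dirDeriv K ξ g p := fun _ _ => rfl
    simp only [sub_apply, add_apply,
      smul_apply, smul_eq_mul, sum_apply, hfold, hw,
      Option.elim_none, Option.elim_some]
    have c1 : dirDeriv K (1, 0) vo p = dirDeriv K (0, ω) vt p := dirDeriv_comm hv hK hpn _ _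
    have c2 : ∀ j, dirDeriv K (1, 0) (vj j) p = dirDeriv K (0, e j) vt p :=
      fun j => dirDeriv_comm hv hK hpn _ _
    have c3 : ∀ j, dirDeriv K (0, ω) (vj j) p = dirDeriv K (0, e j) vo p :=
      fun j => dirDeriv_comm hv hK hpn _ _
    simp only [c1, c2, c3, boxOp]
    change 2 * (dirDeriv K (1, 0) vt p - ∑ j, dirDeriv K (0, e j) (vj j) p) * _ = _
    simp only [mul_add, Finset.sum_add_distrib, Finset.sum_sub_distrib, ← Finset.mul_sum]
    ring
  have hcont0 := hΩ.integrableOn_cyl (hcg0.continuousOn_dirDeriv hK (1, 0))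
  have hcontG := hΩ.integrableOn_cyl (continuousOn_finsetSum Finset.univ fun i _ =>
    (hcG i).continuousOn_dirDeriv hK (0, w i))
  rw [setIntegral_congr_fun hΩ.measurableSet_cyl hpt, integral_add hcont0 hcontG,
    setIntegral_dirDeriv_time hΩ hT hcg0, setIntegral_sum_dirDeriv_space hΩ hT hμ hcG w]
  congr 1
  · refine setIntegral_congr_fun hΩ.isOpen.measurableSet fun x hx => ?_
    -- The slice `t = 0` contributes nothing: `v_t` vanishes there by hypothesis and the spatial
    -- gradient because `v (0, ·)` is zero on `Ω`.
    have h1 : vt (0, x) = 0 := hvt0 x hx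
    have h2 : ∀ j, vj j (0, x) = 0 := fun j =>
      dirDeriv_space_eq_zero hΩ (hv.differentiableOn two_ne_zero) ⟨le_rfl, hT.le⟩ hv0 hx _
    simp only [hg0, h1, h2]
    simp only [pow_two, mul_zero, zero_mul, Finset.sum_const_zero, add_zero, sub_zero]
    rfl
  · refine setIntegral_congr_fun measurableSet_Ioo fun t ht => ?_
    refine integral_congr_ae ?_
    have hae : ∀ᵐ x ∂μ, x ∈ frontier Ω := mem_ae_iff.2 hμ.measure_compl
    filter_upwards [hae] with x hx
    have h1 : vt (t, x) = 0 :=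
      dirDeriv_time_eq_zero (hv.differentiableOn two_ne_zero) ht hvS hx
    have h2 : ∀ w, dirDeriv K (0, w) v (t, x) =
        ⟪outerNormal Ω x, w⟫ * dirDeriv K (0, outerNormal Ω x) v (t, x) := fun w =>
      dirDeriv_space_boundary hΩ (hv.differentiableOn two_ne_zero) ht hvS hx w
    have h3 : ∑ j, ⟪outerNormal Ω x, e j⟫ * ⟪outerNormal Ω x, e j⟫ = 1 := by
      rw [sum_inner_single_mul_inner_single, real_inner_self_eq_norm_sq,
        (hΩ.isOuterUnitNormal hx).norm_eq_one]
      norm_num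
    rw [Fintype.sum_option]
    simp only [hG, hw, Option.elim_none, Option.elim_some, h1]
    simp only [hvj, hvo]
    rw [h2 ω]
    simp only [fun j => h2 (e j)]
    set a := dirDeriv K (0, outerNormal Ω x) v (t, x)
    set b := ⟪outerNormal Ω x, ω⟫
    -- On the lateral boundary `v_t = 0` and `∇v = a ν`, with `a = ∂_ν v` and `b = ν·ω`. The flux
    -- along `ω` is then `-a² b`, the coordinate fluxes add up to `2 a² b`, and the total is `a² b`.
    have h4 : ∑ j, ⟪outerNormal Ω x, e j⟫ * a * (⟪outerNormal Ω x, e j⟫ * a) = a ^ 2 := by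
      rw [← one_mul (a ^ 2), ← h3, Finset.sum_mul]
      exact Finset.sum_congr rfl fun j _ => by ring
    have h5 : ∑ j, (2 * (⟪outerNormal Ω x, e j⟫ * a * (b * a)) -
        2 * (⟪outerNormal Ω x, e j⟫ * a * 0)) * ⟪outerNormal Ω x, e j⟫ = 2 * b * a ^ 2 := by
      rw [← mul_one (2 * b * a ^ 2), ← h3, Finset.mul_sum]
      exact Finset.sum_congr rfl fun j _ => by ring
    rw [h4, h5]
    ring

/-- Poincaré inequality along the characteristic direction `∂_t - ω·∇`. -/
theorem setIntegral_sq_le (hΩ : IsBoundedC2Domain Ω) (hT : 0 < T)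
    {μ : Measure (EuclideanSpace ℝ (Fin n))} (hμ : IsDivergenceMeasure Ω μ)
    (ω : EuclideanSpace ℝ (Fin n))
    {v : ℝ × EuclideanSpace ℝ (Fin n) → ℝ} (hv : ContDiffOn ℝ 1 v (closedCyl T Ω))
    (hvS : ∀ t ∈ Ioo 0 T, ∀ x ∈ frontier Ω, v (t, x) = 0) (hv0 : ∀ x ∈ Ω, v (0, x) = 0) :
    ∫ p in cyl T Ω, v p ^ 2 ≤ 4 * T ^ 2 * ∫ p in cyl T Ω,
      (dirDeriv (closedCyl T Ω) (1, 0) v p - dirDeriv (closedCyl T Ω) (0, ω) v p) ^ 2 := by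
  have hK := hΩ.uniqueDiffOn_closedCyl hT
  set K := closedCyl T Ω with hKdef
  -- The factor `T - t` makes `g` vanish at `t = T`; at `t = 0` and on the lateral boundary it
  -- vanishes with `v`. So `Zg = -v² + 2 (T - t) v Zv` integrates to zero, and no boundary term
  -- arises.
  set g : ℝ × EuclideanSpace ℝ (Fin n) → ℝ := fun p => (T - p.1) * (v p * v p) with hg
  have hcT : ContDiffOn ℝ 1 (fun p : ℝ × EuclideanSpace ℝ (Fin n) => T - p.1) K :=
    (contDiff_const.sub contDiff_fst).contDiffOn
  have hcg : ContDiffOn ℝ 1 g K := hcT.mul (hv.mul hv)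
  have h1 := setIntegral_dirDeriv_time hΩ hT hcg
  have h2 := setIntegral_sum_dirDeriv_space hΩ hT hμ (ι := Unit) (fun _ => hcg) (fun _ => ω)
  have h1' : ∫ x in Ω, (g (T, x) - g (0, x)) = 0 := by
    refine integral_eq_zero_of_ae ?_
    filter_upwards [ae_restrict_mem hΩ.isOpen.measurableSet] with x hx
    simp [hg, hv0 x hx]
  have h2' : ∫ t in Ioo 0 T, ∫ x, ∑ _i : Unit, g (t, x) * ⟪outerNormal Ω x, ω⟫ ∂μ = 0 := by
    refine integral_eq_zero_of_ae ?_
    filter_upwards [ae_restrict_mem measurableSet_Ioo] with t ht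
    refine integral_eq_zero_of_ae ?_
    have hae : ∀ᵐ x ∂μ, x ∈ frontier Ω := mem_ae_iff.2 hμ.measure_compl
    filter_upwards [hae] with x hx
    simp [hg, hvS t ht x hx]
  rw [h1'] at h1
  rw [h2'] at h2
  simp only [Finset.univ_unique, Finset.sum_singleton] at h2
  set vt := dirDeriv K (1, 0) v
  set vo := dirDeriv K (0, ω) v
  have hct : ContinuousOn vt K := hv.continuousOn_dirDeriv hK _
  have hco : ContinuousOn vo K := hv.continuousOn_dirDeriv hK _
  have hvc : ContinuousOn v K := hv.continuousOn
  -- This is the square `(v - 2 (T - t) Zv)² ≥ 0` together with `(T - t)² ≤ T²`; it is the source of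
  -- the constant `4 T²`.
  have hpt : ∀ p ∈ cyl T Ω, (1 / 2) * v p ^ 2 ≤ 2 * T ^ 2 * (vt p - vo p) ^ 2 -
      (dirDeriv K (1, 0) g p - dirDeriv K (0, ω) g p) := by
    intro p hp
    have hpK : p ∈ K := cyl_subset_closedCyl hp
    have hdv := (hv.differentiableOn one_ne_zero p hpK).hasFDerivWithinAt
    have hdT : HasFDerivWithinAt (fun p : ℝ × EuclideanSpace ℝ (Fin n) => T - p.1)
        (-ContinuousLinearMap.fst ℝ ℝ (EuclideanSpace ℝ (Fin n))) K p :=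
      (hasFDerivAt_fst.const_sub T).hasFDerivWithinAt
    have hdg : HasFDerivWithinAt g _ K p := hdT.mul (hdv.mul hdv)
    rw [hdg.dirDeriv_eq hK hpK, hdg.dirDeriv_eq hK hpK]
    have hfold : ∀ ξ, fderivWithin ℝ v K p ξ = dirDeriv K ξ v p := fun _ => rfl
    simp only [add_apply, neg_apply,
      smul_apply, smul_eq_mul, hfold, ContinuousLinearMap.coe_fst']
    change _ ≤ 2 * T ^ 2 * (vt p - vo p) ^ 2 - ((T - p.1) * (v p * vt p + v p * vt p) + _ -
      ((T - p.1) * (v p * vo p + v p * vo p) + _))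
    have hp1 : 0 < p.1 ∧ p.1 < T := hp.1
    have hTp : (T - p.1) ^ 2 ≤ T ^ 2 := by nlinarith
    have := mul_le_mul_of_nonneg_right hTp (sq_nonneg (vt p - vo p))
    nlinarith [sq_nonneg (v p - 2 * (T - p.1) * (vt p - vo p))]
  have hi1 : IntegrableOn (fun p => 2 * T ^ 2 * (vt p - vo p) ^ 2) (cyl T Ω) :=
    hΩ.integrableOn_cyl (continuousOn_const.mul ((hct.sub hco).pow 2))
  have hi2 := hΩ.integrableOn_cyl (hcg.continuousOn_dirDeriv hK (1, 0))
  have hi3 := hΩ.integrableOn_cyl (hcg.continuousOn_dirDeriv hK (0, ω))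
  have hi4 : IntegrableOn (fun p => (1 / 2) * v p ^ 2) (cyl T Ω) :=
    hΩ.integrableOn_cyl (continuousOn_const.mul (hvc.pow 2))
  have hi23 : IntegrableOn (fun p => dirDeriv K (1, 0) g p - dirDeriv K (0, ω) g p) (cyl T Ω) :=
    hi2.sub hi3
  have hle := setIntegral_mono_on hi4 (hi1.sub hi23) hΩ.measurableSet_cyl hpt
  simp only [Pi.sub_apply] at hle
  rw [integral_sub hi1 hi23, integral_sub hi2 hi3, h1, h2, integral_const_mul, integral_const_mul] at hle
  linarith

/-- The Carleman estimate for the conjugated operator `∂_t² - Δ + 2λ(∂_t - ω·∇)`. -/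
theorem carleman_conjugated (hΩ : IsBoundedC2Domain Ω) (hT : 0 < T)
    {μ : Measure (EuclideanSpace ℝ (Fin n))} (hμ : IsDivergenceMeasure Ω μ)
    (ω : EuclideanSpace ℝ (Fin n))
    {v : ℝ × EuclideanSpace ℝ (Fin n) → ℝ} (hv : ContDiffOn ℝ 2 v (closedCyl T Ω))
    (hvS : ∀ t ∈ Ioo 0 T, ∀ x ∈ frontier Ω, v (t, x) = 0) (hv0 : ∀ x ∈ Ω, v (0, x) = 0)
    (hvt0 : ∀ x ∈ Ω, dirDeriv (closedCyl T Ω) (1, 0) v (0, x) = 0) (lam : ℝ) :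
    lam ^ 2 / T ^ 2 * (∫ p in cyl T Ω, v p ^ 2) +
      2 * lam * ((∫ x in Ω, (dirDeriv (closedCyl T Ω) (1, 0) v (T, x) ^ 2 +
        ∑ j, dirDeriv (closedCyl T Ω) (0, EuclideanSpace.single j 1) v (T, x) ^ 2 -
        2 * (dirDeriv (closedCyl T Ω) (1, 0) v (T, x) *
          dirDeriv (closedCyl T Ω) (0, ω) v (T, x)))) +
      ∫ t in Ioo 0 T, ∫ x, dirDeriv (closedCyl T Ω) (0, outerNormal Ω x) v (t, x) ^ 2 *
        ⟪outerNormal Ω x, ω⟫ ∂μ) ≤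
    ∫ p in cyl T Ω, (boxOp (closedCyl T Ω) v p + 2 * lam *
      (dirDeriv (closedCyl T Ω) (1, 0) v p - dirDeriv (closedCyl T Ω) (0, ω) v p)) ^ 2 := by
  have hK := hΩ.uniqueDiffOn_closedCyl hT
  have hP := setIntegral_sq_le hΩ hT hμ ω (hv.of_le one_le_two) hvS hv0
  rw [← setIntegral_boxOp_mul hΩ hT hμ ω hv hvS hv0 hvt0]
  set K := closedCyl T Ω with hKdef
  set Z : ℝ × EuclideanSpace ℝ (Fin n) → ℝ := fun p =>
    dirDeriv K (1, 0) v p - dirDeriv K (0, ω) v p with hZ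
  have hZc : ContinuousOn Z K := (hv.dirDeriv hK _).continuousOn.sub (hv.dirDeriv hK _).continuousOn
  have hBc : ContinuousOn (boxOp K v) K :=
    ((hv.dirDeriv hK _).continuousOn_dirDeriv hK _).sub
      (continuousOn_finsetSum Finset.univ fun j _ =>
        (hv.dirDeriv hK _).continuousOn_dirDeriv hK _)
  have hi1 : IntegrableOn (fun p => 4 * lam ^ 2 * Z p ^ 2) (cyl T Ω) :=
    hΩ.integrableOn_cyl (continuousOn_const.mul (hZc.pow 2))
  have hi2 : IntegrableOn (fun p => 2 * lam * (2 * boxOp K v p * Z p)) (cyl T Ω) :=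
    hΩ.integrableOn_cyl (continuousOn_const.mul ((continuousOn_const.mul hBc).mul hZc))
  have hi3 : IntegrableOn (fun p => (boxOp K v p + 2 * lam * Z p) ^ 2) (cyl T Ω) :=
    hΩ.integrableOn_cyl ((hBc.add (continuousOn_const.mul hZc)).pow 2)
  -- Only the square of `boxOp K v` is dropped. The cross term is the multiplier identity times `2
  -- lam`, and `4 lam² Z²` pays for `lam² / T² · v²` through the Poincaré inequality.
  have hle : ∫ p in cyl T Ω, (4 * lam ^ 2 * Z p ^ 2 + 2 * lam * (2 * boxOp K v p * Z p)) ≤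
      ∫ p in cyl T Ω, (boxOp K v p + 2 * lam * Z p) ^ 2 := by
    refine setIntegral_mono_on (hi1.add hi2) hi3 hΩ.measurableSet_cyl fun p _ => ?_
    nlinarith [sq_nonneg (boxOp K v p)]
  rw [integral_add hi1 hi2, integral_const_mul, integral_const_mul] at hle
  refine le_trans (add_le_add_left ?_ _) hle
  calc lam ^ 2 / T ^ 2 * (∫ p in cyl T Ω, v p ^ 2)
      ≤ lam ^ 2 / T ^ 2 * (4 * T ^ 2 * ∫ p in cyl T Ω, Z p ^ 2) := by gcongr
    _ = _ := by field_simp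

end Energy

/-! ### Conjugation by the linear phase and the estimate for real functions -/

section Carleman

variable {n : ℕ} {Ω : Set (EuclideanSpace ℝ (Fin n))} {T : ℝ}

/-- The Carleman weight `exp (-2λ(t + ω·x))`. -/
noncomputable def carlemanWeight (lam : ℝ) (ω : EuclideanSpace ℝ (Fin n))
    (p : ℝ × EuclideanSpace ℝ (Fin n)) : ℝ :=
  Real.exp (-2 * lam * (p.1 + ⟪ω, p.2⟫))

theorem carlemanWeight_pos (lam : ℝ) (ω : EuclideanSpace ℝ (Fin n))
    (p : ℝ × EuclideanSpace ℝ (Fin n)) : 0 < carlemanWeight lam ω p := Real.exp_pos _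

theorem continuous_carlemanWeight (lam : ℝ) (ω : EuclideanSpace ℝ (Fin n)) :
    Continuous (carlemanWeight lam ω) := by
  unfold carlemanWeight
  fun_prop

/-- The linear phase `t + ω·x`. -/
noncomputable def phase (ω : EuclideanSpace ℝ (Fin n)) :
    ℝ × EuclideanSpace ℝ (Fin n) →L[ℝ] ℝ :=
  ContinuousLinearMap.fst ℝ ℝ (EuclideanSpace ℝ (Fin n)) +
    (innerSL ℝ ω).comp (ContinuousLinearMap.snd ℝ ℝ (EuclideanSpace ℝ (Fin n)))

theorem phase_apply (ω : EuclideanSpace ℝ (Fin n)) (p : ℝ × EuclideanSpace ℝ (Fin n)) :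
    phase ω p = p.1 + ⟪ω, p.2⟫ := by
  simp [phase]

theorem exp_phase_sq (lam : ℝ) (ω : EuclideanSpace ℝ (Fin n))
    (p : ℝ × EuclideanSpace ℝ (Fin n)) :
    Real.exp (-lam * phase ω p) ^ 2 = carlemanWeight lam ω p := by
  rw [carlemanWeight, phase_apply, pow_two, ← Real.exp_add]
  congr 1
  ring

section Conjugate

variable {X : Type*} [NormedAddCommGroup X] [NormedSpace ℝ X] {K : Set X}

theorem contDiff_exp_mul (lam : ℝ) (φ : X →L[ℝ] ℝ) {m : WithTop ℕ∞} :
    ContDiff ℝ m fun p => Real.exp (-lam * φ p) :=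
  (contDiff_const.mul φ.contDiff).exp

theorem dirDeriv_exp_mul (hK : UniqueDiffOn ℝ K) (lam : ℝ) (φ : X →L[ℝ] ℝ) {a : X → ℝ}
    (ha : DifferentiableOn ℝ a K) {p : X} (hp : p ∈ K) (ξ : X) :
    dirDeriv K ξ (fun p => Real.exp (-lam * φ p) * a p) p =
      Real.exp (-lam * φ p) * (dirDeriv K ξ a p - lam * φ ξ * a p) := by
  have h1 : HasFDerivWithinAt (fun p => Real.exp (-lam * φ p)) _ K p :=
    ((φ.hasFDerivWithinAt (s := K) (x := p)).const_mul (-lam)).exp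
  have h2 : HasFDerivWithinAt (fun p => Real.exp (-lam * φ p) * a p) _ K p :=
    h1.mul (ha p hp).hasFDerivWithinAt
  rw [h2.dirDeriv_eq hK hp]
  simp [dirDeriv]
  ring

theorem dirDeriv_dirDeriv_exp_mul (hK : UniqueDiffOn ℝ K) (lam : ℝ) (φ : X →L[ℝ] ℝ) {a : X → ℝ}
    (ha : ContDiffOn ℝ 2 a K) {p : X} (hp : p ∈ K) (ξ : X) :
    dirDeriv K ξ (dirDeriv K ξ fun p => Real.exp (-lam * φ p) * a p) p =
      Real.exp (-lam * φ p) * (dirDeriv K ξ (dirDeriv K ξ a) p -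
        2 * lam * φ ξ * dirDeriv K ξ a p + lam ^ 2 * φ ξ ^ 2 * a p) := by
  have had := ha.differentiableOn two_ne_zero
  have hda : DifferentiableOn ℝ (dirDeriv K ξ a) K := (ha.dirDeriv hK ξ).differentiableOn one_ne_zero
  have hcongr : dirDeriv K ξ (dirDeriv K ξ fun p => Real.exp (-lam * φ p) * a p) p =
      dirDeriv K ξ (fun p => Real.exp (-lam * φ p) * (dirDeriv K ξ a p - lam * φ ξ * a p)) p := by
    exact congrArg (fun L : X →L[ℝ] ℝ => L ξ) (fderivWithin_congr
      (fun z hz => dirDeriv_exp_mul hK lam φ had hz ξ) (dirDeriv_exp_mul hK lam φ had hp ξ))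
  have hb : DifferentiableOn ℝ (fun p => dirDeriv K ξ a p - lam * φ ξ * a p) K :=
    hda.sub (had.const_mul _)
  rw [hcongr, dirDeriv_exp_mul hK lam φ hb hp ξ]
  have h3 : HasFDerivWithinAt (fun p => dirDeriv K ξ a p - lam * φ ξ * a p) _ K p :=
    (hda p hp).hasFDerivWithinAt.sub ((had p hp).hasFDerivWithinAt.const_mul (lam * φ ξ))
  rw [h3.dirDeriv_eq hK hp]
  simp [dirDeriv]
  ring

end Conjugate

theorem sum_inner_single_mul_dirDeriv (K : Set (ℝ × EuclideanSpace ℝ (Fin n)))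
    (ω : EuclideanSpace ℝ (Fin n)) (a : ℝ × EuclideanSpace ℝ (Fin n) → ℝ)
    (p : ℝ × EuclideanSpace ℝ (Fin n)) :
    ∑ j, ⟪ω, EuclideanSpace.single j (1:ℝ)⟫ * dirDeriv K (0, EuclideanSpace.single j 1) a p =
      dirDeriv K (0, ω) a p := by
  rw [dirDeriv_space_eq_sum K ω]; rfl

theorem sum_inner_single_sq {ω : EuclideanSpace ℝ (Fin n)} (hω : ‖ω‖ = 1) :
    ∑ j, ⟪ω, EuclideanSpace.single j (1:ℝ)⟫ ^ 2 = 1 := by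
  simp_rw [pow_two]
  rw [sum_inner_single_mul_inner_single, real_inner_self_eq_norm_sq, hω]
  norm_num

/-- The terms of second order in `lam` cancel because `φ_t² = 1 = |∇φ|²`. The phase is also constant
along `∂_t - ω·∇`, so this derivative passes through the exponential, and the first-order correction
removes exactly the cross term produced by `□`. -/
theorem boxOp_exp_mul {K : Set (ℝ × EuclideanSpace ℝ (Fin n))} (hK : UniqueDiffOn ℝ K) (lam : ℝ)
    {ω : EuclideanSpace ℝ (Fin n)} (hω : ‖ω‖ = 1) {a : ℝ × EuclideanSpace ℝ (Fin n) → ℝ}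
    (ha : ContDiffOn ℝ 2 a K) {p : ℝ × EuclideanSpace ℝ (Fin n)} (hp : p ∈ K) :
    boxOp K (fun p => Real.exp (-lam * phase ω p) * a p) p + 2 * lam *
      (dirDeriv K (1, 0) (fun p => Real.exp (-lam * phase ω p) * a p) p -
        dirDeriv K (0, ω) (fun p => Real.exp (-lam * phase ω p) * a p) p) =
      Real.exp (-lam * phase ω p) * boxOp K a p := by
  have had := ha.differentiableOn two_ne_zero
  have hωω : ⟪ω, ω⟫ = 1 := by rw [real_inner_self_eq_norm_sq, hω]; norm_num
  have p1 : phase ω (1, 0) = 1 := by simp [phase_apply]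
  have p2 : ∀ w, phase ω (0, w) = ⟪ω, w⟫ := fun w => by simp [phase_apply]
  unfold boxOp
  rw [dirDeriv_exp_mul hK lam _ had hp, dirDeriv_exp_mul hK lam _ had hp,
    dirDeriv_dirDeriv_exp_mul hK lam _ ha hp, p1, p2 ω, hωω]
  simp_rw [dirDeriv_dirDeriv_exp_mul hK lam _ ha hp, p2]
  rw [← Finset.mul_sum, Finset.sum_add_distrib, Finset.sum_sub_distrib]
  have h1 : ∑ j, 2 * lam * ⟪ω, EuclideanSpace.single j (1:ℝ)⟫ *
      dirDeriv K (0, EuclideanSpace.single j 1) a p = 2 * lam * dirDeriv K (0, ω) a p := by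
    rw [← sum_inner_single_mul_dirDeriv, Finset.mul_sum]
    exact Finset.sum_congr rfl fun j _ => by ring
  have h2 : ∑ j, lam ^ 2 * ⟪ω, EuclideanSpace.single j (1:ℝ)⟫ ^ 2 * a p = lam ^ 2 * a p := by
    rw [← Finset.sum_mul, ← Finset.mul_sum, sum_inner_single_sq hω, mul_one]
  rw [h1, h2]
  ring

/-- Carleman estimate for real-valued functions, with signed boundary term. -/
theorem carleman_real (hΩ : IsBoundedC2Domain Ω) (hT : 0 < T)
    {μ : Measure (EuclideanSpace ℝ (Fin n))} (hμ : IsDivergenceMeasure Ω μ)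
    {ω : EuclideanSpace ℝ (Fin n)} (hω : ‖ω‖ = 1)
    {a : ℝ × EuclideanSpace ℝ (Fin n) → ℝ} (ha : ContDiffOn ℝ 2 a (closedCyl T Ω))
    (haS : ∀ t ∈ Ioo 0 T, ∀ x ∈ frontier Ω, a (t, x) = 0) (ha0 : ∀ x ∈ Ω, a (0, x) = 0)
    (hat0 : ∀ x ∈ Ω, dirDeriv (closedCyl T Ω) (1, 0) a (0, x) = 0) {lam : ℝ} (hlam : 0 ≤ lam) :
    lam ^ 2 / T ^ 2 * (∫ p in cyl T Ω, carlemanWeight lam ω p * a p ^ 2) +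
      lam / 2 * (∫ x in Ω, carlemanWeight lam ω (T, x) *
        dirDeriv (closedCyl T Ω) (1, 0) a (T, x) ^ 2) +
      2 * lam * (∫ t in Ioo 0 T, ∫ x, carlemanWeight lam ω (t, x) *
        dirDeriv (closedCyl T Ω) (0, outerNormal Ω x) a (t, x) ^ 2 * ⟪outerNormal Ω x, ω⟫ ∂μ) ≤
    (∫ p in cyl T Ω, carlemanWeight lam ω p * boxOp (closedCyl T Ω) a p ^ 2) +
      5 * lam ^ 3 * (∫ x in Ω, carlemanWeight lam ω (T, x) * a (T, x) ^ 2) +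
      4 * lam * (∫ x in Ω, carlemanWeight lam ω (T, x) *
        ∑ j, dirDeriv (closedCyl T Ω) (0, EuclideanSpace.single j 1) a (T, x) ^ 2) := by
  have hK := hΩ.uniqueDiffOn_closedCyl hT
  have had := ha.differentiableOn two_ne_zero
  set v : ℝ × EuclideanSpace ℝ (Fin n) → ℝ := fun p => Real.exp (-lam * phase ω p) * a p with hv
  have hvc : ContDiffOn ℝ 2 v (closedCyl T Ω) := (contDiff_exp_mul lam (phase ω)).contDiffOn.mul ha
  have hTm : ∀ x ∈ closure Ω, (T, x) ∈ closedCyl T Ω := fun x hx => ⟨⟨hT.le, le_rfl⟩, hx⟩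
  have hD : ∀ p ∈ closedCyl T Ω, ∀ ξ, dirDeriv (closedCyl T Ω) ξ v p =
      Real.exp (-lam * phase ω p) * (dirDeriv (closedCyl T Ω) ξ a p - lam * phase ω ξ * a p) :=
    fun p hp ξ => dirDeriv_exp_mul hK lam _ had hp ξ
  have p1 : phase ω (1, 0) = 1 := by simp [phase_apply]
  have p2 : ∀ w, phase ω (0, w) = ⟪ω, w⟫ := fun w => by simp [phase_apply]
  have main := carleman_conjugated hΩ hT hμ ω hvc
    (fun t ht x hx => by simp only [hv, haS t ht x hx, mul_zero])
    (fun x hx => by simp only [hv, ha0 x hx, mul_zero])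
    (fun x hx => by
      rw [hD _ ⟨⟨le_rfl, hT.le⟩, subset_closure hx⟩, hat0 x hx, ha0 x hx]; simp) lam
  have e1 : ∫ p in cyl T Ω, v p ^ 2 = ∫ p in cyl T Ω, carlemanWeight lam ω p * a p ^ 2 := by
    refine setIntegral_congr_fun hΩ.measurableSet_cyl fun p _ => ?_
    simp only [hv]
    rw [mul_pow, exp_phase_sq]
  have e2 : ∫ p in cyl T Ω, (boxOp (closedCyl T Ω) v p + 2 * lam *
      (dirDeriv (closedCyl T Ω) (1, 0) v p - dirDeriv (closedCyl T Ω) (0, ω) v p)) ^ 2 =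
      ∫ p in cyl T Ω, carlemanWeight lam ω p * boxOp (closedCyl T Ω) a p ^ 2 := by
    refine setIntegral_congr_fun hΩ.measurableSet_cyl fun p hp => ?_
    simp only [hv]
    rw [boxOp_exp_mul hK lam hω ha (cyl_subset_closedCyl hp), mul_pow, exp_phase_sq]
  have e3 : ∫ t in Ioo 0 T, ∫ x, dirDeriv (closedCyl T Ω) (0, outerNormal Ω x) v (t, x) ^ 2 *
        ⟪outerNormal Ω x, ω⟫ ∂μ = ∫ t in Ioo 0 T, ∫ x, carlemanWeight lam ω (t, x) *
        dirDeriv (closedCyl T Ω) (0, outerNormal Ω x) a (t, x) ^ 2 *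
        ⟪outerNormal Ω x, ω⟫ ∂μ := by
    -- On the lateral boundary `a = 0`, so differentiating the exponential contributes nothing and
    -- the normal derivative merely acquires the weight.
    refine setIntegral_congr_fun measurableSet_Ioo fun t ht => ?_
    refine integral_congr_ae ?_
    have hae : ∀ᵐ x ∂μ, x ∈ frontier Ω := mem_ae_iff.2 hμ.measure_compl
    filter_upwards [hae] with x hx
    rw [hD _ ⟨Ioo_subset_Icc_self ht, frontier_subset_closure hx⟩, haS t ht x hx, mul_zero,
      sub_zero, mul_pow, exp_phase_sq]
  rw [e1, e2, e3] at main
  set K := closedCyl T Ω with hKdef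
  have hsl : ∀ g : ℝ × EuclideanSpace ℝ (Fin n) → ℝ, ContinuousOn g K →
      ContinuousOn (fun x => g (T, x)) (closure Ω) := fun g hg =>
    hg.comp (by fun_prop) fun x hx => hTm x hx
  have hWc : ContinuousOn (carlemanWeight lam ω) K := (continuous_carlemanWeight lam ω).continuousOn
  have hDc : ∀ ξ, ContinuousOn (dirDeriv K ξ a) K := fun ξ => (ha.dirDeriv hK ξ).continuousOn
  have hDvc : ∀ ξ, ContinuousOn (dirDeriv K ξ v) K := fun ξ => (hvc.dirDeriv hK ξ).continuousOn
  have i1 : IntegrableOn (fun x => carlemanWeight lam ω (T, x) *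
      dirDeriv K (1, 0) a (T, x) ^ 2) Ω :=
    hΩ.integrableOn_domain (hsl _ (hWc.mul ((hDc _).pow 2)))
  have i2 : IntegrableOn (fun x => carlemanWeight lam ω (T, x) * a (T, x) ^ 2) Ω :=
    hΩ.integrableOn_domain (hsl _ (hWc.mul (ha.continuousOn.pow 2)))
  have i3 : IntegrableOn (fun x => carlemanWeight lam ω (T, x) *
      ∑ j, dirDeriv K (0, EuclideanSpace.single j 1) a (T, x) ^ 2) Ω :=
    hΩ.integrableOn_domain (hsl _ (hWc.mul
      (continuousOn_finsetSum Finset.univ fun j _ => (hDc _).pow 2)))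
  have i4 : IntegrableOn (fun x => dirDeriv K (1, 0) v (T, x) ^ 2 +
        ∑ j, dirDeriv K (0, EuclideanSpace.single j 1) v (T, x) ^ 2 -
        2 * (dirDeriv K (1, 0) v (T, x) * dirDeriv K (0, ω) v (T, x))) Ω :=
    hΩ.integrableOn_domain (hsl (fun p => dirDeriv K (1, 0) v p ^ 2 +
        ∑ j, dirDeriv K (0, EuclideanSpace.single j 1) v p ^ 2 -
        2 * (dirDeriv K (1, 0) v p * dirDeriv K (0, ω) v p))
      ((((hDvc _).pow 2).add (continuousOn_finsetSum Finset.univ fun j _ => (hDvc _).pow 2)).sub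
        (continuousOn_const.mul ((hDvc _).mul (hDvc _)))))
  -- Lower bound for the form at `t = T`. From `(v_t - 2 v_ω)² ≥ 0` and `v_ω² ≤ |∇v|²` it is at
  -- least `v_t² / 2 - |∇v|²`. Inserting `v = y a` in both terms costs `lam² y² a² / 2` and `2 lam²
  -- y² a²`, which add up to the coefficient `5 / 2`.
  have hle : 1 / 4 * (∫ x in Ω, carlemanWeight lam ω (T, x) * dirDeriv K (1, 0) a (T, x) ^ 2) -
      5 / 2 * lam ^ 2 * (∫ x in Ω, carlemanWeight lam ω (T, x) * a (T, x) ^ 2) -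
      2 * (∫ x in Ω, carlemanWeight lam ω (T, x) *
        ∑ j, dirDeriv K (0, EuclideanSpace.single j 1) a (T, x) ^ 2) ≤
      ∫ x in Ω, (dirDeriv K (1, 0) v (T, x) ^ 2 +
        ∑ j, dirDeriv K (0, EuclideanSpace.single j 1) v (T, x) ^ 2 -
        2 * (dirDeriv K (1, 0) v (T, x) * dirDeriv K (0, ω) v (T, x))) := by
    have i12 : IntegrableOn (fun x => 1 / 4 * (carlemanWeight lam ω (T, x) *
        dirDeriv K (1, 0) a (T, x) ^ 2) - 5 / 2 * lam ^ 2 *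
        (carlemanWeight lam ω (T, x) * a (T, x) ^ 2)) Ω :=
      (i1.const_mul _).sub (i2.const_mul _)
    rw [← integral_const_mul, ← integral_const_mul, ← integral_const_mul,
      ← integral_sub (i1.const_mul _) (i2.const_mul _), ← integral_sub i12 (i3.const_mul _)]
    refine setIntegral_mono_on (i12.sub (i3.const_mul _)) i4
      hΩ.isOpen.measurableSet fun x hx => ?_
    have hxT := hTm x (subset_closure hx)
    set y := Real.exp (-lam * phase ω (T, x)) with hy
    have hyW : carlemanWeight lam ω (T, x) = y ^ 2 := (exp_phase_sq lam ω _).symm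
    have hcs : dirDeriv K (0, ω) v (T, x) ^ 2 ≤
        ∑ j, dirDeriv K (0, EuclideanSpace.single j 1) v (T, x) ^ 2 := by
      rw [← sum_inner_single_mul_dirDeriv K ω v]
      refine (Finset.sum_mul_sq_le_sq_mul_sq _ _ _).trans ?_
      rw [sum_inner_single_sq hω, one_mul]
    have hgrad : ∑ j, dirDeriv K (0, EuclideanSpace.single j 1) v (T, x) ^ 2 ≤
        2 * (y ^ 2 * ∑ j, dirDeriv K (0, EuclideanSpace.single j 1) a (T, x) ^ 2) +
          2 * lam ^ 2 * (y ^ 2 * a (T, x) ^ 2) := by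
      have hsplit : 2 * (y ^ 2 * ∑ j, dirDeriv K (0, EuclideanSpace.single j 1) a (T, x) ^ 2) +
          2 * lam ^ 2 * (y ^ 2 * a (T, x) ^ 2) =
          ∑ j, (2 * (y ^ 2 * dirDeriv K (0, EuclideanSpace.single j 1) a (T, x) ^ 2) +
            2 * lam ^ 2 * (y ^ 2 * a (T, x) ^ 2) *
              ⟪ω, EuclideanSpace.single j (1:ℝ)⟫ ^ 2) := by
        rw [Finset.sum_add_distrib, ← Finset.mul_sum, ← Finset.mul_sum, ← Finset.mul_sum,
          sum_inner_single_sq hω, mul_one]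
      rw [hsplit]
      refine Finset.sum_le_sum fun j _ => ?_
      rw [hD _ hxT, p2]
      nlinarith [sq_nonneg (y * (dirDeriv K (0, EuclideanSpace.single j 1) a (T, x) +
        lam * ⟪ω, EuclideanSpace.single j (1:ℝ)⟫ * a (T, x)))]
    have hvt := hD _ hxT (1, 0)
    rw [p1] at hvt
    have hyt : 1 / 2 * (y ^ 2 * dirDeriv K (1, 0) a (T, x) ^ 2) - lam ^ 2 * (y ^ 2 * a (T, x) ^ 2) ≤
        dirDeriv K (1, 0) v (T, x) ^ 2 := by
      rw [hvt]
      nlinarith [sq_nonneg (y * (dirDeriv K (1, 0) a (T, x) - 2 * lam * a (T, x)))]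
    rw [hyW]
    nlinarith [sq_nonneg (dirDeriv K (1, 0) v (T, x) - 2 * dirDeriv K (0, ω) v (T, x))]
  have h2 := mul_le_mul_of_nonneg_left hle (by positivity : 0 ≤ 2 * lam)
  nlinarith [main, h2]

end Carleman

/-! ### Complex-valued functions via real and imaginary parts -/

section ComplexCarleman

variable {n : ℕ} {Ω : Set (EuclideanSpace ℝ (Fin n))} {T : ℝ}

theorem dirDeriv_clm_comp {X F G : Type*} [NormedAddCommGroup X] [NormedSpace ℝ X]
    [NormedAddCommGroup F] [NormedSpace ℝ F] [NormedAddCommGroup G] [NormedSpace ℝ G] {K : Set X}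
    (hK : UniqueDiffOn ℝ K) (L : F →L[ℝ] G) {u : X → F} (hu : DifferentiableOn ℝ u K) {p : X}
    (hp : p ∈ K) (ξ : X) : dirDeriv K ξ (fun p => L (u p)) p = L (dirDeriv K ξ u p) := by
  have h : HasFDerivWithinAt (fun p => L (u p)) _ K p :=
    L.hasFDerivAt.comp_hasFDerivWithinAt p (hu p hp).hasFDerivWithinAt
  rw [h.dirDeriv_eq hK hp]
  rfl

theorem boxOp_clm_comp {F G : Type*} [NormedAddCommGroup F] [NormedSpace ℝ F]
    [NormedAddCommGroup G] [NormedSpace ℝ G] {K : Set (ℝ × EuclideanSpace ℝ (Fin n))}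
    (hK : UniqueDiffOn ℝ K) (L : F →L[ℝ] G) {u : ℝ × EuclideanSpace ℝ (Fin n) → F}
    (hu : ContDiffOn ℝ 2 u K) {p : ℝ × EuclideanSpace ℝ (Fin n)} (hp : p ∈ K) :
    boxOp K (fun p => L (u p)) p = L (boxOp K u p) := by
  have h : ∀ ξ, dirDeriv K ξ (dirDeriv K ξ fun p => L (u p)) p =
      L (dirDeriv K ξ (dirDeriv K ξ u) p) := by
    intro ξ
    rw [← dirDeriv_clm_comp hK L ((hu.dirDeriv hK ξ).differentiableOn one_ne_zero) hp]
    exact congrArg (fun M : ℝ × EuclideanSpace ℝ (Fin n) →L[ℝ] G => M ξ) (fderivWithin_congr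
      (fun z hz => dirDeriv_clm_comp hK L (hu.differentiableOn two_ne_zero) hz ξ)
      (dirDeriv_clm_comp hK L (hu.differentiableOn two_ne_zero) hp ξ))
  unfold boxOp
  rw [h, map_sub, map_sum]
  simp_rw [h]

theorem norm_sq_eq_re_im (z : ℂ) :
    ‖z‖ ^ 2 = Complex.reCLM z ^ 2 + Complex.imCLM z ^ 2 := by
  rw [Complex.sq_norm, Complex.normSq_apply]
  simp [pow_two]

theorem integrable_boundary (hΩ : IsBoundedC2Domain Ω) {μ : Measure (EuclideanSpace ℝ (Fin n))}
    [IsFiniteMeasure μ] (hμ : μ (frontier Ω)ᶜ = 0) {h : ℝ × EuclideanSpace ℝ (Fin n) → ℝ}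
    (hc : ContinuousOn h (Icc 0 T ×ˢ frontier Ω)) :
    Integrable h ((volume.restrict (Ioo 0 T)).prod μ) := by
  have hae : ∀ᵐ x ∂μ, x ∈ frontier Ω := mem_ae_iff.2 hμ
  have h1 : IntegrableOn h (Icc 0 T ×ˢ frontier Ω) (volume.prod μ) :=
    hc.integrableOn_compact' (isCompact_Icc.prod hΩ.isCompact_frontier)
      (isCompact_Icc.prod hΩ.isCompact_frontier).measurableSet
  have h2 := h1.mono_set (prod_mono_left Ioo_subset_Icc_self :
    Ioo 0 T ×ˢ frontier Ω ⊆ Icc 0 T ×ˢ frontier Ω)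
  rwa [IntegrableOn, ← Measure.prod_restrict, Measure.restrict_eq_self_of_ae_mem hae] at h2

theorem continuousOn_normalComponent (hΩ : IsBoundedC2Domain Ω) (hT : 0 < T) {F : Type*}
    [NormedAddCommGroup F] [NormedSpace ℝ F] {u : ℝ × EuclideanSpace ℝ (Fin n) → F}
    (hu : ContDiffOn ℝ 2 u (closedCyl T Ω)) :
    ContinuousOn (fun p => dirDeriv (closedCyl T Ω) (0, outerNormal Ω p.2) u p)
      (Icc 0 T ×ˢ frontier Ω) := by
  have hsub : Icc 0 T ×ˢ frontier Ω ⊆ closedCyl T Ω := prod_mono_right frontier_subset_closure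
  refine ((hu.continuousOn_fderivWithin (hΩ.uniqueDiffOn_closedCyl hT) one_le_two).mono
    hsub).clm_apply ?_
  exact continuousOn_const.prodMk
    (hΩ.continuousOn_outerNormal.comp continuousOn_snd fun p hp => hp.2)

theorem continuousOn_outerNormal_snd (hΩ : IsBoundedC2Domain Ω) (ω : EuclideanSpace ℝ (Fin n)) :
    ContinuousOn (fun p : ℝ × EuclideanSpace ℝ (Fin n) => ⟪outerNormal Ω p.2, ω⟫)
      (Icc 0 T ×ˢ frontier Ω) :=
  (hΩ.continuousOn_outerNormal.comp continuousOn_snd fun _ hp => hp.2).inner continuousOn_const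

theorem setIntegral_mul_norm_sq {α : Type*} [MeasurableSpace α] {μ : Measure α} {W : α → ℝ}
    {f : α → ℂ} (h1 : Integrable (fun p => W p * Complex.reCLM (f p) ^ 2) μ)
    (h2 : Integrable (fun p => W p * Complex.imCLM (f p) ^ 2) μ) :
    ∫ p, W p * ‖f p‖ ^ 2 ∂μ =
      (∫ p, W p * Complex.reCLM (f p) ^ 2 ∂μ) + ∫ p, W p * Complex.imCLM (f p) ^ 2 ∂μ := by
  rw [← integral_add h1 h2]
  congr 1
  ext p
  rw [norm_sq_eq_re_im, mul_add]

/-- Carleman estimate for complex-valued functions, with signed boundary term. -/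
theorem carleman_complex (hΩ : IsBoundedC2Domain Ω) (hT : 0 < T)
    {μ : Measure (EuclideanSpace ℝ (Fin n))} (hμ : IsDivergenceMeasure Ω μ)
    {ω : EuclideanSpace ℝ (Fin n)} (hω : ‖ω‖ = 1)
    {u : ℝ × EuclideanSpace ℝ (Fin n) → ℂ} (hu : ContDiffOn ℝ 2 u (closedCyl T Ω))
    (huS : ∀ t ∈ Ioo 0 T, ∀ x ∈ frontier Ω, u (t, x) = 0) (hu0 : ∀ x ∈ Ω, u (0, x) = 0)
    (hut0 : ∀ x ∈ Ω, dirDeriv (closedCyl T Ω) (1, 0) u (0, x) = 0) {lam : ℝ} (hlam : 0 ≤ lam) :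
    lam ^ 2 / T ^ 2 * (∫ p in cyl T Ω, carlemanWeight lam ω p * ‖u p‖ ^ 2) +
      lam / 2 * (∫ x in Ω, carlemanWeight lam ω (T, x) *
        ‖dirDeriv (closedCyl T Ω) (1, 0) u (T, x)‖ ^ 2) +
      2 * lam * (∫ t in Ioo 0 T, ∫ x, carlemanWeight lam ω (t, x) *
        ‖dirDeriv (closedCyl T Ω) (0, outerNormal Ω x) u (t, x)‖ ^ 2 *
          ⟪outerNormal Ω x, ω⟫ ∂μ) ≤
    (∫ p in cyl T Ω, carlemanWeight lam ω p * ‖boxOp (closedCyl T Ω) u p‖ ^ 2) +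
      5 * lam ^ 3 * (∫ x in Ω, carlemanWeight lam ω (T, x) * ‖u (T, x)‖ ^ 2) +
      4 * lam * (∫ x in Ω, carlemanWeight lam ω (T, x) *
        ∑ j, ‖dirDeriv (closedCyl T Ω) (0, EuclideanSpace.single j 1) u (T, x)‖ ^ 2) := by
  have hK := hΩ.uniqueDiffOn_closedCyl hT
  have hfin := hμ.isFiniteMeasure
  have hud := hu.differentiableOn two_ne_zero
  have hTm : ∀ x ∈ closure Ω, (T, x) ∈ closedCyl T Ω := fun x hx => ⟨⟨hT.le, le_rfl⟩, hx⟩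
  -- Every real functional `L` of `u` satisfies the real hypotheses, and all operators commute with
  -- `L`. The boundary term is rewritten as one integral over a product measure, whose integrability
  -- allows the real and imaginary contributions to be added.
  have hreal : ∀ L : ℂ →L[ℝ] ℝ,
      lam ^ 2 / T ^ 2 * (∫ p in cyl T Ω, carlemanWeight lam ω p * L (u p) ^ 2) +
      lam / 2 * (∫ x in Ω, carlemanWeight lam ω (T, x) *
        L (dirDeriv (closedCyl T Ω) (1, 0) u (T, x)) ^ 2) +
      2 * lam * (∫ z, carlemanWeight lam ω z *
        L (dirDeriv (closedCyl T Ω) (0, outerNormal Ω z.2) u z) ^ 2 *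
          ⟪outerNormal Ω z.2, ω⟫ ∂((volume.restrict (Ioo 0 T)).prod μ)) ≤
      (∫ p in cyl T Ω, carlemanWeight lam ω p * L (boxOp (closedCyl T Ω) u p) ^ 2) +
      5 * lam ^ 3 * (∫ x in Ω, carlemanWeight lam ω (T, x) * L (u (T, x)) ^ 2) +
      4 * lam * (∫ x in Ω, carlemanWeight lam ω (T, x) *
        ∑ j, L (dirDeriv (closedCyl T Ω) (0, EuclideanSpace.single j 1) u (T, x)) ^ 2) := by
    intro L
    have hD : ∀ p ∈ closedCyl T Ω, ∀ ξ, dirDeriv (closedCyl T Ω) ξ (fun p => L (u p)) p =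
        L (dirDeriv (closedCyl T Ω) ξ u p) := fun p hp ξ => dirDeriv_clm_comp hK L hud hp ξ
    have main := carleman_real hΩ hT hμ hω (a := fun p => L (u p))
      (L.contDiff.comp_contDiffOn hu) (fun t ht x hx => by simp only [huS t ht x hx, map_zero])
      (fun x hx => by simp only [hu0 x hx, map_zero])
      (fun x hx => by rw [hD _ ⟨⟨le_rfl, hT.le⟩, subset_closure hx⟩, hut0 x hx, map_zero]) hlam
    have e1 : ∫ x in Ω, carlemanWeight lam ω (T, x) *
        dirDeriv (closedCyl T Ω) (1, 0) (fun p => L (u p)) (T, x) ^ 2 =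
        ∫ x in Ω, carlemanWeight lam ω (T, x) *
          L (dirDeriv (closedCyl T Ω) (1, 0) u (T, x)) ^ 2 :=
      setIntegral_congr_fun hΩ.isOpen.measurableSet fun x hx => by
        simp only [hD _ (hTm x (subset_closure hx))]
    have e2 : ∫ x in Ω, carlemanWeight lam ω (T, x) * ∑ j,
        dirDeriv (closedCyl T Ω) (0, EuclideanSpace.single j 1) (fun p => L (u p)) (T, x) ^ 2 =
        ∫ x in Ω, carlemanWeight lam ω (T, x) * ∑ j,
          L (dirDeriv (closedCyl T Ω) (0, EuclideanSpace.single j 1) u (T, x)) ^ 2 :=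
      setIntegral_congr_fun hΩ.isOpen.measurableSet fun x hx => by
        simp only [hD _ (hTm x (subset_closure hx))]
    have e3 : ∫ p in cyl T Ω, carlemanWeight lam ω p *
        boxOp (closedCyl T Ω) (fun p => L (u p)) p ^ 2 =
        ∫ p in cyl T Ω, carlemanWeight lam ω p * L (boxOp (closedCyl T Ω) u p) ^ 2 :=
      setIntegral_congr_fun hΩ.measurableSet_cyl fun p hp => by
        simp only [boxOp_clm_comp hK L hu (cyl_subset_closedCyl hp)]
    have e4 : ∫ t in Ioo 0 T, ∫ x, carlemanWeight lam ω (t, x) *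
        dirDeriv (closedCyl T Ω) (0, outerNormal Ω x) (fun p => L (u p)) (t, x) ^ 2 *
          ⟪outerNormal Ω x, ω⟫ ∂μ = ∫ z, carlemanWeight lam ω z *
        L (dirDeriv (closedCyl T Ω) (0, outerNormal Ω z.2) u z) ^ 2 *
          ⟪outerNormal Ω z.2, ω⟫ ∂((volume.restrict (Ioo 0 T)).prod μ) := by
      rw [integral_prod]
      · refine setIntegral_congr_fun measurableSet_Ioo fun t ht => ?_
        refine integral_congr_ae ?_
        have hae : ∀ᵐ x ∂μ, x ∈ frontier Ω := mem_ae_iff.2 hμ.measure_compl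
        filter_upwards [hae] with x hx
        rw [hD _ ⟨Ioo_subset_Icc_self ht, frontier_subset_closure hx⟩]
      · refine integrable_boundary hΩ hμ.measure_compl ?_
        exact (((continuous_carlemanWeight lam ω).continuousOn).mul
          ((L.continuous.comp_continuousOn (continuousOn_normalComponent hΩ hT hu)).pow 2)).mul
            (continuousOn_outerNormal_snd hΩ ω)
    rwa [e1, e2, e3, e4] at main
  set K := closedCyl T Ω with hKdef
  have hsl : ∀ g : ℝ × EuclideanSpace ℝ (Fin n) → ℝ, ContinuousOn g K →
      IntegrableOn (fun x => g (T, x)) Ω := fun g hg =>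
    hΩ.integrableOn_domain (hg.comp (by fun_prop) fun x hx => hTm x hx)
  have hWc : ContinuousOn (carlemanWeight lam ω) K := (continuous_carlemanWeight lam ω).continuousOn
  have hDc : ∀ ξ, ContinuousOn (dirDeriv K ξ u) K := fun ξ => (hu.dirDeriv hK ξ).continuousOn
  have hBc : ContinuousOn (boxOp K u) K :=
    ((hu.dirDeriv hK _).continuousOn_dirDeriv hK _).sub
      (continuousOn_finsetSum Finset.univ fun j _ =>
        (hu.dirDeriv hK _).continuousOn_dirDeriv hK _)
  have hL : ∀ (L : ℂ →L[ℝ] ℝ) (f : ℝ × EuclideanSpace ℝ (Fin n) → ℂ), ContinuousOn f K →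
      ContinuousOn (fun p => carlemanWeight lam ω p * L (f p) ^ 2) K := fun L f hf =>
    hWc.mul ((L.continuous.comp_continuousOn hf).pow 2)
  have q1 := setIntegral_mul_norm_sq (hΩ.integrableOn_cyl (hL Complex.reCLM u hu.continuousOn))
    (hΩ.integrableOn_cyl (hL Complex.imCLM u hu.continuousOn))
  have q2 := setIntegral_mul_norm_sq (W := fun x => carlemanWeight lam ω (T, x))
    (f := fun x => dirDeriv K (1, 0) u (T, x))
    (hsl _ (hL Complex.reCLM _ (hDc (1, 0)))) (hsl _ (hL Complex.imCLM _ (hDc (1, 0))))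
  have q3 := setIntegral_mul_norm_sq (hΩ.integrableOn_cyl (hL Complex.reCLM _ hBc))
    (hΩ.integrableOn_cyl (hL Complex.imCLM _ hBc))
  have q4 := setIntegral_mul_norm_sq (W := fun x => carlemanWeight lam ω (T, x))
    (f := fun x => u (T, x))
    (hsl _ (hL Complex.reCLM _ hu.continuousOn)) (hsl _ (hL Complex.imCLM _ hu.continuousOn))
  have q5 : ∫ x in Ω, carlemanWeight lam ω (T, x) *
        ∑ j, ‖dirDeriv K (0, EuclideanSpace.single j 1) u (T, x)‖ ^ 2 =
      (∫ x in Ω, carlemanWeight lam ω (T, x) *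
        ∑ j, Complex.reCLM (dirDeriv K (0, EuclideanSpace.single j 1) u (T, x)) ^ 2) +
      ∫ x in Ω, carlemanWeight lam ω (T, x) *
        ∑ j, Complex.imCLM (dirDeriv K (0, EuclideanSpace.single j 1) u (T, x)) ^ 2 := by
    have hi : ∀ L : ℂ →L[ℝ] ℝ, IntegrableOn (fun x => carlemanWeight lam ω (T, x) *
        ∑ j, L (dirDeriv K (0, EuclideanSpace.single j 1) u (T, x)) ^ 2) Ω := fun L =>
      hsl (fun p => carlemanWeight lam ω p *
        ∑ j, L (dirDeriv K (0, EuclideanSpace.single j 1) u p) ^ 2)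
        (hWc.mul (continuousOn_finsetSum Finset.univ fun j _ =>
          (L.continuous.comp_continuousOn (hDc _)).pow 2))
    rw [← integral_add (hi _) (hi _)]
    congr 1
    ext x
    rw [← mul_add, ← Finset.sum_add_distrib]
    simp_rw [norm_sq_eq_re_im]
  have q6 : ∫ t in Ioo 0 T, ∫ x, carlemanWeight lam ω (t, x) *
        ‖dirDeriv K (0, outerNormal Ω x) u (t, x)‖ ^ 2 * ⟪outerNormal Ω x, ω⟫ ∂μ =
      (∫ z, carlemanWeight lam ω z * Complex.reCLM (dirDeriv K (0, outerNormal Ω z.2) u z) ^ 2 *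
          ⟪outerNormal Ω z.2, ω⟫ ∂((volume.restrict (Ioo 0 T)).prod μ)) +
      ∫ z, carlemanWeight lam ω z * Complex.imCLM (dirDeriv K (0, outerNormal Ω z.2) u z) ^ 2 *
          ⟪outerNormal Ω z.2, ω⟫ ∂((volume.restrict (Ioo 0 T)).prod μ) := by
    have hi : ∀ L : ℂ →L[ℝ] ℝ, Integrable (fun z => carlemanWeight lam ω z *
        L (dirDeriv K (0, outerNormal Ω z.2) u z) ^ 2 * ⟪outerNormal Ω z.2, ω⟫)
        ((volume.restrict (Ioo 0 T)).prod μ) := fun L =>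
      integrable_boundary hΩ hμ.measure_compl
        ((((continuous_carlemanWeight lam ω).continuousOn).mul
          ((L.continuous.comp_continuousOn (continuousOn_normalComponent hΩ hT hu)).pow 2)).mul
            (continuousOn_outerNormal_snd hΩ ω))
    rw [← integral_add (hi _) (hi _), integral_prod]
    · congr 1
      ext t
      congr 1
      ext x
      rw [norm_sq_eq_re_im]
      ring
    · exact (hi _).add (hi _)
  have hre := hreal Complex.reCLM
  have him := hreal Complex.imCLM
  rw [q1, q2, q3, q4, q5, q6]
  linarith

end ComplexCarleman

/-! ### Splitting the boundary flux into faces and changing the boundary measure -/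

section Faces

variable {n : ℕ} {Ω : Set (EuclideanSpace ℝ (Fin n))} {T : ℝ}

theorem IsBoundedC2Domain.isClosed_facePlus (hΩ : IsBoundedC2Domain Ω)
    (ω : EuclideanSpace ℝ (Fin n)) : IsClosed (facePlus Ω ω) := by
  have hc : ContinuousOn (fun x => ⟪outerNormal Ω x, ω⟫) (frontier Ω) :=
    hΩ.continuousOn_outerNormal.inner continuousOn_const
  exact hc.preimage_isClosed_of_isClosed isClosed_frontier (isClosed_Ici (a := 0))

theorem IsBoundedC2Domain.isClosed_faceMinus (hΩ : IsBoundedC2Domain Ω)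
    (ω : EuclideanSpace ℝ (Fin n)) : IsClosed (faceMinus Ω ω) := by
  have hc : ContinuousOn (fun x => ⟪outerNormal Ω x, ω⟫) (frontier Ω) :=
    hΩ.continuousOn_outerNormal.inner continuousOn_const
  exact hc.preimage_isClosed_of_isClosed isClosed_frontier (isClosed_Iic (a := 0))

theorem faceMinus_neg (Ω : Set (EuclideanSpace ℝ (Fin n))) (ω : EuclideanSpace ℝ (Fin n)) :
    faceMinus Ω (-ω) = facePlus Ω ω := by
  ext x
  simp [facePlus, faceMinus]

theorem facePlus_neg (Ω : Set (EuclideanSpace ℝ (Fin n))) (ω : EuclideanSpace ℝ (Fin n)) :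
    facePlus Ω (-ω) = faceMinus Ω ω := by
  ext x
  simp [facePlus, faceMinus]

/-- The signed boundary integral is the difference of the integrals over the two faces. -/
theorem integral_boundary_eq_sub_faces (hΩ : IsBoundedC2Domain Ω)
    {μ : Measure (EuclideanSpace ℝ (Fin n))} [IsFiniteMeasure μ] (hμ : μ (frontier Ω)ᶜ = 0)
    (ω : EuclideanSpace ℝ (Fin n)) {g : ℝ × EuclideanSpace ℝ (Fin n) → ℝ}
    (hg : ContinuousOn g (Icc 0 T ×ˢ frontier Ω)) :
    ∫ t in Ioo 0 T, ∫ x, g (t, x) * ⟪outerNormal Ω x, ω⟫ ∂μ =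
      (∫ t in Ioo 0 T, ∫ x in facePlus Ω ω, g (t, x) * |⟪ω, outerNormal Ω x⟫| ∂μ) -
      ∫ t in Ioo 0 T, ∫ x in faceMinus Ω ω, g (t, x) * |⟪ω, outerNormal Ω x⟫| ∂μ := by
  have hint : Integrable (fun z : ℝ × EuclideanSpace ℝ (Fin n) =>
      g z * |⟪ω, outerNormal Ω z.2⟫|) ((volume.restrict (Ioo 0 T)).prod μ) := by
    refine integrable_boundary hΩ hμ (hg.mul ?_)
    simp_rw [real_inner_comm _ ω]
    exact (continuousOn_outerNormal_snd hΩ ω).abs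
  have hind : ∀ F : Set (EuclideanSpace ℝ (Fin n)), MeasurableSet F →
      Integrable (fun z : ℝ × EuclideanSpace ℝ (Fin n) =>
        F.indicator (fun x => g (z.1, x) * |⟪ω, outerNormal Ω x⟫|) z.2)
        ((volume.restrict (Ioo 0 T)).prod μ) := by
    intro F hF
    refine (hint.indicator (measurable_snd hF)).congr (Eventually.of_forall fun z => ?_)
    change indicator _ _ z = indicator F _ z.2
    by_cases hz : z.2 ∈ F
    · rw [indicator_of_mem (by exact hz), indicator_of_mem hz]
    · rw [indicator_of_notMem (by exact hz), indicator_of_notMem hz]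
  have hP := hind _ (hΩ.isClosed_facePlus ω).measurableSet
  have hM := hind _ (hΩ.isClosed_faceMinus ω).measurableSet
  simp_rw [← integral_indicator (hΩ.isClosed_facePlus ω).measurableSet,
    ← integral_indicator (hΩ.isClosed_faceMinus ω).measurableSet]
  have hPM : Integrable (fun z : ℝ × EuclideanSpace ℝ (Fin n) =>
      (facePlus Ω ω).indicator (fun x => g (z.1, x) * |⟪ω, outerNormal Ω x⟫|) z.2 -
      (faceMinus Ω ω).indicator (fun x => g (z.1, x) * |⟪ω, outerNormal Ω x⟫|) z.2)
      ((volume.restrict (Ioo 0 T)).prod μ) := hP.sub hM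
  rw [← integral_prod _ hP, ← integral_prod _ hM, ← integral_sub hP hM, integral_prod _ hPM]
  congr 1
  ext t
  refine integral_congr_ae ?_
  have hae : ∀ᵐ x ∂μ, x ∈ frontier Ω := mem_ae_iff.2 hμ
  filter_upwards [hae] with x hx
  rw [real_inner_comm ω]
  -- The two faces overlap where `ν·ω = 0`, but the factor `|ν·ω|` makes the overlap contribute zero
  -- to both integrals.
  rcases lt_trichotomy ⟪ω, outerNormal Ω x⟫ 0 with h | h | h
  · have h1 : x ∈ faceMinus Ω ω := ⟨hx, by rw [real_inner_comm]; exact h.le⟩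
    have h2 : x ∉ facePlus Ω ω := fun hc => by
      have := hc.2; rw [real_inner_comm] at this; linarith
    rw [indicator_of_mem h1, indicator_of_notMem h2, abs_of_neg h]
    ring
  · simp [indicator, h]
  · have h1 : x ∈ facePlus Ω ω := ⟨hx, by rw [real_inner_comm]; exact h.le⟩
    have h2 : x ∉ faceMinus Ω ω := fun hc => by
      have := hc.2; rw [real_inner_comm] at this; linarith
    rw [indicator_of_mem h1, indicator_of_notMem h2, abs_of_pos h]
    ring

/-- Comparison of integrals over part of the boundary for comparable measures. -/
theorem integral_face_le (hΩ : IsBoundedC2Domain Ω)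
    {μ ν : Measure (EuclideanSpace ℝ (Fin n))} [IsFiniteMeasure ν] {k : ℝ≥0}
    (hμν : μ ≤ k • ν) {F : Set (EuclideanSpace ℝ (Fin n))} (hF : IsClosed F)
    (hFs : F ⊆ frontier Ω) {g : ℝ × EuclideanSpace ℝ (Fin n) → ℝ}
    (hg : ContinuousOn g (Icc 0 T ×ˢ frontier Ω)) (hg0 : ∀ p, 0 ≤ g p) :
    ∫ t in Ioo 0 T, ∫ x in F, g (t, x) ∂μ ≤ k * ∫ t in Ioo 0 T, ∫ x in F, g (t, x) ∂ν := by
  have hFm := hF.measurableSet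
  have hν : (ν.restrict F) (frontier Ω)ᶜ = 0 := by
    rw [Measure.restrict_apply isClosed_frontier.measurableSet.compl]
    rw [(disjoint_compl_left.mono_right hFs).inter_eq]
    exact measure_empty
  have hint := integrable_boundary hΩ hν hg
  rw [← integral_const_mul]
  -- With a nonnegative integrand only the larger side must be shown integrable.
  refine integral_mono_of_nonneg (Eventually.of_forall fun t => integral_nonneg fun x => hg0 _)
    (hint.integral_prod_left.const_mul _) ?_
  filter_upwards [ae_restrict_mem measurableSet_Ioo] with t ht
  have hle : μ.restrict F ≤ k • ν.restrict F := by
    rw [← Measure.restrict_smul]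
    exact Measure.restrict_mono le_rfl hμν
  have hsl : Integrable (fun x => g (t, x)) (ν.restrict F) :=
    integrable_of_continuousOn_of_measure_compl hΩ.isCompact_frontier hν
      (hg.comp (by fun_prop) fun x hx => ⟨Ioo_subset_Icc_self ht, hx⟩)
  refine (integral_mono_measure hle (Eventually.of_forall fun x => hg0 _)
    (hsl.smul_measure_nnreal)).trans_eq ?_
  rw [integral_smul_nnreal_measure]
  rfl

end Faces

/-! ### Absorbing the potential and fixing the constants -/

section ForwardEstimate

variable {n : ℕ} {Ω : Set (EuclideanSpace ℝ (Fin n))} {T : ℝ}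

theorem timeDeriv_eq (hT : 0 < T) {u : ℝ × EuclideanSpace ℝ (Fin n) → ℂ}
    (hu : DifferentiableOn ℝ u (closedCyl T Ω)) {t : ℝ} (ht : t ∈ Icc 0 T)
    {x : EuclideanSpace ℝ (Fin n)} (hx : x ∈ closure Ω) :
    timeDeriv T u t x = dirDeriv (closedCyl T Ω) (1, 0) u (t, x) :=
  ((hu (t, x) ⟨ht, hx⟩).hasFDerivWithinAt.slice_time hx).derivWithin (uniqueDiffOn_Icc hT t ht)

theorem gradSq_eq (hΩ : IsBoundedC2Domain Ω) {u : ℝ × EuclideanSpace ℝ (Fin n) → ℂ}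
    (hu : DifferentiableOn ℝ u (closedCyl T Ω)) {t : ℝ} (ht : t ∈ Icc 0 T)
    {x : EuclideanSpace ℝ (Fin n)} (hx : x ∈ Ω) :
    gradSq u t x =
      ∑ j, ‖dirDeriv (closedCyl T Ω) (0, EuclideanSpace.single j 1) u (t, x)‖ ^ 2 := by
  rw [gradSq, (fderiv_slice_space hΩ hu ht hx).fderiv]
  rfl

theorem normalDeriv_eq (hΩ : IsBoundedC2Domain Ω) {u : ℝ × EuclideanSpace ℝ (Fin n) → ℂ}
    (hu : DifferentiableOn ℝ u (closedCyl T Ω)) {t : ℝ} (ht : t ∈ Icc 0 T)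
    {x : EuclideanSpace ℝ (Fin n)} (hx : x ∈ frontier Ω) :
    normalDeriv Ω u t x = dirDeriv (closedCyl T Ω) (0, outerNormal Ω x) u (t, x) := by
  have hxc := frontier_subset_closure hx
  rw [normalDeriv, ((hu (t, x) ⟨ht, hxc⟩).hasFDerivWithinAt.slice_space ht).fderivWithin
    (hΩ.uniqueDiffOn_closure x hxc)]
  rfl

/-- Inside the open cylinder the two-sided derivatives in `waveOp` agree with derivatives within the
closed cylinder, not only at the point but on a neighbourhood, which is what second derivatives
require. -/
theorem waveOp_eq (hΩ : IsBoundedC2Domain Ω) (hT : 0 < T)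
    {u : ℝ × EuclideanSpace ℝ (Fin n) → ℂ} (hu : ContDiffOn ℝ 2 u (closedCyl T Ω))
    (q : ℝ × EuclideanSpace ℝ (Fin n) → ℝ) {p : ℝ × EuclideanSpace ℝ (Fin n)}
    (hp : p ∈ cyl T Ω) :
    waveOp q u p = boxOp (closedCyl T Ω) u p + (q p : ℂ) * u p := by
  obtain ⟨t, x⟩ := p
  obtain ⟨ht, hx⟩ : t ∈ Ioo 0 T ∧ x ∈ Ω := hp
  have hK := hΩ.uniqueDiffOn_closedCyl hT
  have htc := Ioo_subset_Icc_self ht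
  have hxc := subset_closure hx
  have hud := hu.differentiableOn two_ne_zero
  have hd : ∀ ξ, DifferentiableOn ℝ (dirDeriv (closedCyl T Ω) ξ u) (closedCyl T Ω) := fun ξ =>
    (hu.dirDeriv hK ξ).differentiableOn one_ne_zero
  have htime : iteratedDeriv 2 (fun s : ℝ => u (s, x)) t =
      dirDeriv (closedCyl T Ω) (1, 0) (dirDeriv (closedCyl T Ω) (1, 0) u) (t, x) := by
    have h1 : ∀ (g : ℝ × EuclideanSpace ℝ (Fin n) → ℂ), DifferentiableOn ℝ g (closedCyl T Ω) →
        ∀ s ∈ Ioo 0 T, deriv (fun s => g (s, x)) s = dirDeriv (closedCyl T Ω) (1, 0) g (s, x) :=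
      fun g hg s hs => (((hg (s, x) ⟨Ioo_subset_Icc_self hs, hxc⟩).hasFDerivWithinAt.slice_time
        hxc).hasDerivAt (Icc_mem_nhds hs.1 hs.2)).deriv
    have h2 : deriv (fun s : ℝ => u (s, x)) =ᶠ[𝓝 t]
        fun s => dirDeriv (closedCyl T Ω) (1, 0) u (s, x) := by
      filter_upwards [isOpen_Ioo.mem_nhds ht] with s hs using h1 u hud s hs
    rw [iteratedDeriv_succ, iteratedDeriv_one, h2.deriv_eq, h1 _ (hd _) t ht]
  have hspace : (Δ (fun y : EuclideanSpace ℝ (Fin n) => u (t, y))) x =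
      ∑ j, dirDeriv (closedCyl T Ω) (0, EuclideanSpace.single j 1)
        (dirDeriv (closedCyl T Ω) (0, EuclideanSpace.single j 1) u) (t, x) := by
    rw [InnerProductSpace.laplacian_eq_iteratedFDeriv_orthonormalBasis _
      (EuclideanSpace.basisFun (Fin n) ℝ)]
    refine Finset.sum_congr rfl fun j _ => ?_
    rw [iteratedFDeriv_two_apply, EuclideanSpace.basisFun_apply]
    simp only [Matrix.cons_val_zero, Matrix.cons_val_one]
    set e : EuclideanSpace ℝ (Fin n) := EuclideanSpace.single j 1
    have hc : ContDiffAt ℝ 2 (fun y : EuclideanSpace ℝ (Fin n) => u (t, y)) x := by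
      have h1 : ContDiffAt ℝ 2 u (t, x) := hu.contDiffAt (hΩ.closedCyl_mem_nhds ⟨ht, hx⟩)
      exact h1.comp x (contDiffAt_const.prodMk contDiffAt_id)
    have hcd : DifferentiableAt ℝ (fderiv ℝ fun y : EuclideanSpace ℝ (Fin n) => u (t, y)) x :=
      (hc.fderiv_right (m := 1) (by norm_num)).differentiableAt one_ne_zero
    have h1 : ∀ (g : ℝ × EuclideanSpace ℝ (Fin n) → ℂ), DifferentiableOn ℝ g (closedCyl T Ω) →
        ∀ y ∈ Ω, fderiv ℝ (fun y => g (t, y)) y e = dirDeriv (closedCyl T Ω) (0, e) g (t, y) := by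
      intro g hg y hy
      rw [(fderiv_slice_space hΩ hg htc hy).fderiv]
      rfl
    have h2 : (fun y => fderiv ℝ (fun y => u (t, y)) y e) =ᶠ[𝓝 x]
        fun y => dirDeriv (closedCyl T Ω) (0, e) u (t, y) := by
      filter_upwards [hΩ.isOpen.mem_nhds hx] with y hy using h1 u hud y hy
    have h3 : HasFDerivAt (fun y => fderiv ℝ (fun y => u (t, y)) y e) _ x :=
      hcd.hasFDerivAt.clm_apply (hasFDerivAt_const e x)
    rw [← h1 _ (hd _) x hx, ← h2.fderiv_eq, h3.fderiv]
    simp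
  rw [waveOp, htime, hspace, boxOp]

theorem ae_norm_le_of_eLpNorm_top_le {α : Type*} [MeasurableSpace α] {μ : Measure α} {q : α → ℝ}
    {M : ℝ≥0} (hq : eLpNorm q ∞ μ ≤ (M : ℝ≥0∞)) : ∀ᵐ p ∂μ, ‖q p‖ ≤ M := by
  rw [eLpNorm_exponent_top] at hq
  filter_upwards [ae_le_eLpNormEssSup (f := q) (μ := μ)] with p hp
  have h := hp.trans hq
  rw [← enorm_norm, Real.enorm_of_nonneg (norm_nonneg _)] at h
  exact (ENNReal.ofReal_le_iff_le_toReal ENNReal.coe_ne_top).1 h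

/-- Absorbing the potential. -/
theorem setIntegral_boxOp_sq_le (hΩ : IsBoundedC2Domain Ω) (hT : 0 < T)
    {u : ℝ × EuclideanSpace ℝ (Fin n) → ℂ} (hu : ContDiffOn ℝ 2 u (closedCyl T Ω))
    {q : ℝ × EuclideanSpace ℝ (Fin n) → ℝ} {M : ℝ≥0}
    (hqm : MemLp q ∞ (volume.restrict (cyl T Ω)))
    (hq : eLpNorm q ∞ (volume.restrict (cyl T Ω)) ≤ (M : ℝ≥0∞)) (lam : ℝ)
    (ω : EuclideanSpace ℝ (Fin n)) :
    ∫ p in cyl T Ω, carlemanWeight lam ω p * ‖boxOp (closedCyl T Ω) u p‖ ^ 2 ≤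
      2 * (∫ p in cyl T Ω, carlemanWeight lam ω p * ‖waveOp q u p‖ ^ 2) +
      2 * (M : ℝ) ^ 2 * ∫ p in cyl T Ω, carlemanWeight lam ω p * ‖u p‖ ^ 2 := by
  have hK := hΩ.uniqueDiffOn_closedCyl hT
  have hWc : ContinuousOn (carlemanWeight lam ω) (closedCyl T Ω) :=
    (continuous_carlemanWeight lam ω).continuousOn
  have hBc : ContinuousOn (boxOp (closedCyl T Ω) u) (closedCyl T Ω) :=
    ((hu.dirDeriv hK _).continuousOn_dirDeriv hK _).sub
      (continuousOn_finsetSum Finset.univ fun j _ =>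
        (hu.dirDeriv hK _).continuousOn_dirDeriv hK _)
  have iB : IntegrableOn (fun p => carlemanWeight lam ω p * ‖boxOp (closedCyl T Ω) u p‖ ^ 2)
      (cyl T Ω) := hΩ.integrableOn_cyl (hWc.mul (hBc.norm.pow 2))
  have iU : IntegrableOn (fun p => carlemanWeight lam ω p * ‖u p‖ ^ 2) (cyl T Ω) :=
    hΩ.integrableOn_cyl (hWc.mul (hu.continuousOn.norm.pow 2))
  have hqb := ae_norm_le_of_eLpNorm_top_le hq
  have hPe : ∫ p in cyl T Ω, carlemanWeight lam ω p * ‖waveOp q u p‖ ^ 2 =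
      ∫ p in cyl T Ω, carlemanWeight lam ω p *
        ‖boxOp (closedCyl T Ω) u p + (q p : ℂ) * u p‖ ^ 2 :=
    setIntegral_congr_fun hΩ.measurableSet_cyl fun p hp => by
      simp only [waveOp_eq hΩ hT hu q hp]
  have hqu : ∀ᵐ p ∂(volume.restrict (cyl T Ω)), ‖(q p : ℂ) * u p‖ ^ 2 ≤ (M : ℝ) ^ 2 * ‖u p‖ ^ 2 := by
    filter_upwards [hqb] with p hp
    rw [norm_mul, mul_pow, Complex.norm_real]
    gcongr
  -- Since `q` is only measurable and essentially bounded, continuity is unavailable; integrability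
  -- comes from domination by the two continuous terms.
  have iP : IntegrableOn (fun p => carlemanWeight lam ω p *
      ‖boxOp (closedCyl T Ω) u p + (q p : ℂ) * u p‖ ^ 2) (cyl T Ω) := by
    refine Integrable.mono' ((iB.const_mul 2).add (iU.const_mul (2 * (M : ℝ) ^ 2))) ?_ ?_
    · have hqa : AEStronglyMeasurable (fun p => (q p : ℂ)) (volume.restrict (cyl T Ω)) :=
        Complex.continuous_ofReal.comp_aestronglyMeasurable hqm.1
      have hua := (hΩ.integrableOn_cyl hu.continuousOn).aestronglyMeasurable
      have hBa := (hΩ.integrableOn_cyl hBc).aestronglyMeasurable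
      have hWa := (hΩ.integrableOn_cyl hWc).aestronglyMeasurable
      exact hWa.mul ((hBa.add (hqa.mul hua)).norm.pow 2)
    · filter_upwards [hqu] with p hp
      have hW := (carlemanWeight_pos lam ω p).le
      rw [Real.norm_of_nonneg (mul_nonneg hW (sq_nonneg _))]
      simp only [Pi.add_apply]
      have h1 := norm_add_le (boxOp (closedCyl T Ω) u p) ((q p : ℂ) * u p)
      have h2 : ‖boxOp (closedCyl T Ω) u p + (q p : ℂ) * u p‖ ^ 2 ≤
          2 * ‖boxOp (closedCyl T Ω) u p‖ ^ 2 + 2 * ((M : ℝ) ^ 2 * ‖u p‖ ^ 2) := by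
        nlinarith [pow_le_pow_left₀ (norm_nonneg _) h1 2,
          sq_nonneg (‖boxOp (closedCyl T Ω) u p‖ - ‖(q p : ℂ) * u p‖)]
      nlinarith [mul_le_mul_of_nonneg_left h2 hW]
  rw [hPe, ← integral_const_mul, ← integral_const_mul, ← integral_add (iP.const_mul _)
    (iU.const_mul _)]
  refine integral_mono_ae iB ((iP.const_mul _).add (iU.const_mul _)) ?_
  filter_upwards [hqu] with p hp
  have hW := (carlemanWeight_pos lam ω p).le
  have h1 := norm_sub_le (boxOp (closedCyl T Ω) u p + (q p : ℂ) * u p) ((q p : ℂ) * u p)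
  rw [add_sub_cancel_right] at h1
  have h2 : ‖boxOp (closedCyl T Ω) u p‖ ^ 2 ≤
      2 * ‖boxOp (closedCyl T Ω) u p + (q p : ℂ) * u p‖ ^ 2 + 2 * ((M : ℝ) ^ 2 * ‖u p‖ ^ 2) := by
    nlinarith [pow_le_pow_left₀ (norm_nonneg _) h1 2,
      sq_nonneg (‖boxOp (closedCyl T Ω) u p + (q p : ℂ) * u p‖ - ‖(q p : ℂ) * u p‖)]
  nlinarith [mul_le_mul_of_nonneg_left h2 hW]

/-- The Carleman estimate for functions vanishing to first order at `t = 0`. -/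
theorem carleman_forward (hn : 2 ≤ n) (hΩ : IsBoundedC2Domain Ω) (hT : 0 < T) (M : ℝ≥0) :
    ∃ lam₁ : ℝ, 1 < lam₁ ∧ ∃ C : ℝ, 0 < C ∧
      ∀ ω : EuclideanSpace ℝ (Fin n), ‖ω‖ = 1 →
      ∀ q : ℝ × EuclideanSpace ℝ (Fin n) → ℝ,
        MemLp q ∞ (volume.restrict (cyl T Ω)) →
        eLpNorm q ∞ (volume.restrict (cyl T Ω)) ≤ (M : ℝ≥0∞) →
      ∀ u : ℝ × EuclideanSpace ℝ (Fin n) → ℂ, ContDiffOn ℝ 2 u (closedCyl T Ω) →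
        (∀ t ∈ Ioo 0 T, ∀ x ∈ frontier Ω, u (t, x) = 0) →
        (∀ x ∈ Ω, u (0, x) = 0 ∧ timeDeriv T u 0 x = 0) →
          ∀ lam : ℝ, lam₁ ≤ lam →
            lam * (∫ x in Ω, Real.exp (-2 * lam * (T + ⟪ω, x⟫)) * ‖timeDeriv T u T x‖ ^ 2)
              + lam * (∫ t in Ioo 0 T, ∫ x in facePlus Ω ω,
                  Real.exp (-2 * lam * (t + ⟪ω, x⟫)) * ‖normalDeriv Ω u t x‖ ^ 2
                    * |⟪ω, outerNormal Ω x⟫| ∂(surfaceMeasure n))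
              + lam ^ 2 * (∫ p in cyl T Ω,
                  Real.exp (-2 * lam * (p.1 + ⟪ω, p.2⟫)) * ‖u p‖ ^ 2)
            ≤ C * ((∫ p in cyl T Ω,
                    Real.exp (-2 * lam * (p.1 + ⟪ω, p.2⟫)) * ‖waveOp q u p‖ ^ 2)
                  + lam ^ 3 * (∫ x in Ω, Real.exp (-2 * lam * (T + ⟪ω, x⟫)) * ‖u (T, x)‖ ^ 2)
                  + lam * (∫ x in Ω, Real.exp (-2 * lam * (T + ⟪ω, x⟫)) * gradSq u T x))
              + C * lam * (∫ t in Ioo 0 T, ∫ x in faceMinus Ω ω,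
                  Real.exp (-2 * lam * (t + ⟪ω, x⟫)) * ‖normalDeriv Ω u t x‖ ^ 2
                    * |⟪ω, outerNormal Ω x⟫| ∂(surfaceMeasure n)) := by
  obtain ⟨μ, k₀, hμ, hle₁, hle₂⟩ := hΩ.exists_isDivergenceMeasure hn
  have hfin := hμ.isFiniteMeasure
  set σ := (surfaceMeasure n).restrict (frontier Ω) with hσ
  have hfinσ : IsFiniteMeasure σ := isFiniteMeasure_of_le _ hle₂
  -- Adding `1` makes the comparison constant positive, so that it may be divided by.
  set k : ℝ := k₀ + 1 with hk
  have hkpos : 0 < k := by positivity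
  -- Smallest factor available on the left: `1 / (2T²)` remains for `|u|²` after absorption, `1 / 2`
  -- for the final time derivative, and `2 / k` for the outflow face after the change of measure.
  set c : ℝ := min (min (1 / (2 * T ^ 2)) (1 / 2)) (2 / k) with hc
  have hcpos : 0 < c := by positivity
  have hc1 : c ≤ 1 / (2 * T ^ 2) := (min_le_left _ _).trans (min_le_left _ _)
  have hc2 : c ≤ 1 / 2 := (min_le_left _ _).trans (min_le_right _ _)
  have hc3 : c * k ≤ 2 := by
    rw [← le_div_iff₀ hkpos]; exact min_le_right _ _
  -- The threshold gives `lam ≥ 2MT`, hence `2M² ≤ lam² / (2T²)`. The numerator `5 + 2k` dominates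
  -- the coefficients `2`, `5`, `4` and `2k` on the right. Everything is fixed before `ω`, `q` and
  -- `u` enter.
  refine ⟨2 + 2 * M * T, by have : 0 ≤ (M : ℝ) * T := by positivity
                            linarith, (5 + 2 * k) / c, by positivity, ?_⟩
  intro ω hω q hqm hq u hu huS hu0 lam hlam
  have hud := hu.differentiableOn two_ne_zero
  have hMT : 0 ≤ (M : ℝ) * T := by positivity
  have hlam0 : 0 < lam := by linarith
  have hTc : T ∈ Icc 0 T := ⟨hT.le, le_rfl⟩
  have main := carleman_complex hΩ hT hμ hω hu huS (fun x hx => (hu0 x hx).1)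
    (fun x hx => by
      rw [← timeDeriv_eq hT hud ⟨le_rfl, hT.le⟩ (subset_closure hx)]; exact (hu0 x hx).2) hlam0.le
  have hbox := setIntegral_boxOp_sq_le hΩ hT hu hqm hq lam ω
  -- the boundary terms
  set h : ℝ × EuclideanSpace ℝ (Fin n) → ℝ := fun p => carlemanWeight lam ω p *
    ‖dirDeriv (closedCyl T Ω) (0, outerNormal Ω p.2) u p‖ ^ 2 with hh
  have hhc : ContinuousOn h (Icc 0 T ×ˢ frontier Ω) :=
    (continuous_carlemanWeight lam ω).continuousOn.mul
      ((continuousOn_normalComponent hΩ hT hu).norm.pow 2)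
  have hhc' : ContinuousOn (fun p => h p * |⟪ω, outerNormal Ω p.2⟫|) (Icc 0 T ×ˢ frontier Ω) := by
    refine hhc.mul ?_
    simp_rw [real_inner_comm _ ω]
    exact (continuousOn_outerNormal_snd hΩ ω).abs
  have hh0 : ∀ p, 0 ≤ h p * |⟪ω, outerNormal Ω p.2⟫| := fun p =>
    mul_nonneg (mul_nonneg (carlemanWeight_pos lam ω p).le (sq_nonneg _)) (abs_nonneg _)
  have hfaces := integral_boundary_eq_sub_faces hΩ hμ.measure_compl ω hhc
  have hPs : facePlus Ω ω ⊆ frontier Ω := fun x hx => hx.1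
  have hMs : faceMinus Ω ω ⊆ frontier Ω := fun x hx => hx.1
  have hSp := integral_face_le hΩ hle₂ (hΩ.isClosed_facePlus ω) hPs hhc' hh0
  have hSm := integral_face_le hΩ hle₁ (hΩ.isClosed_faceMinus ω) hMs hhc' hh0
  have hconv : ∀ F : Set (EuclideanSpace ℝ (Fin n)), IsClosed F → F ⊆ frontier Ω →
      ∫ t in Ioo 0 T, ∫ x in F, Real.exp (-2 * lam * (t + ⟪ω, x⟫)) * ‖normalDeriv Ω u t x‖ ^ 2
        * |⟪ω, outerNormal Ω x⟫| ∂(surfaceMeasure n) =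
      ∫ t in Ioo 0 T, ∫ x in F, h (t, x) * |⟪ω, outerNormal Ω x⟫| ∂σ := by
    intro F hF hFs
    rw [hσ, Measure.restrict_restrict_of_subset hFs]
    refine setIntegral_congr_fun measurableSet_Ioo fun t ht => ?_
    refine setIntegral_congr_fun hF.measurableSet fun x hx => ?_
    simp only [hh, normalDeriv_eq hΩ hud (Ioo_subset_Icc_self ht) (hFs hx)]
    rfl
  rw [hconv _ (hΩ.isClosed_facePlus ω) hPs, hconv _ (hΩ.isClosed_faceMinus ω) hMs]
  have hAe : ∫ x in Ω, Real.exp (-2 * lam * (T + ⟪ω, x⟫)) * ‖timeDeriv T u T x‖ ^ 2 =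
      ∫ x in Ω, carlemanWeight lam ω (T, x) *
        ‖dirDeriv (closedCyl T Ω) (1, 0) u (T, x)‖ ^ 2 :=
    setIntegral_congr_fun hΩ.isOpen.measurableSet fun x hx => by
      simp only [timeDeriv_eq hT hud hTc (subset_closure hx)]; rfl
  have hGe : ∫ x in Ω, Real.exp (-2 * lam * (T + ⟪ω, x⟫)) * gradSq u T x =
      ∫ x in Ω, carlemanWeight lam ω (T, x) *
        ∑ j, ‖dirDeriv (closedCyl T Ω) (0, EuclideanSpace.single j 1) u (T, x)‖ ^ 2 :=
    setIntegral_congr_fun hΩ.isOpen.measurableSet fun x hx => by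
      simp only [gradSq_eq hΩ hud hTc hx]; rfl
  rw [hAe, hGe]
  change lam * _ + lam * _ + lam ^ 2 * (∫ p in cyl T Ω, carlemanWeight lam ω p * ‖u p‖ ^ 2) ≤
    (5 + 2 * k) / c * ((∫ p in cyl T Ω, carlemanWeight lam ω p * ‖waveOp q u p‖ ^ 2) +
      lam ^ 3 * (∫ x in Ω, carlemanWeight lam ω (T, x) * ‖u (T, x)‖ ^ 2) + _) + _
  change _ + _ + 2 * lam * (∫ t in Ioo 0 T, ∫ x, h (t, x) * ⟪outerNormal Ω x, ω⟫ ∂μ) ≤ _ at main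
  rw [hfaces] at main
  have hW := fun p => (carlemanWeight_pos lam ω p).le
  have nA : 0 ≤ ∫ x in Ω, carlemanWeight lam ω (T, x) *
      ‖dirDeriv (closedCyl T Ω) (1, 0) u (T, x)‖ ^ 2 :=
    integral_nonneg fun x => mul_nonneg (hW _) (sq_nonneg _)
  have nV : 0 ≤ ∫ p in cyl T Ω, carlemanWeight lam ω p * ‖u p‖ ^ 2 :=
    integral_nonneg fun x => mul_nonneg (hW _) (sq_nonneg _)
  have nP : 0 ≤ ∫ p in cyl T Ω, carlemanWeight lam ω p * ‖waveOp q u p‖ ^ 2 :=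
    integral_nonneg fun x => mul_nonneg (hW _) (sq_nonneg _)
  have nX : 0 ≤ ∫ x in Ω, carlemanWeight lam ω (T, x) * ‖u (T, x)‖ ^ 2 :=
    integral_nonneg fun x => mul_nonneg (hW _) (sq_nonneg _)
  have nG : 0 ≤ ∫ x in Ω, carlemanWeight lam ω (T, x) *
        ∑ j, ‖dirDeriv (closedCyl T Ω) (0, EuclideanSpace.single j 1) u (T, x)‖ ^ 2 :=
    integral_nonneg fun x => mul_nonneg (hW _) (Finset.sum_nonneg fun _ _ => sq_nonneg _)
  have nBp : 0 ≤ ∫ t in Ioo 0 T, ∫ x in facePlus Ω ω, h (t, x) * |⟪ω, outerNormal Ω x⟫| ∂μ :=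
    integral_nonneg fun t => integral_nonneg fun x => hh0 (t, x)
  have nSm : 0 ≤ ∫ t in Ioo 0 T, ∫ x in faceMinus Ω ω, h (t, x) * |⟪ω, outerNormal Ω x⟫| ∂σ :=
    integral_nonneg fun t => integral_nonneg fun x => hh0 (t, x)
  simp only at hSp hSm
  generalize (∫ x in Ω, carlemanWeight lam ω (T, x) *
      ‖dirDeriv (closedCyl T Ω) (1, 0) u (T, x)‖ ^ 2) = A at *
  generalize (∫ p in cyl T Ω, carlemanWeight lam ω p * ‖u p‖ ^ 2) = V at *
  generalize (∫ p in cyl T Ω, carlemanWeight lam ω p * ‖waveOp q u p‖ ^ 2) = P at *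
  generalize (∫ x in Ω, carlemanWeight lam ω (T, x) * ‖u (T, x)‖ ^ 2) = X at *
  generalize (∫ x in Ω, carlemanWeight lam ω (T, x) *
        ∑ j, ‖dirDeriv (closedCyl T Ω) (0, EuclideanSpace.single j 1) u (T, x)‖ ^ 2) = G at *
  generalize (∫ t in Ioo 0 T, ∫ x in facePlus Ω ω, h (t, x) * |⟪ω, outerNormal Ω x⟫| ∂μ) = Bp at *
  generalize (∫ t in Ioo 0 T, ∫ x in faceMinus Ω ω, h (t, x) * |⟪ω, outerNormal Ω x⟫| ∂μ) = Bm at *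
  generalize (∫ t in Ioo 0 T, ∫ x in facePlus Ω ω, h (t, x) * |⟪ω, outerNormal Ω x⟫| ∂σ) = Sp at *
  generalize (∫ t in Ioo 0 T, ∫ x in faceMinus Ω ω, h (t, x) * |⟪ω, outerNormal Ω x⟫| ∂σ) = Sm at *
  generalize (∫ p in cyl T Ω, carlemanWeight lam ω p * ‖boxOp (closedCyl T Ω) u p‖ ^ 2) = Bx at *
  have hSp' : Sp ≤ k * Bp := by rw [hk]; linarith
  have hSm' : Bm ≤ k * Sm := by rw [hk]; linarith
  -- Half of `lam² / T² · V` absorbs the potential; the other half stays on the left.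
  have hlamM : 2 * (M : ℝ) ^ 2 * V ≤ lam ^ 2 / (2 * T ^ 2) * V := by
    refine mul_le_mul_of_nonneg_right ?_ nV
    rw [le_div_iff₀ (by positivity)]
    nlinarith
  have hsplit : lam ^ 2 / T ^ 2 * V = lam ^ 2 / (2 * T ^ 2) * V + lam ^ 2 / (2 * T ^ 2) * V := by
    field_simp; ring
  have e1 : c * (lam ^ 2 * V) ≤ lam ^ 2 / (2 * T ^ 2) * V := by
    have := mul_le_mul_of_nonneg_right hc1 (by positivity : 0 ≤ lam ^ 2 * V)
    refine this.trans_eq ?_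
    ring
  have e2 : c * (lam * A) ≤ lam / 2 * A := by
    have := mul_le_mul_of_nonneg_right hc2 (by positivity : 0 ≤ lam * A)
    linarith
  have e3 : c * (lam * Sp) ≤ 2 * lam * Bp := by
    have h1 := mul_le_mul_of_nonneg_left hSp' (by positivity : 0 ≤ c * lam)
    have h2 := mul_le_mul_of_nonneg_right hc3 (by positivity : 0 ≤ lam * Bp)
    linarith
  have e4 : 2 * lam * Bm ≤ 2 * k * (lam * Sm) := by
    have h1 := mul_le_mul_of_nonneg_left hSm' (by positivity : 0 ≤ 2 * lam)
    linarith
  have hfinal : c * (lam * A + lam * Sp + lam ^ 2 * V) ≤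
      (5 + 2 * k) * (P + lam ^ 3 * X + lam * G) + (5 + 2 * k) * (lam * Sm) := by
    have n1 : 0 ≤ lam ^ 3 * X := by positivity
    have n2 : 0 ≤ lam * G := by positivity
    have n3 : 0 ≤ lam * Sm := by positivity
    have m1 := mul_nonneg hkpos.le nP
    have m2 := mul_nonneg hkpos.le n1
    have m3 := mul_nonneg hkpos.le n2
    linarith
  rw [mul_comm c, ← le_div_iff₀ hcpos] at hfinal
  refine hfinal.trans_eq ?_
  ring

end ForwardEstimate

/-! ### Time reversal and the backward estimate -/

section TimeReversal

variable {n : ℕ} {Ω : Set (EuclideanSpace ℝ (Fin n))} {T : ℝ}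

/-- The reflection `t ↦ T - t` of space-time in the time variable. -/
def timeReversal (T : ℝ) (p : ℝ × EuclideanSpace ℝ (Fin n)) : ℝ × EuclideanSpace ℝ (Fin n) :=
  (T - p.1, p.2)

theorem contDiff_timeReversal {k : WithTop ℕ∞} :
    ContDiff ℝ k (timeReversal (n := n) T) := by
  unfold timeReversal; fun_prop

theorem measurePreserving_timeReversal :
    MeasurePreserving (timeReversal (n := n) T) := by
  have h := (Measure.measurePreserving_sub_left (volume : Measure ℝ) T).prod
    (MeasurePreserving.id (volume : Measure (EuclideanSpace ℝ (Fin n))))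
  exact h

theorem measurableEmbedding_timeReversal :
    MeasurableEmbedding (timeReversal (n := n) T) :=
  ((Homeomorph.subLeft T).prodCongr
    (Homeomorph.refl (EuclideanSpace ℝ (Fin n)))).measurableEmbedding

theorem timeReversal_preimage_cyl : timeReversal T ⁻¹' cyl T Ω = cyl T Ω := by
  ext p
  simp only [timeReversal, cyl, mem_preimage, mem_prod, mem_Ioo]
  constructor <;> rintro ⟨⟨h1, h2⟩, h3⟩ <;> exact ⟨⟨by linarith, by linarith⟩, h3⟩

theorem mapsTo_timeReversal_closedCyl :
    MapsTo (timeReversal T) (closedCyl T Ω) (closedCyl T Ω) := by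
  rintro p ⟨⟨h1, h2⟩, h3⟩
  exact ⟨⟨by simpa [timeReversal] using h2, by simpa [timeReversal] using h1⟩, h3⟩

theorem measurePreserving_timeReversal_restrict :
    MeasurePreserving (timeReversal (n := n) T) (volume.restrict (cyl T Ω))
      (volume.restrict (cyl T Ω)) := by
  have h := measurePreserving_timeReversal (n := n) (T := T)
    |>.restrict_preimage_emb measurableEmbedding_timeReversal (cyl T Ω)
  rwa [timeReversal_preimage_cyl] at h

theorem setIntegral_cyl_timeReversal (f : ℝ × EuclideanSpace ℝ (Fin n) → ℝ) :
    ∫ p in cyl T Ω, f (timeReversal T p) = ∫ p in cyl T Ω, f p :=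
  measurePreserving_timeReversal_restrict.integral_comp measurableEmbedding_timeReversal f

theorem setIntegral_Ioo_sub_left (f : ℝ → ℝ) :
    ∫ t in Ioo 0 T, f (T - t) = ∫ t in Ioo 0 T, f t := by
  have h := (Measure.measurePreserving_sub_left (volume : Measure ℝ) T).restrict_preimage_emb
    (Homeomorph.subLeft T).measurableEmbedding (Ioo 0 T)
  rw [Set.preimage_const_sub_Ioo, sub_self, sub_zero] at h
  exact h.integral_comp (Homeomorph.subLeft T).measurableEmbedding f

open Pointwise in
theorem timeDeriv_timeReversal (u : ℝ × EuclideanSpace ℝ (Fin n) → ℂ) (t : ℝ)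
    (x : EuclideanSpace ℝ (Fin n)) :
    timeDeriv T (u ∘ timeReversal T) t x = -timeDeriv T u (T - t) x := by
  have h := derivWithin_comp_const_sub (f := fun s => u (s, x)) (s := Icc 0 T) (x := t) T
  have hs : T +ᵥ -Icc (0 : ℝ) T = Icc 0 T := by
    ext s
    simp [and_comm]
  rw [hs] at h
  exact h

theorem waveOp_timeReversal (q : ℝ × EuclideanSpace ℝ (Fin n) → ℝ)
    (u : ℝ × EuclideanSpace ℝ (Fin n) → ℂ) (p : ℝ × EuclideanSpace ℝ (Fin n)) :
    waveOp (q ∘ timeReversal T) (u ∘ timeReversal T) p = waveOp q u (timeReversal T p) := by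
  have h := congrFun (iteratedDeriv_comp_const_sub 2 (fun s => u (s, p.2)) T) p.1
  simp only [even_two, Even.neg_pow, one_pow, one_smul] at h
  simp only [waveOp, Function.comp_apply, timeReversal]
  rw [h]

/-- Reversing time and reflecting `ω` turns the forward weight into the backward one up to the
constant `e^{-2λT}`, which is common to all terms and divides out. -/
theorem exp_reversed_weight (lam T s a : ℝ) :
    Real.exp (-2 * lam * (T - s + -a))
      = Real.exp (-2 * lam * T) * Real.exp (2 * lam * (s + a)) := by
  rw [← Real.exp_add]; ring_nf

/-- Undoing the time reversal and the reflection of `ω` in the forward estimate gives the backward one. -/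
theorem carleman_of_timeReversal {lam C : ℝ}
    {ω : EuclideanSpace ℝ (Fin n)} {q : ℝ × EuclideanSpace ℝ (Fin n) → ℝ}
    {u : ℝ × EuclideanSpace ℝ (Fin n) → ℂ}
    (h : lam * (∫ x in Ω, Real.exp (-2 * lam * (T + ⟪-ω, x⟫))
              * ‖timeDeriv T (u ∘ timeReversal T) T x‖ ^ 2)
          + lam * (∫ t in Ioo 0 T, ∫ x in facePlus Ω (-ω),
              Real.exp (-2 * lam * (t + ⟪-ω, x⟫)) * ‖normalDeriv Ω (u ∘ timeReversal T) t x‖ ^ 2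
                * |⟪-ω, outerNormal Ω x⟫| ∂(surfaceMeasure n))
          + lam ^ 2 * (∫ p in cyl T Ω,
              Real.exp (-2 * lam * (p.1 + ⟪-ω, p.2⟫)) * ‖(u ∘ timeReversal T) p‖ ^ 2)
        ≤ C * ((∫ p in cyl T Ω, Real.exp (-2 * lam * (p.1 + ⟪-ω, p.2⟫))
                * ‖waveOp (q ∘ timeReversal T) (u ∘ timeReversal T) p‖ ^ 2)
              + lam ^ 3 * (∫ x in Ω,
                Real.exp (-2 * lam * (T + ⟪-ω, x⟫)) * ‖(u ∘ timeReversal T) (T, x)‖ ^ 2)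
              + lam * (∫ x in Ω,
                Real.exp (-2 * lam * (T + ⟪-ω, x⟫)) * gradSq (u ∘ timeReversal T) T x))
          + C * lam * (∫ t in Ioo 0 T, ∫ x in faceMinus Ω (-ω),
              Real.exp (-2 * lam * (t + ⟪-ω, x⟫)) * ‖normalDeriv Ω (u ∘ timeReversal T) t x‖ ^ 2
                * |⟪-ω, outerNormal Ω x⟫| ∂(surfaceMeasure n))) :
    lam * (∫ x in Ω, Real.exp (2 * lam * ⟪ω, x⟫) * ‖timeDeriv T u 0 x‖ ^ 2)
        + lam * (∫ t in Ioo 0 T, ∫ x in faceMinus Ω ω,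
            Real.exp (2 * lam * (t + ⟪ω, x⟫)) * ‖normalDeriv Ω u t x‖ ^ 2
              * |⟪ω, outerNormal Ω x⟫| ∂(surfaceMeasure n))
        + lam ^ 2 * (∫ p in cyl T Ω, Real.exp (2 * lam * (p.1 + ⟪ω, p.2⟫)) * ‖u p‖ ^ 2)
      ≤ C * ((∫ p in cyl T Ω, Real.exp (2 * lam * (p.1 + ⟪ω, p.2⟫)) * ‖waveOp q u p‖ ^ 2)
            + lam ^ 3 * (∫ x in Ω, Real.exp (2 * lam * ⟪ω, x⟫) * ‖u (0, x)‖ ^ 2)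
            + lam * (∫ x in Ω, Real.exp (2 * lam * ⟪ω, x⟫) * gradSq u 0 x))
        + C * lam * (∫ t in Ioo 0 T, ∫ x in facePlus Ω ω,
            Real.exp (2 * lam * (t + ⟪ω, x⟫)) * ‖normalDeriv Ω u t x‖ ^ 2
              * |⟪ω, outerNormal Ω x⟫| ∂(surfaceMeasure n)) := by
  set E := Real.exp (-2 * lam * T) with hE
  have hE0 : 0 < E := Real.exp_pos _
  have hfinal : ∀ f : EuclideanSpace ℝ (Fin n) → ℝ,
      ∫ x in Ω, Real.exp (-2 * lam * (T + ⟪-ω, x⟫)) * f x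
        = E * ∫ x in Ω, Real.exp (2 * lam * ⟪ω, x⟫) * f x := fun f => by
    rw [← integral_const_mul]
    congr 1 with x
    -- The final slice of the reversed function is the slice `t = 0` of the original, hence `s = 0`.
    have := exp_reversed_weight lam T 0 ⟪ω, x⟫
    rw [sub_zero, zero_add] at this
    rw [inner_neg_left, this, mul_assoc]
  have hcyl : ∀ f : ℝ × EuclideanSpace ℝ (Fin n) → ℝ,
      ∫ p in cyl T Ω, Real.exp (-2 * lam * (p.1 + ⟪-ω, p.2⟫)) * f (timeReversal T p)
        = E * ∫ p in cyl T Ω, Real.exp (2 * lam * (p.1 + ⟪ω, p.2⟫)) * f p := fun f => by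
    rw [← integral_const_mul, ← setIntegral_cyl_timeReversal]
    congr 1 with p
    have hp : timeReversal T (timeReversal T p) = p := by simp [timeReversal]
    rw [hp, inner_neg_left, timeReversal, exp_reversed_weight, mul_assoc]
  have hface : ∀ S : Set (EuclideanSpace ℝ (Fin n)),
      ∫ t in Ioo 0 T, ∫ x in S, Real.exp (-2 * lam * (t + ⟪-ω, x⟫))
          * ‖normalDeriv Ω (u ∘ timeReversal T) t x‖ ^ 2
          * |⟪-ω, outerNormal Ω x⟫| ∂(surfaceMeasure n)
        = E * ∫ t in Ioo 0 T, ∫ x in S, Real.exp (2 * lam * (t + ⟪ω, x⟫))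
          * ‖normalDeriv Ω u t x‖ ^ 2 * |⟪ω, outerNormal Ω x⟫| ∂(surfaceMeasure n) :=
    fun S => by
    rw [← integral_const_mul, ← setIntegral_Ioo_sub_left]
    congr 1 with t
    rw [← integral_const_mul]
    congr 1 with x
    have ht : normalDeriv Ω (u ∘ timeReversal T) (T - t) x = normalDeriv Ω u t x := by
      simp [normalDeriv, timeReversal]
    rw [ht, inner_neg_left, inner_neg_left, abs_neg, exp_reversed_weight]
    ring
  have hgrad : ∀ x, gradSq (u ∘ timeReversal T) T x = gradSq u 0 x := fun x => by
    simp [gradSq, timeReversal]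
  simp only [timeDeriv_timeReversal, waveOp_timeReversal, norm_neg, hgrad, Function.comp_apply,
    sub_self] at h
  rw [hfinal, hfinal, hfinal, hface, hface, hcyl (fun p => ‖u p‖ ^ 2),
    hcyl (fun p => ‖waveOp q u p‖ ^ 2), facePlus_neg, faceMinus_neg] at h
  simp only [timeReversal, sub_self] at h
  refine le_of_mul_le_mul_left (h.trans_eq' ?_ |>.trans_eq ?_) hE0 <;> ring

end TimeReversal

end CarlemanEstimate

theorem theorem4p1 (n : ℕ) (hn : 2 ≤ n) (Ω : Set (EuclideanSpace ℝ (Fin n)))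
    (hΩ : IsBoundedC2Domain Ω) (T : ℝ) (hT : 0 < T) (M : ℝ≥0) :
    ∃ lam₁ : ℝ, 1 < lam₁ ∧ ∃ C : ℝ, 0 < C ∧
      ∀ ω : EuclideanSpace ℝ (Fin n), ‖ω‖ = 1 →
      ∀ q : ℝ × EuclideanSpace ℝ (Fin n) → ℝ,
        MemLp q ∞ (volume.restrict (cyl T Ω)) →
        eLpNorm q ∞ (volume.restrict (cyl T Ω)) ≤ (M : ℝ≥0∞) →
      ∀ u : ℝ × EuclideanSpace ℝ (Fin n) → ℂ, ContDiffOn ℝ 2 u (closure (cyl T Ω)) →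
        (∀ t ∈ Ioo 0 T, ∀ x ∈ frontier Ω, u (t, x) = 0) →
        ((∀ x ∈ Ω, u (0, x) = 0 ∧ timeDeriv T u 0 x = 0) →
          ∀ lam : ℝ, lam₁ ≤ lam →
            lam * (∫ x in Ω, Real.exp (-2 * lam * (T + ⟪ω, x⟫)) * ‖timeDeriv T u T x‖ ^ 2)
              + lam * (∫ t in Ioo 0 T, ∫ x in facePlus Ω ω,
                  Real.exp (-2 * lam * (t + ⟪ω, x⟫)) * ‖normalDeriv Ω u t x‖ ^ 2
                    * |⟪ω, outerNormal Ω x⟫| ∂(surfaceMeasure n))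
              + lam ^ 2 * (∫ p in cyl T Ω,
                  Real.exp (-2 * lam * (p.1 + ⟪ω, p.2⟫)) * ‖u p‖ ^ 2)
            ≤ C * ((∫ p in cyl T Ω,
                    Real.exp (-2 * lam * (p.1 + ⟪ω, p.2⟫)) * ‖waveOp q u p‖ ^ 2)
                  + lam ^ 3 * (∫ x in Ω, Real.exp (-2 * lam * (T + ⟪ω, x⟫)) * ‖u (T, x)‖ ^ 2)
                  + lam * (∫ x in Ω, Real.exp (-2 * lam * (T + ⟪ω, x⟫)) * gradSq u T x))
              + C * lam * (∫ t in Ioo 0 T, ∫ x in faceMinus Ω ω,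
                  Real.exp (-2 * lam * (t + ⟪ω, x⟫)) * ‖normalDeriv Ω u t x‖ ^ 2
                    * |⟪ω, outerNormal Ω x⟫| ∂(surfaceMeasure n)))
        ∧
        ((∀ x ∈ Ω, u (T, x) = 0 ∧ timeDeriv T u T x = 0) →
          ∀ lam : ℝ, lam₁ ≤ lam →
            lam * (∫ x in Ω, Real.exp (2 * lam * ⟪ω, x⟫) * ‖timeDeriv T u 0 x‖ ^ 2)
              + lam * (∫ t in Ioo 0 T, ∫ x in faceMinus Ω ω,
                  Real.exp (2 * lam * (t + ⟪ω, x⟫)) * ‖normalDeriv Ω u t x‖ ^ 2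
                    * |⟪ω, outerNormal Ω x⟫| ∂(surfaceMeasure n))
              + lam ^ 2 * (∫ p in cyl T Ω,
                  Real.exp (2 * lam * (p.1 + ⟪ω, p.2⟫)) * ‖u p‖ ^ 2)
            ≤ C * ((∫ p in cyl T Ω,
                    Real.exp (2 * lam * (p.1 + ⟪ω, p.2⟫)) * ‖waveOp q u p‖ ^ 2)
                  + lam ^ 3 * (∫ x in Ω, Real.exp (2 * lam * ⟪ω, x⟫) * ‖u (0, x)‖ ^ 2)
                  + lam * (∫ x in Ω, Real.exp (2 * lam * ⟪ω, x⟫) * gradSq u 0 x))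
              + C * lam * (∫ t in Ioo 0 T, ∫ x in facePlus Ω ω,
                  Real.exp (2 * lam * (t + ⟪ω, x⟫)) * ‖normalDeriv Ω u t x‖ ^ 2
                    * |⟪ω, outerNormal Ω x⟫| ∂(surfaceMeasure n))) := by

  obtain ⟨lam₁, hlam₁, C, hC, H⟩ := carleman_forward hn hΩ hT M
  refine ⟨lam₁, hlam₁, C, hC, fun ω hω q hq hqM u hu huS => ?_⟩
  rw [closure_cyl hT] at hu
  refine ⟨H ω hω q hq hqM u hu huS, fun hu0 lam hlam => ?_⟩
  have hR := measurePreserving_timeReversal_restrict (Ω := Ω) (T := T)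
  -- Reversal preserves the `L^∞` bound, the regularity and the lateral condition, and final data
  -- become initial data. Thus the constants of the forward estimate serve for both parts.
  refine carleman_of_timeReversal (H (-ω) (by rwa [norm_neg]) (q ∘ timeReversal T)
    (hq.comp_measurePreserving hR)
    ((eLpNorm_comp_measurePreserving hq.aestronglyMeasurable hR).trans_le hqM)
    (u ∘ timeReversal T)
    (hu.comp contDiff_timeReversal.contDiffOn mapsTo_timeReversal_closedCyl)
    (fun t ht x hx => huS (T - t) ⟨by linarith [ht.2], by linarith [ht.1]⟩ x hx)
    (fun x hx => ⟨?_, ?_⟩) lam hlam)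
  · simpa [timeReversal] using (hu0 x hx).1
  · rw [timeDeriv_timeReversal, sub_zero, (hu0 x hx).2, neg_zero]
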